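/- For positive numbers $A_i,B_j$ and complex $a_i,b_j$ the H-function is $$H^{m,n}_{p,q}\!\left[z\,\middle|\,{(a_1,A_1),\dots,(a_p,A_p)\atop(b_1,B_1),\dots,(b_q,B_q)}\right]=\frac1{2\pi i}\int_{\gamma-i\infty}^{\gamma+i\infty}\frac{\prod_{j=1}^m\Gamma(b_j+B_j\xi)\,\prod_{i=1}^n\Gamma(1-a_i-A_i\xi)}{\prod_{j=m+1}^q\Gamma(1-b_j-B_j\xi)\,\prod_{i=n+1}^p\Gamma(a_i+A_i\xi)}\,z^{-\xi}\,d\xi ,$$ where the line $\operatorname{Re}\xi=\gamma$ has the poles of the $\Gamma(b_j+B_j\xi)$, $j\le m$, on its left and the poles of the $\Gamma(1-a_i-A_i\xi)$, $i\le n$, on its right. It is said to be defined at $z\neq 0$ when such lines exist and the integral converges absolutely along each of them, with a value independent of $\gamma$. **Corollary 1.2.** Let $\alpha>0$, $0<\beta\le 1$, $\eta>0$. Consider $$\frac{\partial^\beta N}{\partial t^\beta}=\eta\;{}_{-\infty}D_x^\alpha N\quad(x\in\mathbb R,\ t>0),\qquad N(x,0)=\delta(x),$$ where $\partial^\beta/\partial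 t^\beta$ is the Caputo derivative, $\frac1{\Gamma(1-\beta)}\int_0^t f'(\tau)(t-\tau)^{-\beta}d\tau$ for $\beta<1$ and $f'(t)$ for $\beta=1$, and ${}_{-\infty}D_x^\alpha$ is the operator with Fourier symbol $-|k|^\alpha$, that is $\widetilde{{}_{-\infty}D_x^\alpha\varphi}(k)=-|k|^\alpha\tilde\varphi(k)$ with $\tilde\varphi(k)=\int\varphi(x)e^{ikx}dx$. By a solution we mean a function $N$ such that $N(\cdot,t)$ is integrable for every $t>0$ with $\int|N(x,t)|\,dx$ bounded on $0<t\le T$ for every $T>0$ and, for every Schwartz function $\varphi$, $\int N(x,t)\varphi(x)\,dx\to\varphi(0)$ as $t\to0+$, and the Caputo derivative of order $\beta$ of $t\mapsto\int N(x,t)\varphi(x)\,dx$ exists and equals $\eta\int N(x,t)\,({}_{-\infty}D_x^\alpha\varphi)(x)\,dx$ for every $t>0$. Then, for $x\ne0$ and $t>0$, the H-function below is defined, the function $$N(x,t)=\frac1{\alpha|x|}H^{2,1}_{3,3}\!\left[\frac{|x|}{(\eta t^\beta)^{1/\alpha}}\,\middle|\,{(1,1/\alpha),(1,\beta/\alpha),(1,1/2)\atop(1,1),(1,1/\alpha),(1,1/2)}\right]$$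 is a solution, and every solution $M$ satisfies, for every $t>0$, $M(x,t)=N(x,t)$ for almost every $x$. If $\beta=1$, then for $x\ne0$ and $t>0$ (the H-functions being defined) $$N(x,t)=\frac1{\alpha|x|}H^{1,1}_{2,2}\!\left[\frac{|x|}{\eta^{1/\alpha}t^{1/\alpha}}\,\middle|\,{(1,1/\alpha),(1,1/2)\atop(1,1),(1,1/2)}\right],$$ and if moreover $\alpha\le2$, then for every $t>0$ this function of $x\neq 0$ is real, nonnegative, and the density of the symmetric Lévy stable law with characteristic function $k\mapsto e^{-\eta t|k|^\alpha}$. If $\beta=1$ and $\alpha=2$, then for $x\ne0$ and $t>0$ (the H-functions being defined) $$N(x,t)=\frac1{2|x|}H^{1,1}_{2,2}\!\left[\frac{|x|}{(\eta t)^{1/2}}\,\middle|\,{(1,1/2),(1,1/2)\atop(1,1),(1,1/2)}\right]=\frac1{2|x|}H^{1,0}_{1,1}\!\left[\frac{|x|}{(\eta t)^{1/2}}\,\middle|\,{(1,1/2)\atop(1,1)}\right]=(4\pi\eta t)^{-1/2}\exp\!\left(-\frac{|x|^2}{4\eta t}\right),$$ and this Gaussian is also the limit, as $\alpha\to2$ with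 $\beta=1$ and $x\neq 0$, $t>0$ fixed, of $N(x,t)$. -/

import Mathlib

open MeasureTheory Filter Topology

noncomputable section

/-! ### The H-function -/

/-- The Mellin–Barnes kernel `Θ(ξ)` of the H-function `H^{m,n}_{p,q}`. An upper parameter is a pair
`(a i).1, (a i).2` (written `(a_i, A_i)`), a lower parameter a pair `(b j).1, (b j).2`
(written `(b_j, B_j)`); the first `n` upper and the first `m` lower ones go to the numerator. -/
def foxTheta (m n : ℕ) {p q : ℕ} (a : Fin p → ℂ × ℝ) (b : Fin q → ℂ × ℝ) (ξ : ℂ) : ℂ :=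
  ((∏ j ∈ Finset.univ.filter (fun j : Fin q => (j : ℕ) < m), Complex.Gamma ((b j).1 + (b j).2 * ξ)) *
    (∏ i ∈ Finset.univ.filter (fun i : Fin p => (i : ℕ) < n), Complex.Gamma (1 - (a i).1 - (a i).2 * ξ))) /
  ((∏ j ∈ Finset.univ.filter (fun j : Fin q => m ≤ (j : ℕ)), Complex.Gamma (1 - (b j).1 - (b j).2 * ξ)) *
    (∏ i ∈ Finset.univ.filter (fun i : Fin p => n ≤ (i : ℕ)), Complex.Gamma ((a i).1 + (a i).2 * ξ)))

/-- The vertical line `Re ξ = γ` separates the poles of the factors `Γ(b_j + B_j ξ)`, `j ≤ m`, which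
are the points `-(b_j + k) / B_j` and lie to its left, from the poles of the factors
`Γ(1 - a_i - A_i ξ)`, `i ≤ n`, which are the points `(1 - a_i + k) / A_i` and lie to its right
(the `A_i`, `B_j` are positive, so that `k = 0` is the critical case). -/
def FoxSeparates (m n : ℕ) {p q : ℕ} (a : Fin p → ℂ × ℝ) (b : Fin q → ℂ × ℝ) (γ : ℝ) : Prop :=
  (∀ j : Fin q, (j : ℕ) < m → 0 < (b j).1.re + (b j).2 * γ) ∧
  (∀ i : Fin p, (i : ℕ) < n → 0 < 1 - (a i).1.re - (a i).2 * γ)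

/-- The integrand `Θ(ξ) z ^ (-ξ)` at the point `ξ = γ + i y` of the vertical line `Re ξ = γ`. -/
def foxIntegrand (m n : ℕ) {p q : ℕ} (a : Fin p → ℂ × ℝ) (b : Fin q → ℂ × ℝ) (z : ℂ) (γ y : ℝ) :
    ℂ :=
  foxTheta m n a b (γ + y * Complex.I) * z ^ (-(γ + y * Complex.I))

/-- The H-function `H^{m,n}_{p,q}[z | (a_p, A_p); (b_q, B_q)]` is defined, with value `w`, through
the contour from `γ - i∞` to `γ + i∞`: the parameters are admissible, there is a vertical line that
separates the two families of poles, and along each such line the Mellin–Barnes integral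
`(2πi)⁻¹ ∫ Θ(ξ) z ^ (-ξ) dξ` converges absolutely and equals `w`
(on the line, `dξ = i dy`). -/
structure HasFoxH (m n : ℕ) {p q : ℕ} (a : Fin p → ℂ × ℝ) (b : Fin q → ℂ × ℝ) (z w : ℂ) :
    Prop where
  one_le_m : 1 ≤ m
  m_le_q : m ≤ q
  n_le_p : n ≤ p
  upper_pos : ∀ i, 0 < (a i).2
  lower_pos : ∀ j, 0 < (b j).2
  arg_ne_zero : z ≠ 0
  exists_contour : ∃ γ : ℝ, FoxSeparates m n a b γ
  integrable : ∀ γ : ℝ, FoxSeparates m n a b γ → Integrable (foxIntegrand m n a b z γ)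
  value : ∀ γ : ℝ, FoxSeparates m n a b γ →
    w = (1 / (2 * Real.pi) : ℂ) * ∫ y : ℝ, foxIntegrand m n a b z γ y

/-- The H-function is defined at `z` (through a vertical contour). -/
def FoxHDefined (m n : ℕ) {p q : ℕ} (a : Fin p → ℂ × ℝ) (b : Fin q → ℂ × ℝ) (z : ℂ) : Prop :=
  ∃ w, HasFoxH m n a b z w

open Classical in
/-- The value `H^{m,n}_{p,q}[z | (a_p, A_p); (b_q, B_q)]`; it is meaningful where `FoxHDefined`
holds. -/
def foxH (m n : ℕ) {p q : ℕ} (a : Fin p → ℂ × ℝ) (b : Fin q → ℂ × ℝ) (z : ℂ) : ℂ :=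
  if h : FoxHDefined m n a b z then h.choose else 0

theorem HasFoxH.unique {m n p q : ℕ} {a : Fin p → ℂ × ℝ} {b : Fin q → ℂ × ℝ} {z w w' : ℂ}
    (h : HasFoxH m n a b z w) (h' : HasFoxH m n a b z w') : w = w' := by
  obtain ⟨γ, hγ⟩ := h.exists_contour
  rw [h.value γ hγ, h'.value γ hγ]

theorem HasFoxH.foxH_eq {m n p q : ℕ} {a : Fin p → ℂ × ℝ} {b : Fin q → ℂ × ℝ} {z w : ℂ}
    (h : HasFoxH m n a b z w) : foxH m n a b z = w := by
  have hd : FoxHDefined m n a b z := ⟨w, h⟩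
  rw [foxH, dif_pos hd]
  exact hd.choose_spec.unique h

/-! ### The fractional derivatives -/

/-- `v` is the Caputo derivative of order `β ∈ (0, 1]` of `f` at `t > 0` (base point `0`): the usual
derivative if `β = 1`, and `Γ(1 - β)⁻¹ ∫₀ᵗ f'(τ) (t - τ) ^ (-β) dτ` if `β < 1`, where `f` has to be
differentiable on `(0, t)` and the integral has to converge absolutely. -/
def HasCaputoDerivAt (β : ℝ) (f : ℝ → ℂ) (v : ℂ) (t : ℝ) : Prop :=
  if β = 1 then HasDerivAt f v t
  else
    (∀ τ ∈ Set.Ioo 0 t, DifferentiableAt ℝ f τ) ∧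
    IntegrableOn (fun τ : ℝ => (((t - τ) ^ (-β) : ℝ) : ℂ) * deriv f τ) (Set.Ioo 0 t) ∧
    v = ((Real.Gamma (1 - β) : ℝ) : ℂ)⁻¹ *
      ∫ τ in Set.Ioo 0 t, (((t - τ) ^ (-β) : ℝ) : ℂ) * deriv f τ

/-- The Fourier transform `h~(k) = ∫ h(x) exp(i k x) dx`. -/
def fourierTilde (h : ℝ → ℂ) (k : ℝ) : ℂ :=
  ∫ x : ℝ, h x * Complex.exp (Complex.I * k * x)

/-- The space-fractional derivative `-∞D_x^α`, understood (the imaginary unit in Fourier space being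
suppressed) as the operator with `F{D^α φ}(k) = -|k| ^ α φ~(k)`, on a rapidly decreasing function:
`D^α φ (x) = (2π)⁻¹ ∫ -|k| ^ α φ~(k) exp(-i k x) dk`. -/
def spaceFracDeriv (α : ℝ) (φ : SchwartzMap ℝ ℂ) (x : ℝ) : ℂ :=
  (1 / (2 * Real.pi) : ℂ) *
    ∫ k : ℝ, -((|k| ^ α : ℝ) : ℂ) * fourierTilde φ k * Complex.exp (-(Complex.I * k * x))

/-! ### Solutions of the equation with initial datum `δ` -/

/-- `N = N(x, t)` solves `∂^β N / ∂t^β = η · D_x^α N` for `t > 0`, with `N(x, 0) = δ(x)`, in the sense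
of distributions in `x`. Since the symbol `-|k| ^ α` is even, `D_x^α` is its own transpose, so
`⟨D_x^α N, φ⟩ = ⟨N, D_x^α φ⟩`. -/
structure IsFundamentalSolution (α β η : ℝ) (N : ℝ → ℝ → ℂ) : Prop where
  /-- `N(·, t)` is integrable, so that it has a Fourier transform. -/
  integrable : ∀ t : ℝ, 0 < t → Integrable (fun x : ℝ => N x t)
  /-- The total mass stays bounded in bounded time. -/
  bounded : ∀ T : ℝ, 0 < T → ∃ C : ℝ, ∀ t ∈ Set.Ioc 0 T, ∫ x : ℝ, ‖N x t‖ ≤ C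
  /-- The equation, tested against rapidly decreasing functions of `x`. -/
  equation : ∀ φ : SchwartzMap ℝ ℂ, ∀ t : ℝ, 0 < t →
    HasCaputoDerivAt β (fun s : ℝ => ∫ x : ℝ, N x s * φ x)
      ((η : ℂ) * ∫ x : ℝ, N x t * spaceFracDeriv α φ x) t
  /-- The initial condition `N(·, 0) = δ`. -/
  initial : ∀ φ : SchwartzMap ℝ ℂ,
    Tendsto (fun t : ℝ => ∫ x : ℝ, N x t * φ x) (𝓝[>] 0) (𝓝 (φ 0))

/-- Upper parameters `(1, 1/α), (1, β/α), (1, 1/2)`. -/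
def upper33 (α β : ℝ) : Fin 3 → ℂ × ℝ := ![(1, 1 / α), (1, β / α), (1, 1 / 2)]

/-- Lower parameters `(1, 1), (1, 1/α), (1, 1/2)`. -/
def lower33 (α : ℝ) : Fin 3 → ℂ × ℝ := ![(1, 1), (1, 1 / α), (1, 1 / 2)]

/-- `N(x,t) = (α |x|)⁻¹ H^{2,1}_{3,3}[|x| / (η t^β)^{1/α} |
(1, 1/α), (1, β/α), (1, 1/2); (1, 1), (1, 1/α), (1, 1/2)]`. -/
def foxSolution (α β η x t : ℝ) : ℂ :=
  1 / ((α * |x| : ℝ) : ℂ) *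
    foxH 2 1 (upper33 α β) (lower33 α) ((|x| / (η * t ^ β) ^ (1 / α) : ℝ) : ℂ)

/-- The symmetric Lévy stable law of index `α` with characteristic function `exp(-c |k| ^ α)`. -/
def IsSymmetricStableLaw (α c : ℝ) (μ : Measure ℝ) : Prop :=
  IsProbabilityMeasure μ ∧
    ∀ k : ℝ, charFun μ k = ((Real.exp (-(c * |k| ^ α)) : ℝ) : ℂ)

end

/-! ### Exponential bounds for Gamma and sine, and shifting of vertical contours. -/

noncomputable section

/-! ### The Laplace transform of a complex power -/

/-! In Fourier variables the equation reads `∂^β N~ = -η |k|^α N~`, `N~(k, 0) = 1`, so `N~(k, t)`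
must be the Mittag-Leffler function `E_β(-η t^β |k|^α)`. Everything is done with Mellin–Barnes
integrals, without power series.

The H-function. By the reflection formula the kernel equals `Γ(1 + s) sin(π s/2) / (sin(π s/α) Γ(1 +
β s/α))`. Its singularity at `0` is removable, and for `β ≤ 1` it decays exponentially in closed
vertical strips inside `max(-1, -α) < Re s < α` (`stripDecay_foxKernel`). Hence the contour can be
shifted freely, also across `0`. Lines on both sides of `0` bound the profile by `z^(-γ-1)` with `γ
< 0` near `0` and `γ > 0` at infinity, so `N(·, t)` is integrable with a norm independent of `t`.

Its Fourier transform. Integrating the contour integral against `exp(± i k x)` over a half-line (as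
a limit of Laplace transforms) multiplies the kernel by `Γ(-s) |k|^s exp(± i π s/2)`. The two halves
add up to a cosine, and the duplication formula for the sine leaves `-π / (sin(π s/α) Γ(1 + β
s/α))`, the Mittag-Leffler kernel at `s/α` (`foxKernel_mul_Gamma`).

Existence. Moving the Mittag-Leffler contour from `Re s = -1/2` to `Re s = 1/2` produces the residue
`1`, which is the initial datum, plus a superposition of powers `t^(β s)` that vanishes as `t → 0+`.
The Caputo derivative of `t^(β s)` is given by a Beta integral; its Gamma quotient shifts the kernel
from `s` to `s - 1` with a minus sign, and this is the action of the symbol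
(`mlKernel_halfLine_sub_one`).

Uniqueness. Let `g n` be the difference of two solutions paired with the Fourier transform of
`(-|2πu|^α)^n χ(u)`, where `χ` is smooth with compact support away from `0`. The Caputo derivative
of `g n` is `η g (n + 1)`, and the `g n` grow at most geometrically in `n`. Inverting the Caputo
derivative and estimating with a weight `exp(σ t)`, `σ` large, gains a factor below `1` at every
step, so `g 0 = 0` (`eq_zero_of_hasCaputoDerivAt_succ`). The Fourier transforms therefore agree off
`0`, and so do the solutions almost everywhere.

The case `β = 1`. Here the Mittag-Leffler function is the exponential, and Fourier inversion gives
`N` as the inverse transform of `exp(-η t |k|^α)`. This yields the limit `α → 2` by dominated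
convergence. For `α < 2` nonnegativity follows because this exponential is a limit of characteristic
functions of rescaled sums of symmetrised Pareto variables. For `α = 2` the duplication formula for
Gamma and Mellin inversion give the Gaussian. -/

theorem integrableOn_cpow_mul_exp_neg_mul {a r : ℂ} (ha : 0 < a.re) (hr : 0 < r.re) :
    IntegrableOn (fun t : ℝ => (t : ℂ) ^ (a - 1) * Complex.exp (-(r * t))) (Set.Ioi 0) := by
  have h1 : IntegrableOn (fun t : ℝ => t ^ (a.re - 1) * Real.exp (-(r.re) * t)) (Set.Ioi 0) := by
    have := integrableOn_rpow_mul_exp_neg_mul_rpow (p := 1) (s := a.re - 1) (b := r.re)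
      (by linarith) one_pos hr
    simpa using this
  refine Integrable.mono' h1 ?_ ?_
  · exact (Measurable.aestronglyMeasurable (by fun_prop))
  · refine (ae_restrict_mem measurableSet_Ioi).mono fun t ht => ?_
    rw [norm_mul, Complex.norm_cpow_eq_rpow_re_of_pos ht, Complex.norm_exp]
    simp

theorem hasDerivAt_integral_cpow_mul_exp_neg_mul {a r : ℂ} (ha : 0 < a.re) (hr : 0 < r.re) :
    HasDerivAt (fun r : ℂ => ∫ t in Set.Ioi (0 : ℝ), (t : ℂ) ^ (a - 1) * Complex.exp (-(r * t)))
      (∫ t in Set.Ioi (0 : ℝ), -((t : ℂ) ^ (a + 1 - 1) * Complex.exp (-(r * t)))) r := by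
  have hs : {z : ℂ | r.re / 2 < z.re} ∈ 𝓝 r :=
    (isOpen_lt continuous_const Complex.continuous_re).mem_nhds (by simp; linarith)
  refine (hasDerivAt_integral_of_dominated_loc_of_deriv_le hs
    (μ := volume.restrict (Set.Ioi 0)) (F := fun (r : ℂ) (t : ℝ) => (t : ℂ) ^ (a - 1) * Complex.exp (-(r * t)))
    (F' := fun (r : ℂ) (t : ℝ) => -((t : ℂ) ^ (a + 1 - 1) * Complex.exp (-(r * t))))
    (bound := fun t : ℝ => ‖(t : ℂ) ^ (a + 1 - 1) * Complex.exp (-(((r.re / 2 : ℝ) : ℂ) * t))‖)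
    ?_ ?_ ?_ ?_ ?_ ?_).2
  · exact Eventually.of_forall fun z => (Measurable.aestronglyMeasurable (by fun_prop))
  · exact integrableOn_cpow_mul_exp_neg_mul ha hr
  · exact (Measurable.aestronglyMeasurable (by fun_prop))
  · refine (ae_restrict_mem measurableSet_Ioi).mono fun t ht z hz => ?_
    have ht : 0 < t := ht
    have hz : r.re / 2 < z.re := hz
    rw [norm_neg, norm_mul, norm_mul]
    refine mul_le_mul_of_nonneg_left ?_ (norm_nonneg _)
    rw [Complex.norm_exp, Complex.norm_exp]
    refine Real.exp_le_exp.2 ?_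
    simp
    nlinarith
  · exact (integrableOn_cpow_mul_exp_neg_mul (by simp; linarith)
      (by rw [Complex.ofReal_re]; linarith)).norm
  · refine (ae_restrict_mem measurableSet_Ioi).mono fun t ht z hz => ?_
    have ht : (t : ℂ) ≠ 0 := Complex.ofReal_ne_zero.2 (ne_of_gt ht)
    have h1 : HasDerivAt (fun z : ℂ => Complex.exp (-(z * t))) (Complex.exp (-(z * t)) * (-(1 * t))) z :=
      (((hasDerivAt_id z).mul_const (t : ℂ)).neg).cexp
    convert! h1.const_mul ((t : ℂ) ^ (a - 1)) using 1
    rw [show a + 1 - 1 = (a - 1) + 1 by ring, Complex.cpow_add _ _ ht, Complex.cpow_one]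
    ring

/-- The Laplace transform of `t ^ (a - 1)` at a complex point of the right half plane. -/
theorem integral_cpow_mul_exp_neg_mul_complex {a r : ℂ} (ha : 0 < a.re) (hr : 0 < r.re) :
    ∫ t in Set.Ioi (0 : ℝ), (t : ℂ) ^ (a - 1) * Complex.exp (-(r * t))
      = (1 / r) ^ a * Complex.Gamma a := by
  let U : Set ℂ := {z : ℂ | 0 < z.re}
  have hU : IsOpen U := isOpen_lt continuous_const Complex.continuous_re
  have hconv : Convex ℝ U := convex_halfSpace_re_gt 0
  have hf : AnalyticOnNhd ℂ (fun r : ℂ => ∫ t in Set.Ioi (0 : ℝ),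
      (t : ℂ) ^ (a - 1) * Complex.exp (-(r * t))) U :=
    DifferentiableOn.analyticOnNhd (fun z hz =>
      (hasDerivAt_integral_cpow_mul_exp_neg_mul ha hz).differentiableAt.differentiableWithinAt) hU
  have hg : AnalyticOnNhd ℂ (fun r : ℂ => (1 / r) ^ a * Complex.Gamma a) U := by
    refine DifferentiableOn.analyticOnNhd (fun z hz => ?_) hU
    have hz' : 0 < z.re := hz
    have hz0 : z ≠ 0 := by rintro rfl; simp at hz'
    refine DifferentiableAt.differentiableWithinAt ?_
    refine DifferentiableAt.mul_const (DifferentiableAt.cpow_const ?_ ?_) _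
    · exact (differentiableAt_const _).div differentiableAt_id hz0
    · left
      rw [one_div, Complex.inv_re]
      exact div_pos hz' (Complex.normSq_pos.2 hz0)
  -- The formula is known for real `r > 0`. Real points accumulate at `1`, so the identity theorem
  -- extends it to the half plane.
  have hfreq : ∃ᶠ z in 𝓝[≠] (1 : ℂ), (∫ t in Set.Ioi (0 : ℝ),
      (t : ℂ) ^ (a - 1) * Complex.exp (-(z * t))) = (1 / z) ^ a * Complex.Gamma a := by
    have h1 : Tendsto (fun x : ℝ => (x : ℂ)) (𝓝[≠] 1) (𝓝[≠] 1) := by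
      refine tendsto_nhdsWithin_iff.2 ⟨?_, ?_⟩
      · exact (Complex.continuous_ofReal.tendsto' 1 1 (by simp)).mono_left nhdsWithin_le_nhds
      · exact eventually_mem_nhdsWithin.mono fun x hx => by
          simpa using hx
    refine h1.frequently (Eventually.frequently ?_)
    have : ∀ᶠ x : ℝ in 𝓝[≠] 1, 0 < x := nhdsWithin_le_nhds (lt_mem_nhds one_pos)
    exact this.mono fun x hx => Complex.integral_cpow_mul_exp_neg_mul_Ioi ha hx
  exact hf.eqOn_of_preconnected_of_frequently_eq hg hconv.isPreconnected
    (show (1 : ℂ) ∈ U by simp [U]) hfreq hr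

/-! ### Bounds for the Gamma function on vertical strips -/

/-- Take `r = exp(iψ)` in the Laplace transform of `t^(s-1)`: the factor `(1/r)^s` has modulus
`exp(θ |Im s|)` for the right sign of `ψ`, while the integral is at most the real one with rate `cos
θ`. Letting `θ` approach `π/2` gives almost the sharp decay, without Stirling's formula. -/
theorem norm_Gamma_le {s : ℂ} (hs : 0 < s.re) {θ : ℝ} (hθ0 : 0 ≤ θ) (hθ : θ < Real.pi / 2) :
    ‖Complex.Gamma s‖ ≤ Real.Gamma s.re * Real.cos θ ^ (-s.re) * Real.exp (-θ * |s.im|) := by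
  -- rotate the ray of integration towards the side where it helps
  obtain ⟨ψ, hψ, hψs⟩ : ∃ ψ : ℝ, |ψ| = θ ∧ ψ * s.im = θ * |s.im| := by
    rcases le_total 0 s.im with h | h
    · exact ⟨θ, abs_of_nonneg hθ0, by rw [abs_of_nonneg h]⟩
    · exact ⟨-θ, by rw [abs_neg, abs_of_nonneg hθ0], by rw [abs_of_nonpos h]; ring⟩
  have hcos : Real.cos ψ = Real.cos θ := by rw [← hψ, Real.cos_abs]
  have hcpos : 0 < Real.cos θ := Real.cos_pos_of_mem_Ioo ⟨by linarith, hθ⟩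
  have hψ2 : -(Real.pi / 2) < ψ ∧ ψ < Real.pi / 2 := abs_lt.1 (hψ ▸ hθ)
  set r : ℂ := Complex.exp (ψ * Complex.I) with hr
  have hrre : r.re = Real.cos θ := by rw [hr, Complex.exp_ofReal_mul_I_re, hcos]
  have key := integral_cpow_mul_exp_neg_mul_complex hs (r := r) (by rw [hrre]; exact hcpos)
  have hrinv : ((1 / r) ^ s) = Complex.exp (-(ψ * Complex.I) * s) := by
    rw [one_div, hr, ← Complex.exp_neg, Complex.cpow_def_of_ne_zero (Complex.exp_ne_zero _),
      Complex.log_exp]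
    · simp; linarith [Real.pi_pos]
    · simp; linarith [Real.pi_pos]
  have hnorm : ‖(1 / r) ^ s‖ = Real.exp (θ * |s.im|) := by
    rw [hrinv, Complex.norm_exp, ← hψs]
    simp
  have hint : ‖∫ t in Set.Ioi (0 : ℝ), (t : ℂ) ^ (s - 1) * Complex.exp (-(r * t))‖ ≤
      ∫ t in Set.Ioi (0 : ℝ), t ^ (s.re - 1) * Real.exp (-(Real.cos θ * t)) := by
    refine (norm_integral_le_integral_norm _).trans (le_of_eq ?_)
    refine setIntegral_congr_fun measurableSet_Ioi fun t ht => ?_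
    rw [norm_mul, Complex.norm_cpow_eq_rpow_re_of_pos ht, Complex.norm_exp]
    simp [hrre]
  rw [key, norm_mul, hnorm, Real.integral_rpow_mul_exp_neg_mul_Ioi hs hcpos] at hint
  have he := Real.exp_pos (θ * |s.im|)
  rw [neg_mul, Real.exp_neg, ← div_eq_mul_inv, le_div_iff₀ he, Real.rpow_neg hcpos.le,
    ← Real.inv_rpow hcpos.le, ← one_div]
  linarith

/-- `f` is `O (exp (r |Im s|))` in the vertical strip `a ≤ Re s ≤ b`, for `|Im s|` large. -/
def StripBound (f : ℂ → ℂ) (a b r : ℝ) : Prop :=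
  ∃ C T : ℝ, ∀ s : ℂ, a ≤ s.re → s.re ≤ b → T ≤ |s.im| → ‖f s‖ ≤ C * Real.exp (r * |s.im|)

namespace StripBound

variable {f g : ℂ → ℂ} {a b r r' : ℝ}

theorem mono_rate (h : StripBound f a b r) (hr : r ≤ r') : StripBound f a b r' := by
  obtain ⟨C, T, h⟩ := h
  refine ⟨|C|, T, fun s h1 h2 h3 => (h s h1 h2 h3).trans ?_⟩
  gcongr
  exact le_abs_self C

theorem mul (hf : StripBound f a b r) (hg : StripBound g a b r') :
    StripBound (fun s => f s * g s) a b (r + r') := by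
  obtain ⟨C, T, hf⟩ := hf
  obtain ⟨D, T', hg⟩ := hg
  refine ⟨C * D, max T T', fun s h1 h2 h3 => ?_⟩
  have h4 := hf s h1 h2 ((le_max_left _ _).trans h3)
  have h5 := hg s h1 h2 ((le_max_right _ _).trans h3)
  rw [norm_mul, add_mul, Real.exp_add]
  calc ‖f s‖ * ‖g s‖ ≤ (C * Real.exp (r * |s.im|)) * (D * Real.exp (r' * |s.im|)) :=
        mul_le_mul h4 h5 (norm_nonneg _) ((norm_nonneg _).trans h4)
    _ = _ := by ring

/-- Only large `|Im s|` matters, so agreement off the real axis is enough. Identities that fail at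
real poles or zeros can therefore be used. -/
theorem congr (hf : StripBound f a b r)
    (h : ∀ s : ℂ, a ≤ s.re → s.re ≤ b → s.im ≠ 0 → g s = f s) : StripBound g a b r := by
  obtain ⟨C, T, hf⟩ := hf
  refine ⟨C, max T 1, fun s h1 h2 h3 => ?_⟩
  rw [h s h1 h2]
  · exact hf s h1 h2 ((le_max_left _ _).trans h3)
  · intro h0
    rw [h0, abs_zero] at h3
    linarith [le_max_right T 1]

theorem of_norm_le {C : ℝ} (h : ∀ s : ℂ, a ≤ s.re → s.re ≤ b → ‖f s‖ ≤ C * Real.exp (r * |s.im|)) :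
    StripBound f a b r := ⟨C, 0, fun s h1 h2 _ => h s h1 h2⟩

theorem const (c : ℂ) : StripBound (fun _ => c) a b 0 :=
  of_norm_le (C := ‖c‖) fun s _ _ => by simp

theorem comp_affine {a' b' A c : ℝ} (hA : A ≠ 0) (hf : StripBound f a' b' r)
    (h : ∀ x, a ≤ x → x ≤ b → a' ≤ c + A * x ∧ c + A * x ≤ b') :
    StripBound (fun s => f (c + A * s)) a b (r * |A|) := by
  obtain ⟨C, T, hf⟩ := hf
  refine ⟨C, T / |A|, fun s h1 h2 h3 => ?_⟩
  have him : |((c : ℂ) + A * s).im| = |A| * |s.im| := by simp [abs_mul]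
  have h4 := hf (c + A * s) (by simpa using (h _ h1 h2).1) (by simpa using (h _ h1 h2).2)
    (by rw [him]; rwa [div_le_iff₀' (abs_pos.2 hA)] at h3)
  rwa [him, ← mul_assoc] at h4

end StripBound

theorem stripBound_Gamma {a b : ℝ} (ha : 0 < a) {θ : ℝ} (hθ0 : 0 ≤ θ) (hθ : θ < Real.pi / 2) :
    StripBound Complex.Gamma a b (-θ) := by
  have hcpos : 0 < Real.cos θ := Real.cos_pos_of_mem_Ioo ⟨by linarith, hθ⟩
  have hc : ContinuousOn (fun x : ℝ => Real.Gamma x * Real.cos θ ^ (-x)) (Set.Icc a b) := by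
    refine ContinuousOn.mul ?_ ?_
    · intro x hx
      refine (Real.differentiableAt_Gamma fun m => ?_).continuousAt.continuousWithinAt
      have h1 : 0 < x := ha.trans_le hx.1
      have h2 : (0 : ℝ) ≤ m := m.cast_nonneg
      linarith
    · exact (Real.continuous_const_rpow hcpos.ne').comp_continuousOn continuousOn_id.neg
  obtain ⟨C, hC⟩ := isCompact_Icc.exists_bound_of_continuousOn hc
  refine StripBound.of_norm_le (C := C) fun s h1 h2 => ?_
  refine (norm_Gamma_le (ha.trans_le h1) hθ0 hθ).trans ?_
  gcongr
  exact (le_abs_self _).trans (hC s.re ⟨h1, h2⟩)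

theorem norm_sin_le (s : ℂ) : ‖Complex.sin s‖ ≤ Real.exp |s.im| := by
  rw [Complex.sin, norm_div, norm_mul, Complex.norm_I, mul_one]
  have h1 : ‖Complex.exp (-s * Complex.I)‖ ≤ Real.exp |s.im| := by
    rw [Complex.norm_exp]; simpa using le_abs_self _
  have h2 : ‖Complex.exp (s * Complex.I)‖ ≤ Real.exp |s.im| := by
    rw [Complex.norm_exp]; simpa using neg_le_abs _
  have h3 := norm_sub_le (Complex.exp (-s * Complex.I)) (Complex.exp (s * Complex.I))
  rw [Complex.norm_ofNat, div_le_iff₀ two_pos]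
  linarith

theorem le_norm_sin {s : ℂ} (hs : 1 ≤ |s.im|) : Real.exp |s.im| / 4 ≤ ‖Complex.sin s‖ := by
  rw [Complex.sin, norm_div, norm_mul, Complex.norm_I, mul_one]
  have h1 : ‖Complex.exp (-s * Complex.I)‖ = Real.exp s.im := by
    rw [Complex.norm_exp]; simp
  have h2 : ‖Complex.exp (s * Complex.I)‖ = Real.exp (-s.im) := by
    rw [Complex.norm_exp]; simp
  have h3 := abs_norm_sub_norm_le (Complex.exp (-s * Complex.I)) (Complex.exp (s * Complex.I))
  have h4 : Real.exp |s.im| / 2 ≤ |Real.exp s.im - Real.exp (-s.im)| := by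
    have h5 : ∀ x : ℝ, 1 ≤ x → Real.exp (-x) ≤ Real.exp x / 2 := fun x hx => by
      have : Real.exp (-x) ≤ 1 := Real.exp_le_one_iff.2 (by linarith)
      have : x + 1 ≤ Real.exp x := Real.add_one_le_exp x
      linarith
    rcases abs_cases s.im with h | h
    · rw [h.1] at hs ⊢
      have := h5 _ hs
      exact le_trans (by linarith) (le_abs_self _)
    · rw [h.1] at hs ⊢
      have := h5 _ hs
      rw [neg_neg] at this
      exact le_trans (by linarith) (neg_le_abs _)
  rw [Complex.norm_ofNat, le_div_iff₀ two_pos]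
  rw [h1, h2] at h3
  linarith

theorem stripBound_sin {a b : ℝ} : StripBound Complex.sin a b 1 :=
  StripBound.of_norm_le (C := 1) fun s _ _ => by simpa using norm_sin_le s

theorem stripBound_sin_inv {a b : ℝ} : StripBound (fun s => (Complex.sin s)⁻¹) a b (-1) := by
  refine ⟨4, 1, fun s _ _ h => ?_⟩
  have h1 := le_norm_sin h
  have h2 := Real.exp_pos |s.im|
  rw [norm_inv, neg_one_mul, Real.exp_neg, ← div_eq_mul_inv, inv_eq_one_div,
    div_le_div_iff₀ (by linarith) h2]
  linarith

/-- For `Re s ≤ 1/2` the reflection formula `1/Γ(s) = Γ(1-s) sin(πs)/π` gives the rate `π - θ`. The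
recursion `1/Γ(s) = 1/((s-1) Γ(s-1))` then carries the bound to the right, as `1/(s-1)` is bounded
away from the real axis. -/
theorem stripBound_Gamma_inv (a b : ℝ) {θ : ℝ} (hθ0 : 0 ≤ θ) (hθ : θ < Real.pi / 2) :
    StripBound (fun s => (Complex.Gamma s)⁻¹) a b (Real.pi - θ) := by
  suffices H : ∀ n : ℕ, ∀ a b : ℝ, b ≤ n / 2 + 1 / 2 →
      StripBound (fun s => (Complex.Gamma s)⁻¹) a b (Real.pi - θ) by
    obtain ⟨n, hn⟩ := exists_nat_ge (2 * b)
    exact H n a b (by linarith)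
  intro n
  induction n with
  | zero =>
    intro a b hb
    have h1 : StripBound (fun s => Complex.Gamma ((1 : ℝ) + (-1 : ℝ) * s)) a b (-θ * |(-1 : ℝ)|) :=
      StripBound.comp_affine (by norm_num)
        (stripBound_Gamma (a := 1 - b) (b := 1 - a) (by norm_num at hb; linarith) hθ0 hθ)
        (fun x h1 h2 => ⟨by linarith, by linarith⟩)
    have h2 : StripBound (fun s => Complex.sin ((0 : ℝ) + (Real.pi : ℝ) * s)) a b (1 * |Real.pi|) :=
      StripBound.comp_affine Real.pi_ne_zero
        (stripBound_sin (a := Real.pi * a) (b := Real.pi * b))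
        (fun x h1 h2 => ⟨by nlinarith [Real.pi_pos], by nlinarith [Real.pi_pos]⟩)
    have h3 := (h1.mul h2).mul (StripBound.const ((Real.pi : ℂ)⁻¹))
    refine (h3.mono_rate ?_).congr fun s _ _ hs => ?_
    · simp [abs_of_pos Real.pi_pos]
    · have hsin : Complex.sin (Real.pi * s) ≠ 0 := by
        intro h
        obtain ⟨k, hk⟩ := Complex.sin_eq_zero_iff.1 h
        have := congrArg Complex.im hk
        simp [hs, Real.pi_ne_zero] at this
      have hpi : (Real.pi : ℂ) ≠ 0 := Complex.ofReal_ne_zero.2 Real.pi_ne_zero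
      have h4 := Complex.Gamma_mul_Gamma_one_sub s
      have h5 : Complex.Gamma s ≠ 0 := by
        intro h0
        rw [h0, zero_mul, eq_comm, div_eq_zero_iff] at h4
        tauto
      have h6 : Complex.Gamma (((1 : ℝ) : ℂ) + ((-1 : ℝ) : ℂ) * s) = Complex.Gamma (1 - s) := by
        congr 1; push_cast; ring
      rw [eq_div_iff hsin] at h4
      rw [h6, Complex.ofReal_zero, zero_add]
      refine inv_eq_of_mul_eq_one_right ?_
      rw [← mul_assoc, ← mul_assoc, h4, mul_inv_cancel₀ hpi]
  | succ n ih =>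
    intro a b hb
    have h1 : StripBound (fun s => (Complex.Gamma (((-1 : ℝ) : ℂ) + (1 : ℝ) * s))⁻¹) a b
        ((Real.pi - θ) * |1|) :=
      StripBound.comp_affine one_ne_zero (ih (a - 1) (b - 1) (by push_cast at hb; linarith))
        (fun x h1 h2 => ⟨by linarith, by linarith⟩)
    have h2 : StripBound (fun s => (s - 1)⁻¹) a b 0 := by
      refine ⟨1, 1, fun s _ _ hs => ?_⟩
      have h3 : |s.im| ≤ ‖s - 1‖ := by simpa using Complex.abs_im_le_norm (s - 1)
      rw [norm_inv, zero_mul, Real.exp_zero, mul_one]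
      exact inv_le_one_of_one_le₀ (hs.trans h3)
    refine ((h1.mul h2).mono_rate (by simp)).congr fun s _ _ hs => ?_
    have h0 : s - 1 ≠ 0 := fun h => hs (by simpa using congrArg Complex.im h)
    have h3 := Complex.Gamma_add_one (s - 1) h0
    rw [sub_add_cancel] at h3
    rw [h3, mul_inv, mul_comm]
    congr 3
    push_cast; ring

theorem stripBound_cpow {z : ℂ} (hz : z ≠ 0) {a b : ℝ} :
    StripBound (fun s => z ^ (-s)) a b |z.arg| := by
  have hn : 0 < ‖z‖ := norm_pos_iff.2 hz
  obtain ⟨C, hC⟩ := (isCompact_Icc (a := a) (b := b)).exists_bound_of_continuousOn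
    (f := fun x : ℝ => ‖z‖ ^ (-x))
    ((Real.continuous_const_rpow hn.ne').comp_continuousOn continuousOn_id.neg)
  refine StripBound.of_norm_le (C := C) fun s h1 h2 => ?_
  rw [Complex.norm_cpow_of_ne_zero hz, div_eq_mul_inv, ← Real.exp_neg]
  have h3 := (le_abs_self _).trans (hC s.re ⟨h1, h2⟩)
  have h4 : -(z.arg * (-s).im) ≤ |z.arg| * |s.im| := by
    rw [← abs_mul]
    simpa using le_abs_self (z.arg * s.im)
  have h5 : ‖z‖ ^ (-s).re = ‖z‖ ^ (-s.re) := by simp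
  rw [h5]
  exact mul_le_mul h3 (Real.exp_le_exp.2 h4) (Real.exp_pos _).le
    ((Real.rpow_nonneg hn.le _).trans h3)

end

noncomputable section

/-! ### Integrals over vertical lines -/

theorem integrableOn_Ioi_comp_neg {f : ℝ → ℂ} (h : Integrable f) :
    IntegrableOn (fun x => f (-x)) (Set.Ioi 0) :=
  h.comp_neg.integrableOn

theorem integrable_comp_abs {E : Type*} [NormedAddCommGroup E] {f : ℝ → E}
    (h : IntegrableOn f (Set.Ioi 0)) : Integrable fun x => f |x| := by
  have h1 : IntegrableOn (fun x => f |x|) (Set.Ioi 0) :=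
    h.congr_fun (fun x hx => by rw [abs_of_pos hx]) measurableSet_Ioi
  have h2 : IntegrableOn (fun x => f |x|) (Set.Iic 0) := by
    rw [← Measure.map_neg_eq_self (volume : Measure ℝ)]
    let m : MeasurableEmbedding fun x : ℝ => -x := (Homeomorph.neg ℝ).measurableEmbedding
    rw [m.integrableOn_map_iff]
    simp_rw [Function.comp_def, abs_neg, Set.neg_preimage, Set.neg_Iic, neg_zero]
    exact Iff.mpr integrableOn_Ici_iff_integrableOn_Ioi h1
  rw [← integrableOn_univ, ← Set.Iic_union_Ioi (a := (0 : ℝ))]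
  exact h2.union h1

theorem integral_eq_integral_Ioi_add_comp_neg {f : ℝ → ℂ} (h : Integrable f) :
    ∫ x, f x = ∫ x in Set.Ioi (0 : ℝ), (f x + f (-x)) := by
  rw [integral_add h.integrableOn (integrableOn_Ioi_comp_neg h), integral_comp_neg_Ioi, neg_zero,
    add_comm, intervalIntegral.integral_Iic_add_Ioi h.integrableOn h.integrableOn]

theorem integrable_exp_neg_mul_abs_real {c : ℝ} (hc : 0 < c) :
    Integrable (fun y : ℝ => Real.exp (-c * |y|)) :=
  integrable_comp_abs (f := fun y => Real.exp (-c * y)) (integrableOn_exp_mul_Ioi (neg_lt_zero.2 hc) 0)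

theorem integrable_of_norm_le_exp {f : ℝ → ℂ} {c C : ℝ} (hc : 0 < c) (hf : AEStronglyMeasurable f)
    (h : ∀ y, ‖f y‖ ≤ C * Real.exp (-c * |y|)) : Integrable f :=
  ((integrable_exp_neg_mul_abs_real hc).const_mul C).mono' hf (Eventually.of_forall h)

/-- A function which is holomorphic at the points of a closed vertical strip and exponentially small
at its two ends. -/
structure StripDecay (f : ℂ → ℂ) (a b : ℝ) : Prop where
  differentiableAt : ∀ s : ℂ, a ≤ s.re → s.re ≤ b → DifferentiableAt ℂ f s
  exists_norm_le : ∃ C c : ℝ, 0 < c ∧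
    ∀ s : ℂ, a ≤ s.re → s.re ≤ b → ‖f s‖ ≤ C * Real.exp (-c * |s.im|)

/-- For large `|Im s|` this is the hypothesis; the rest of the strip is a compact rectangle, on
which `f` is bounded by continuity. -/
theorem StripBound.stripDecay {f : ℂ → ℂ} {a b r : ℝ} (h : StripBound f a b r) (hr : r < 0)
    (hd : ∀ s : ℂ, a ≤ s.re → s.re ≤ b → DifferentiableAt ℂ f s) : StripDecay f a b := by
  refine ⟨hd, ?_⟩
  obtain ⟨C, T, hC⟩ := h
  have hcomp : IsCompact (Set.Icc a b ×ℂ Set.Icc (-T) T) := isCompact_Icc.reProdIm isCompact_Icc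
  obtain ⟨M, hM⟩ := hcomp.exists_bound_of_continuousOn (f := f) fun s hs =>
    (hd s hs.1.1 hs.1.2).continuousAt.continuousWithinAt
  refine ⟨max C (M * Real.exp (-r * T)), -r, neg_pos.2 hr, fun s h1 h2 => ?_⟩
  rw [neg_neg]
  rcases le_total T |s.im| with h3 | h3
  · refine (hC s h1 h2 h3).trans ?_
    gcongr
    exact le_max_left _ _
  · have h4 := hM s ⟨⟨h1, h2⟩, abs_le.1 h3⟩
    have hM0 : 0 ≤ M := (norm_nonneg _).trans h4
    refine h4.trans ?_
    calc M ≤ M * (Real.exp (-r * T) * Real.exp (r * |s.im|)) := by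
          rw [← Real.exp_add]
          refine le_mul_of_one_le_right hM0 (Real.one_le_exp ?_)
          nlinarith
      _ = M * Real.exp (-r * T) * Real.exp (r * |s.im|) := by ring
      _ ≤ _ := by
          gcongr
          exact le_max_right _ _

namespace StripDecay

variable {f g : ℂ → ℂ} {a b : ℝ}

theorem mono (h : StripDecay f a b) {a' b' : ℝ} (ha : a ≤ a') (hb : b' ≤ b) :
    StripDecay f a' b' := by
  obtain ⟨hd, C, c, hc, hC⟩ := h
  exact ⟨fun s h1 h2 => hd s (ha.trans h1) (h2.trans hb), C, c, hc,
    fun s h1 h2 => hC s (ha.trans h1) (h2.trans hb)⟩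

theorem continuous_line (h : StripDecay f a b) {x : ℝ} (h1 : a ≤ x) (h2 : x ≤ b) :
    Continuous fun y : ℝ => f (x + y * Complex.I) := by
  refine continuous_iff_continuousAt.2 fun y => ?_
  refine ContinuousAt.comp (f := fun y : ℝ => (x : ℂ) + y * Complex.I)
    (h.differentiableAt _ (by simpa using h1) (by simpa using h2)).continuousAt (by fun_prop)

theorem exists_line_bound (h : StripDecay f a b) {x : ℝ} (h1 : a ≤ x) (h2 : x ≤ b) :
    ∃ C c : ℝ, 0 < c ∧ ∀ y : ℝ, ‖f (x + y * Complex.I)‖ ≤ C * Real.exp (-c * |y|) := by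
  obtain ⟨-, C, c, hc, hC⟩ := h
  exact ⟨C, c, hc, fun y => by simpa using hC (x + y * Complex.I) (by simpa using h1) (by simpa using h2)⟩

theorem integrable_line (h : StripDecay f a b) {x : ℝ} (h1 : a ≤ x) (h2 : x ≤ b) :
    Integrable fun y : ℝ => f (x + y * Complex.I) := by
  obtain ⟨C, c, hc, hC⟩ := h.exists_line_bound h1 h2
  exact integrable_of_norm_le_exp hc (h.continuous_line h1 h2).aestronglyMeasurable hC

/-- Shifting a vertical line of integration. -/
theorem integral_line_eq (h : StripDecay f a b) (hab : a ≤ b) :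
    ∫ y : ℝ, f (a + y * Complex.I) = ∫ y : ℝ, f (b + y * Complex.I) := by
  obtain ⟨C, c, hc, hC⟩ := h.exists_norm_le
  have hrect : ∀ T : ℝ, 0 ≤ T →
      (∫ x : ℝ in a..b, f (x + (-T : ℝ) * Complex.I)) - (∫ x : ℝ in a..b, f (x + T * Complex.I)) +
      Complex.I • (∫ y : ℝ in -T..T, f (b + y * Complex.I)) -
      Complex.I • (∫ y : ℝ in -T..T, f (a + y * Complex.I)) = 0 := by
    intro T hT
    have := Complex.integral_boundary_rect_eq_zero_of_differentiableOn f ⟨a, -T⟩ ⟨b, T⟩ (by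
      rintro s ⟨hs1, -⟩
      have hs1' : s.re ∈ Set.uIcc a b := hs1
      rw [Set.uIcc_of_le hab] at hs1'
      exact (h.differentiableAt s hs1'.1 hs1'.2).differentiableWithinAt)
    simpa using this
  -- The choices `τ T = T` and `τ T = -T` treat the two horizontal sides at once.
  have hhor : ∀ τ : ℝ → ℝ, (∀ T, |τ T| = |T|) →
      Tendsto (fun T : ℝ => ∫ x : ℝ in a..b, f (x + τ T * Complex.I)) atTop (𝓝 0) := by
    intro τ hτ
    have hlim : Tendsto (fun T : ℝ => C * Real.exp (-c * T) * |b - a|) atTop (𝓝 0) := by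
      have h1 : Tendsto (fun T : ℝ => -c * T) atTop atBot :=
        tendsto_id.const_mul_atTop_of_neg (neg_lt_zero.2 hc)
      simpa using ((Real.tendsto_exp_atBot.comp h1).const_mul C).mul_const |b - a|
    refine squeeze_zero_norm' ?_ hlim
    filter_upwards [eventually_ge_atTop 0] with T hT
    refine intervalIntegral.norm_integral_le_of_norm_le_const fun x hx => ?_
    rw [Set.uIoc_of_le hab] at hx
    simpa [hτ, abs_of_nonneg hT] using
      hC (x + τ T * Complex.I) (by simpa using hx.1.le) (by simpa using hx.2)
  have hver : ∀ x : ℝ, a ≤ x → x ≤ b →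
      Tendsto (fun T : ℝ => ∫ y : ℝ in -T..T, f (x + y * Complex.I)) atTop
        (𝓝 (∫ y : ℝ, f (x + y * Complex.I))) := fun x h1 h2 =>
    intervalIntegral_tendsto_integral (h.integrable_line h1 h2) tendsto_neg_atTop_atBot tendsto_id
  have hlim := (((hhor (fun T => -T) (fun T => abs_neg T)).sub (hhor id fun _ => rfl)).add
    ((hver b hab le_rfl).const_smul Complex.I)).sub ((hver a le_rfl hab).const_smul Complex.I)
  have h0 := tendsto_nhds_unique (hlim.congr' (by
    filter_upwards [eventually_ge_atTop 0] with T hT using hrect T hT)) tendsto_const_nhds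
  rw [sub_zero, zero_add, ← smul_sub, smul_eq_zero, sub_eq_zero] at h0
  exact (h0.resolve_left Complex.I_ne_zero).symm

theorem integral_line_eq_line (h : StripDecay f a b) {x x' : ℝ} (h1 : a ≤ x) (h2 : x ≤ b)
    (h1' : a ≤ x') (h2' : x' ≤ b) :
    ∫ y : ℝ, f (x + y * Complex.I) = ∫ y : ℝ, f (x' + y * Complex.I) := by
  rcases le_total x x' with hx | hx
  · exact (h.mono h1 h2').integral_line_eq hx
  · exact ((h.mono h1' h2).integral_line_eq hx).symm

end StripDecay

/-- The factor `z ^ (-s)` with `z > 0` does not affect the decay. -/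
theorem StripDecay.mul_cpow {f : ℂ → ℂ} {a b : ℝ} (h : StripDecay f a b) {z : ℝ} (hz : 0 < z) :
    StripDecay (fun s => f s * (z : ℂ) ^ (-s)) a b := by
  have hz' : (z : ℂ) ≠ 0 := Complex.ofReal_ne_zero.2 hz.ne'
  obtain ⟨hd, C, c, hc, hC⟩ := h
  have h1 : StripBound f a b (-c) := StripBound.of_norm_le hC
  have h2 := h1.mul (stripBound_cpow hz' (a := a) (b := b))
  rw [Complex.arg_ofReal_of_nonneg hz.le, abs_zero, add_zero] at h2
  exact h2.stripDecay (neg_lt_zero.2 hc) fun s h3 h4 =>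
    (hd s h3 h4).mul (differentiableAt_id.neg.const_cpow (Or.inl hz'))

end

/-! ### The kernels, their H-functions, and the reductions to the stable and Gaussian cases. -/

noncomputable section

/-! ### Mellin–Barnes kernels -/

/-- The entire function `sin (c s) / s`. -/
def sinSlope (c : ℝ) : ℂ → ℂ := dslope (fun s => Complex.sin (c * s)) 0

theorem differentiable_sinSlope (c : ℝ) : Differentiable ℂ (sinSlope c) := by
  have h : Differentiable ℂ fun s : ℂ => Complex.sin (c * s) := by fun_prop
  exact differentiableOn_univ.1 ((Complex.differentiableOn_dslope univ_mem).2 h.differentiableOn)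

theorem sinSlope_of_ne (c : ℝ) {s : ℂ} (hs : s ≠ 0) : sinSlope c s = Complex.sin (c * s) / s := by
  rw [sinSlope, dslope_of_ne _ hs, slope_def_field]
  simp

/-- The zeros of `sin(c s)` are the points `kπ/c`. The one at `0` has been divided out, and the next
ones lie on the boundary of the region. -/
theorem sinSlope_ne_zero {c : ℝ} (hc : c ≠ 0) {s : ℂ} (hs : |c * s.re| < Real.pi) :
    sinSlope c s ≠ 0 := by
  rcases eq_or_ne s 0 with rfl | h0
  · have h : HasDerivAt (fun s : ℂ => Complex.sin (c * s)) (c : ℂ) 0 := by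
      simpa using (((hasDerivAt_id (0 : ℂ)).const_mul (c : ℂ)).csin)
    rw [sinSlope, dslope_same, h.deriv]
    exact Complex.ofReal_ne_zero.2 hc
  · rw [sinSlope_of_ne c h0]
    refine div_ne_zero (fun h => ?_) h0
    obtain ⟨k, hk⟩ := Complex.sin_eq_zero_iff.1 h
    have him : c * s.im = 0 := by simpa using congrArg Complex.im hk
    have hre : c * s.re = k * Real.pi := by simpa using congrArg Complex.re hk
    rw [hre, abs_mul, abs_of_pos Real.pi_pos] at hs
    have hk1 : |(k : ℝ)| < 1 := by
      by_contra! hcon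
      nlinarith [Real.pi_pos]
    have hk0 : k = 0 := by
      rw [← Int.cast_abs] at hk1
      exact Int.abs_lt_one_iff.1 (by exact_mod_cast hk1)
    rw [hk0] at hre
    refine h0 (Complex.ext ?_ ?_)
    · simpa [hc] using hre
    · simpa [hc] using him

/-- The Mellin–Barnes kernel of the solution, continued across its removable singularity `0`. -/
def foxKernel (α β : ℝ) (s : ℂ) : ℂ :=
  Complex.Gamma (1 + s) * (sinSlope (Real.pi / 2) s / sinSlope (Real.pi / α) s) *
    (Complex.Gamma (1 + (β / α : ℝ) * s))⁻¹

/-- The Mellin–Barnes kernel of the solution in the case `β = 1`. -/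
def stableKernel (α : ℝ) (s : ℂ) : ℂ :=
  Complex.Gamma (1 + s) * Complex.Gamma ((-(1 / α) : ℝ) * s) *
    (-Complex.sin ((Real.pi / 2 : ℝ) * s) / Real.pi)

/-- At `θ = π/2` the expression equals `-π/(2α)`. Lowering `θ` by `π/(4(α+1))` gives back exactly
half of it. -/
theorem exists_angle {α : ℝ} (hα : 0 < α) : ∃ θ : ℝ, 0 ≤ θ ∧ θ < Real.pi / 2 ∧
    -θ + Real.pi / 2 - θ / α < 0 := by
  have hpi := Real.pi_pos
  refine ⟨Real.pi / 2 - Real.pi / (4 * (α + 1)), ?_, ?_, ?_⟩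
  · have : Real.pi / (4 * (α + 1)) ≤ Real.pi / 2 := by
      gcongr
      linarith
    linarith
  · have : 0 < Real.pi / (4 * (α + 1)) := by positivity
    linarith
  · have : -(Real.pi / 2 - Real.pi / (4 * (α + 1))) + Real.pi / 2 -
        (Real.pi / 2 - Real.pi / (4 * (α + 1))) / α = -(Real.pi / (4 * α)) := by
      field_simp
      ring
    rw [this]
    have : 0 < Real.pi / (4 * α) := by positivity
    linarith

theorem stripBound_sin_mul {c : ℝ} (hc : 0 < c) (a b : ℝ) :
    StripBound (fun s => Complex.sin (c * s)) a b c := by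
  have := StripBound.comp_affine (a := a) (b := b) (c := 0) hc.ne'
    (stripBound_sin (a := c * a) (b := c * b))
    (fun x h1 h2 => ⟨by nlinarith, by nlinarith⟩)
  simpa [abs_of_pos hc] using this

theorem stripBound_sin_mul_inv {c : ℝ} (hc : 0 < c) (a b : ℝ) :
    StripBound (fun s => (Complex.sin (c * s))⁻¹) a b (-c) := by
  have := StripBound.comp_affine (a := a) (b := b) (c := 0) hc.ne'
    (stripBound_sin_inv (a := c * a) (b := c * b))
    (fun x h1 h2 => ⟨by nlinarith, by nlinarith⟩)
  simpa [abs_of_pos hc] using this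

theorem stripBound_Gamma_one_add {a : ℝ} (ha : -1 < a) (b : ℝ) {θ : ℝ} (hθ0 : 0 ≤ θ)
    (hθ : θ < Real.pi / 2) : StripBound (fun s => Complex.Gamma (1 + s)) a b (-θ) := by
  have := StripBound.comp_affine (a := a) (b := b) (c := 1) one_ne_zero
    (stripBound_Gamma (a := 1 + a) (b := 1 + b) (by linarith) hθ0 hθ)
    (fun x h1 h2 => ⟨by linarith, by linarith⟩)
  simpa using this

theorem stripBound_Gamma_one_add_inv {A : ℝ} (hA : 0 < A) (a b : ℝ) {θ : ℝ} (hθ0 : 0 ≤ θ)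
    (hθ : θ < Real.pi / 2) (d : ℝ) :
    StripBound (fun s => (Complex.Gamma (d + A * s))⁻¹) a b ((Real.pi - θ) * A) := by
  have := StripBound.comp_affine (a := a) (b := b) (c := d) hA.ne'
    (stripBound_Gamma_inv (d + A * a) (d + A * b) hθ0 hθ)
    (fun x h1 h2 => ⟨by nlinarith, by nlinarith⟩)
  simpa [abs_of_pos hA] using this

theorem differentiableAt_Gamma_of_re_pos {s : ℂ} (hs : 0 < s.re) :
    DifferentiableAt ℂ Complex.Gamma s :=
  Complex.differentiableAt_Gamma s fun m hm => by
    rw [hm] at hs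
    simp at hs
    linarith [m.cast_nonneg (α := ℝ)]

/-- The exponential rates add up to `-θ + (π/2 - π/α) + (π - θ) β/α`. Since `β ≤ 1`, this is at most
`-θ + π/2 - θ/α`, which is negative for a suitable angle. The limits of the strip are the first pole
of `Γ(1 + s)` and the first nonzero zeros of `sin(π s/α)`; the point `0` may lie inside. -/
theorem stripDecay_foxKernel {α β : ℝ} (hα : 0 < α) (hβ : 0 < β) (hβ1 : β ≤ 1) {a b : ℝ}
    (ha : -1 < a) (ha' : -α < a) (hb : b < α) : StripDecay (foxKernel α β) a b := by
  have hpi := Real.pi_pos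
  obtain ⟨θ, hθ0, hθ, hθα⟩ := exists_angle hα
  have h := ((stripBound_Gamma_one_add ha b hθ0 hθ).mul
    ((stripBound_sin_mul (half_pos hpi) a b).mul (stripBound_sin_mul_inv (div_pos hpi hα) a b))).mul
    (stripBound_Gamma_one_add_inv (div_pos hβ hα) a b hθ0 hθ 1)
  refine StripBound.stripDecay (r := -θ + (Real.pi / 2 + -(Real.pi / α)) + (Real.pi - θ) * (β / α))
    (h.congr fun s _ _ hs => ?_) ?_ fun s h1 h2 => ?_
  · have h0 : s ≠ 0 := by rintro rfl; simp at hs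
    rw [foxKernel, sinSlope_of_ne _ h0, sinSlope_of_ne _ h0, div_div_div_cancel_right₀ h0,
      div_eq_mul_inv]
    simp
  · have : (Real.pi - θ) * (β / α) ≤ (Real.pi - θ) * (1 / α) := by
      have : 0 ≤ Real.pi - θ := by linarith
      gcongr
    have h3 : (Real.pi - θ) * (1 / α) = Real.pi / α - θ / α := by ring
    linarith
  · have hs1 : 0 < (1 + s).re := by simp; linarith
    have hs2 : |Real.pi / α * s.re| < Real.pi := by
      rw [abs_mul, abs_of_pos (div_pos hpi hα), div_mul_eq_mul_div, div_lt_iff₀ hα]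
      have : |s.re| < α := abs_lt.2 ⟨by linarith, by linarith⟩
      nlinarith
    refine DifferentiableAt.mul (DifferentiableAt.mul ?_ ?_) ?_
    · exact (differentiableAt_Gamma_of_re_pos hs1).comp s (by fun_prop)
    · exact ((differentiable_sinSlope _) s).div ((differentiable_sinSlope _) s)
        (sinSlope_ne_zero (div_pos hpi hα).ne' hs2)
    · exact (Complex.differentiable_one_div_Gamma _).comp s
        (f := fun s => 1 + ((β / α : ℝ) : ℂ) * s) (by fun_prop)

/-- The factor `Γ(-s/α)` is holomorphic on all of `Re s < 0`, so the bound `-α < Re s` disappears.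
-/
theorem stripDecay_stableKernel {α : ℝ} (hα : 0 < α) {a b : ℝ} (ha : -1 < a) (hb : b < 0) :
    StripDecay (stableKernel α) a b := by
  have hpi := Real.pi_pos
  have hpi0 : (Real.pi : ℂ) ≠ 0 := Complex.ofReal_ne_zero.2 hpi.ne'
  obtain ⟨θ, hθ0, hθ, hθα⟩ := exists_angle hα
  have hαi : 0 < 1 / α := by positivity
  have h2 : StripBound (fun s => Complex.Gamma ((-(1 / α) : ℝ) * s)) a b (-θ * (1 / α)) := by
    have := StripBound.comp_affine (A := -(1 / α)) (a := a) (b := b) (c := 0) (neg_ne_zero.2 hαi.ne')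
      (stripBound_Gamma (a := -(1 / α) * b) (b := -(1 / α) * a) (by nlinarith) hθ0 hθ)
      (fun x h1 h2 => ⟨by nlinarith, by nlinarith⟩)
    rw [abs_neg, abs_of_pos hαi] at this
    simpa using this
  have h := ((stripBound_Gamma_one_add ha b hθ0 hθ).mul h2).mul
    ((stripBound_sin_mul (half_pos hpi) a b).mul (StripBound.const (-(Real.pi : ℂ)⁻¹)))
  refine StripBound.stripDecay (r := -θ + -θ * (1 / α) + (Real.pi / 2 + 0))
    (h.congr fun s _ _ hs => ?_) ?_ fun s h1 h2 => ?_
  · rw [stableKernel]; ring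
  · have : -θ * (1 / α) = - (θ / α) := by ring
    linarith
  · have hs1 : 0 < (1 + s).re := by simp; linarith
    have hs2 : 0 < (((-(1 / α) : ℝ) : ℂ) * s).re := by
      rw [Complex.re_ofReal_mul]; nlinarith
    refine DifferentiableAt.mul (DifferentiableAt.mul ?_ ?_) ?_
    · exact (differentiableAt_Gamma_of_re_pos hs1).comp s (by fun_prop)
    · exact (differentiableAt_Gamma_of_re_pos hs2).comp s
        (f := fun s => ((-(1 / α) : ℝ) : ℂ) * s) (by fun_prop)
    · fun_prop

/-! ### Existence of H-functions -/

/-- The inverse Mellin transform along `Re s = γ`. -/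
def mellinBarnes (f : ℂ → ℂ) (γ z : ℝ) : ℂ :=
  (1 / (2 * Real.pi) : ℂ) *
    ∫ y : ℝ, f (γ + y * Complex.I) * (z : ℂ) ^ (-(γ + y * Complex.I))

theorem StripDecay.mellinBarnes_eq {f : ℂ → ℂ} {a b : ℝ} (h : StripDecay f a b) {z : ℝ} (hz : 0 < z)
    {γ γ' : ℝ} (h1 : a ≤ γ) (h2 : γ ≤ b) (h1' : a ≤ γ') (h2' : γ' ≤ b) :
    mellinBarnes f γ z = mellinBarnes f γ' z := by
  rw [mellinBarnes, mellinBarnes, (h.mul_cpow hz).integral_line_eq_line h1 h2 h1' h2']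

/-- A kernel that is holomorphic and exponentially small between any two separating lines gives an
absolutely convergent integral, whose value does not depend on the line by Cauchy's theorem.
Agreement with `Θ` is needed only on these lines, so `Θ` may be a holomorphic continuation. -/
theorem hasFoxH_of_stripDecay {m n p q : ℕ} {a : Fin p → ℂ × ℝ} {b : Fin q → ℂ × ℝ} {Θ : ℂ → ℂ}
    (hm : 1 ≤ m) (hmq : m ≤ q) (hnp : n ≤ p) (ha : ∀ i, 0 < (a i).2) (hb : ∀ j, 0 < (b j).2)
    (hΘ : ∀ γ : ℝ, FoxSeparates m n a b γ → ∀ y : ℝ,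
      foxTheta m n a b (γ + y * Complex.I) = Θ (γ + y * Complex.I))
    (hdec : ∀ γ γ' : ℝ, FoxSeparates m n a b γ → FoxSeparates m n a b γ' → StripDecay Θ γ γ')
    {γ₀ : ℝ} (hγ₀ : FoxSeparates m n a b γ₀) {z : ℝ} (hz : 0 < z) :
    HasFoxH m n a b z (mellinBarnes Θ γ₀ z) where
  one_le_m := hm
  m_le_q := hmq
  n_le_p := hnp
  upper_pos := ha
  lower_pos := hb
  arg_ne_zero := Complex.ofReal_ne_zero.2 hz.ne'
  exists_contour := ⟨γ₀, hγ₀⟩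
  integrable := fun γ hγ => by
    refine (((hdec γ γ hγ hγ).mul_cpow hz).integrable_line le_rfl le_rfl).congr ?_
    exact Eventually.of_forall fun y => by simp only [foxIntegrand, hΘ γ hγ y]
  value := fun γ hγ => by
    simp only [foxIntegrand, hΘ γ hγ]
    change _ = mellinBarnes Θ γ z
    rcases le_total γ₀ γ with h | h
    · exact (hdec γ₀ γ hγ₀ hγ).mellinBarnes_eq hz le_rfl h h le_rfl
    · exact (hdec γ γ₀ hγ hγ₀).mellinBarnes_eq hz h le_rfl le_rfl h

theorem foxSeparates_33 {α : ℝ} (hα : 0 < α) (β γ : ℝ) :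
    FoxSeparates 2 1 (upper33 α β) (lower33 α) γ ↔ -1 < γ ∧ -α < γ ∧ γ < 0 := by
  have h1 : 0 < 1 + α⁻¹ * γ ↔ -α < γ := by
    rw [inv_mul_eq_div, ← neg_lt_iff_pos_add', lt_div_iff₀ hα]
    simp
  have h2 : α⁻¹ * γ < 0 ↔ γ < 0 := by
    rw [inv_mul_eq_div, div_neg_iff]; constructor
    · rintro (h | h) <;> linarith
    · intro h; right; exact ⟨h, hα⟩
  simp [FoxSeparates, upper33, lower33, Fin.forall_fin_succ, h1, h2]
  grind

/-- Holds at integers too: there one Gamma factor is at a pole and has the default value `0`, as has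
the division by `sin(π w) = 0`. -/
theorem Gamma_neg_mul_Gamma_one_add (w : ℂ) :
    Complex.Gamma (-w) * Complex.Gamma (1 + w) = -(Real.pi / Complex.sin (Real.pi * w)) := by
  have := Complex.Gamma_mul_Gamma_one_sub (-w)
  rwa [sub_neg_eq_add, mul_neg, Complex.sin_neg, div_neg] at this

/-- The parameters `1/α` and `1/2` each contribute a pair `Γ(-w) Γ(1 + w)`, one in the numerator and
one in the denominator. The reflection formula turns their quotient into a quotient of sines. -/
theorem foxTheta_33 {α : ℝ} (β : ℝ) {s : ℂ} (hs : s ≠ 0) :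
    foxTheta 2 1 (upper33 α β) (lower33 α) s = foxKernel α β s := by
  have h1 := Gamma_neg_mul_Gamma_one_add (((1 / α : ℝ) : ℂ) * s)
  have h2 := Gamma_neg_mul_Gamma_one_add (((1 / 2 : ℝ) : ℂ) * s)
  have hpi : (Real.pi : ℂ) ≠ 0 := Complex.ofReal_ne_zero.2 Real.pi_ne_zero
  have e1 : Complex.sin (Real.pi * (((1 / α : ℝ) : ℂ) * s)) =
      Complex.sin ((Real.pi / α : ℝ) * s) := by congr 1; push_cast; ring
  have e2 : Complex.sin (Real.pi * (((1 / 2 : ℝ) : ℂ) * s)) =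
      Complex.sin ((Real.pi / 2 : ℝ) * s) := by congr 1; push_cast; ring
  rw [e1] at h1
  rw [e2] at h2
  have key : foxTheta 2 1 (upper33 α β) (lower33 α) s =
      Complex.Gamma (1 + s) *
      (Complex.Gamma (-(((1 / α : ℝ) : ℂ) * s)) * Complex.Gamma (1 + ((1 / α : ℝ) : ℂ) * s)) /
      (Complex.Gamma (-(((1 / 2 : ℝ) : ℂ) * s)) * Complex.Gamma (1 + ((1 / 2 : ℝ) : ℂ) * s)) *
      (Complex.Gamma (1 + (β / α : ℝ) * s))⁻¹ := by
    simp [foxTheta, upper33, lower33, Finset.prod_filter, Fin.prod_univ_three]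
    field_simp
  rw [key, h1, h2, foxKernel, sinSlope_of_ne _ hs, sinSlope_of_ne _ hs, div_div_div_cancel_right₀ hs]
  field_simp

end

noncomputable section

/-! ### The H-function of the solution and its reductions for `β = 1` -/

/-- Separating lines have `γ < 0`, yet the value may be computed on any line up to `γ < α`: the
continued kernel has no pole at `0`. -/
theorem hasFoxH_33 {α β : ℝ} (hα : 0 < α) (hβ : 0 < β) (hβ1 : β ≤ 1) {z : ℝ} (hz : 0 < z) {γ : ℝ}
    (h1 : -1 < γ) (h2 : -α < γ) (h3 : γ < α) :
    HasFoxH 2 1 (upper33 α β) (lower33 α) z (mellinBarnes (foxKernel α β) γ z) := by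
  have hex : ∃ γ₀ : ℝ, -1 < γ₀ ∧ -α < γ₀ ∧ γ₀ < 0 := by
    have := lt_min one_pos hα
    have h4 := min_le_left 1 α
    have h5 := min_le_right 1 α
    exact ⟨-(min 1 α) / 2, by linarith, by linarith, by linarith⟩
  obtain ⟨γ₀, h⟩ := hex
  have hmain : HasFoxH 2 1 (upper33 α β) (lower33 α) z (mellinBarnes (foxKernel α β) γ₀ z) := by
    refine hasFoxH_of_stripDecay (by norm_num) (by norm_num) (by norm_num) ?_ ?_ ?_ ?_
      ((foxSeparates_33 hα β γ₀).2 h) hz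
    · intro i
      fin_cases i <;> simp [upper33] <;> positivity
    · intro i
      fin_cases i <;> simp [lower33, hα]
    · intro γ hγ y
      obtain ⟨-, -, h6⟩ := (foxSeparates_33 hα β γ).1 hγ
      refine foxTheta_33 β fun h0 => ?_
      have := congrArg Complex.re h0
      simp at this
      linarith
    · intro γ γ' hγ hγ'
      rw [foxSeparates_33 hα β] at hγ hγ'
      exact stripDecay_foxKernel hα hβ hβ1 hγ.1 hγ.2.1 (by linarith)
  convert hmain using 1
  rcases le_total γ γ₀ with hle | hle
  · exact (stripDecay_foxKernel hα hβ hβ1 h1 h2 (by linarith)).mellinBarnes_eq hz le_rfl hle hle le_rfl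
  · exact (stripDecay_foxKernel hα hβ hβ1 h.1 h.2.1 h3).mellinBarnes_eq hz hle le_rfl le_rfl hle

theorem solution_arg_pos {η t x : ℝ} (α β : ℝ) (hη : 0 < η) (ht : 0 < t) (hx : x ≠ 0) :
    0 < |x| / (η * t ^ β) ^ (1 / α) := by
  have := abs_pos.2 hx
  positivity

theorem foxSolution_eq {α β η : ℝ} (hα : 0 < α) (hβ : 0 < β) (hβ1 : β ≤ 1) (hη : 0 < η) {x t : ℝ}
    (hx : x ≠ 0) (ht : 0 < t) {γ : ℝ} (h1 : -1 < γ) (h2 : -α < γ) (h3 : γ < α) :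
    foxSolution α β η x t = 1 / ((α * |x| : ℝ) : ℂ) *
      mellinBarnes (foxKernel α β) γ (|x| / (η * t ^ β) ^ (1 / α)) := by
  rw [foxSolution, (hasFoxH_33 hα hβ hβ1 (solution_arg_pos α β hη ht hx) h1 h2 h3).foxH_eq]

/-- For `β = 1` the reciprocal of `Γ(1 + s/α)` and the sine in the denominator combine to `Γ(-s/α)`.
-/
theorem foxKernel_one {α : ℝ} (hα : 0 < α) {s : ℂ} (hs : s ≠ 0) (h : -α < s.re) :
    foxKernel α 1 s = stableKernel α s := by
  have h1 := Gamma_neg_mul_Gamma_one_add (((1 / α : ℝ) : ℂ) * s)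
  have hpi : (Real.pi : ℂ) ≠ 0 := Complex.ofReal_ne_zero.2 Real.pi_ne_zero
  have e1 : Complex.sin (Real.pi * (((1 / α : ℝ) : ℂ) * s)) =
      Complex.sin ((Real.pi / α : ℝ) * s) := by congr 1; push_cast; ring
  rw [e1] at h1
  have h2 : Complex.Gamma (1 + ((1 / α : ℝ) : ℂ) * s) ≠ 0 := by
    refine Complex.Gamma_ne_zero_of_re_pos ?_
    rw [Complex.add_re, Complex.re_ofReal_mul, Complex.one_re, one_div_mul_eq_div]
    have : -1 < s.re / α := by rwa [lt_div_iff₀ hα, neg_one_mul]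
    linarith
  rw [← eq_div_iff h2] at h1
  rw [foxKernel, stableKernel, sinSlope_of_ne _ hs, sinSlope_of_ne _ hs,
    div_div_div_cancel_right₀ hs, Complex.ofReal_neg, neg_mul, h1]
  field_simp

theorem foxTheta_22 (α : ℝ) (s : ℂ) :
    foxTheta 1 1 ![(1, 1 / α), (1, 1 / 2)] ![(1, 1), (1, 1 / 2)] s = stableKernel α s := by
  have h2 := Gamma_neg_mul_Gamma_one_add (((1 / 2 : ℝ) : ℂ) * s)
  have e2 : Complex.sin (Real.pi * (((1 / 2 : ℝ) : ℂ) * s)) =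
      Complex.sin ((Real.pi / 2 : ℝ) * s) := by congr 1; push_cast; ring
  rw [e2] at h2
  have key : foxTheta 1 1 ![(1, 1 / α), (1, 1 / 2)] ![(1, 1), (1, 1 / 2)] s =
      Complex.Gamma (1 + s) * Complex.Gamma (-(((1 / α : ℝ) : ℂ) * s)) /
      (Complex.Gamma (-(((1 / 2 : ℝ) : ℂ) * s)) * Complex.Gamma (1 + ((1 / 2 : ℝ) : ℂ) * s)) := by
    simp [foxTheta, Finset.prod_filter, Fin.prod_univ_two]
  rw [key, h2, stableKernel, Complex.ofReal_neg, neg_mul, div_neg, div_div_eq_mul_div]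
  ring

theorem foxSeparates_22 (α γ : ℝ) (hα : 0 < α) :
    FoxSeparates 1 1 ![((1 : ℂ), 1 / α), (1, 1 / 2)] ![((1 : ℂ), (1 : ℝ)), (1, 1 / 2)] γ ↔
      -1 < γ ∧ γ < 0 := by
  have h2 : α⁻¹ * γ < 0 ↔ γ < 0 := by
    rw [inv_mul_eq_div, div_neg_iff]; constructor
    · rintro (h | h) <;> linarith
    · intro h; right; exact ⟨h, hα⟩
  simp [FoxSeparates, h2]
  grind

theorem hasFoxH_22 {α : ℝ} (hα : 0 < α) {z : ℝ} (hz : 0 < z) {γ : ℝ} (h1 : -1 < γ) (h2 : γ < 0) :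
    HasFoxH 1 1 ![((1 : ℂ), 1 / α), (1, 1 / 2)] ![((1 : ℂ), (1 : ℝ)), (1, 1 / 2)] z
      (mellinBarnes (stableKernel α) γ z) := by
  refine hasFoxH_of_stripDecay (by norm_num) (by norm_num) (by norm_num) ?_ ?_ ?_ ?_
    ((foxSeparates_22 α γ hα).2 ⟨h1, h2⟩) hz
  · intro i
    fin_cases i <;> simp [hα]
  · intro i
    fin_cases i <;> simp
  · intro γ hγ y
    exact foxTheta_22 α _
  · intro γ γ' hγ hγ'
    rw [foxSeparates_22 α _ hα] at hγ hγ'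
    exact stripDecay_stableKernel hα hγ.1 hγ'.2

theorem foxSolution_one_eq {α η : ℝ} (hα : 0 < α) (hη : 0 < η) {x t : ℝ}
    (hx : x ≠ 0) (ht : 0 < t) {γ : ℝ} (h1 : -1 < γ) (h3 : γ < 0) :
    foxSolution α 1 η x t = 1 / ((α * |x| : ℝ) : ℂ) *
      mellinBarnes (stableKernel α) γ (|x| / (η ^ (1 / α) * t ^ (1 / α))) := by
  have hm := lt_min one_pos hα
  have h4 := min_le_left 1 α
  have h5 := min_le_right 1 α
  have hz := solution_arg_pos α 1 hη ht hx
  -- The line `Re s = -(min 1 α)/2` is admissible for both kernels. From there the line is moved to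
  -- `γ`, using the wider strip of the stable kernel.
  rw [foxSolution_eq hα one_pos le_rfl hη hx ht (γ := -(min 1 α) / 2) (by linarith) (by linarith)
    (by linarith)]
  rw [Real.rpow_one, Real.mul_rpow hη.le ht.le] at *
  congr 1
  have e : mellinBarnes (foxKernel α 1) (-(min 1 α) / 2) (|x| / (η ^ (1 / α) * t ^ (1 / α))) =
      mellinBarnes (stableKernel α) (-(min 1 α) / 2) (|x| / (η ^ (1 / α) * t ^ (1 / α))) := by
    rw [mellinBarnes, mellinBarnes]
    congr 2
    funext y
    rw [foxKernel_one hα]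
    · intro h0
      have := congrArg Complex.re h0
      simp at this
      linarith
    · simp
      linarith
  rw [e]
  rcases le_total γ (-(min 1 α) / 2) with hle | hle
  · exact ((stripDecay_stableKernel hα h1 (by linarith)).mellinBarnes_eq hz le_rfl hle hle le_rfl).symm
  · exact (stripDecay_stableKernel hα (by linarith) h3).mellinBarnes_eq hz le_rfl hle hle le_rfl

/-- The Mellin–Barnes kernel of the Gaussian. -/
def gaussKernel (s : ℂ) : ℂ :=
  (2 : ℂ) ^ s * (Real.sqrt Real.pi : ℂ)⁻¹ * Complex.Gamma ((1 + s) / 2)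

theorem stripDecay_gaussKernel {a b : ℝ} (ha : -1 < a) : StripDecay gaussKernel a b := by
  have h1 : StripBound (fun s => Complex.Gamma ((1 / 2 : ℝ) + (1 / 2 : ℝ) * s)) a b
      (-1 * |(1 / 2 : ℝ)|) :=
    StripBound.comp_affine (by norm_num)
      (stripBound_Gamma (a := 1 / 2 + 1 / 2 * a) (b := 1 / 2 + 1 / 2 * b) (by linarith) zero_le_one
        (by linarith [Real.pi_gt_three]))
      (fun x h1 h2 => ⟨by linarith, by linarith⟩)
  have h2 := stripBound_cpow (z := ((1 / 2 : ℝ) : ℂ)) (by norm_num) (a := a) (b := b)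
  rw [Complex.arg_ofReal_of_nonneg (by norm_num)] at h2
  have h3 := (h2.mul (StripBound.const (Real.sqrt Real.pi : ℂ)⁻¹)).mul h1
  refine (h3.congr fun s _ _ _ => ?_).stripDecay (by norm_num) fun s h4 _ => ?_
  · rw [gaussKernel]
    congr 2
    · rw [Complex.cpow_neg, one_div, Complex.ofReal_inv, Complex.inv_cpow, inv_inv]
      · simp
      · rw [Complex.arg_ofReal_of_nonneg (by norm_num)]
        exact Real.pi_ne_zero.symm
    · push_cast; ring
  · refine DifferentiableAt.mul (DifferentiableAt.mul_const ?_ _) ?_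
    · exact differentiableAt_id.const_cpow (Or.inl two_ne_zero)
    · refine (differentiableAt_Gamma_of_re_pos ?_).comp s (f := fun s => (1 + s) / 2) (by fun_prop)
      simp
      linarith

/-- The function with Mellin transform `gaussKernel`. -/
def gaussProfile (z : ℝ) : ℂ :=
  (Real.sqrt Real.pi : ℂ)⁻¹ • ((z : ℂ) ^ (1 : ℂ) •
    (fun u : ℝ => (fun v : ℝ => ((Real.exp (-v) : ℝ) : ℂ)) (1 / 4 * u)) (z ^ (2 : ℝ)))

/-- The profile is `z exp(-z²/4)/√π`, written so that the Mellin rules apply in turn: the factor `z`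
shifts `s` to `s + 1`, the substitution `u = z²` halves it, and the scale `1/4` gives a power. -/
theorem mellin_gaussProfile {s : ℂ} (hs : -1 < s.re) : mellin gaussProfile s = gaussKernel s := by
  have h1 : 0 < ((s + 1) / (2 : ℝ)).re := by simp; linarith
  unfold gaussProfile
  rw [mellin_const_smul, mellin_cpow_smul, mellin_comp_rpow (fun u : ℝ =>
    (fun v : ℝ => ((Real.exp (-v) : ℝ) : ℂ)) (1 / 4 * u)), mellin_comp_mul_left (fun v : ℝ => ((Real.exp (-v) : ℝ) : ℂ)) _
      (by norm_num : (0 : ℝ) < 1 / 4),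
    ← Complex.GammaIntegral_eq_mellin, ← Complex.Gamma_eq_integral h1, gaussKernel]
  -- The factor `2` cancels the `1/2` produced by the substitution `u = z²`.
  have h2 : ((1 / 4 : ℝ) : ℂ) ^ (-((s + 1) / (2 : ℝ))) = 2 * 2 ^ s := by
    have h3 : ((1 / 4 : ℝ) : ℂ) = Complex.exp (((-2 * Real.log 2 : ℝ) : ℂ)) := by
      rw [← Complex.ofReal_exp, show -2 * Real.log 2 = -(Real.log 2 + Real.log 2) by ring,
        Real.exp_neg, Real.exp_add, Real.exp_log two_pos]
      norm_num
    have h4 : (2 : ℂ) = Complex.exp (Real.log 2 : ℝ) := by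
      rw [← Complex.ofReal_exp, Real.exp_log two_pos]; simp
    rw [h3, Complex.cpow_def_of_ne_zero (Complex.exp_ne_zero _), Complex.log_exp
      (by rw [Complex.ofReal_im]; linarith [Real.pi_pos]) (by rw [Complex.ofReal_im]; exact Real.pi_pos.le), Complex.cpow_def_of_ne_zero two_ne_zero]
    conv_rhs => enter [1]; rw [h4]
    rw [← Complex.exp_add, ← Complex.ofReal_ofNat 2, ← Complex.ofReal_log two_pos.le]
    congr 1
    push_cast
    ring
  rw [h2]
  simp only [smul_eq_mul, abs_two, Complex.real_smul]
  rw [show (s + 1) / ((2 : ℝ) : ℂ) = (1 + s) / 2 by push_cast; ring]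
  push_cast
  ring

theorem mellinConvergent_gaussProfile {s : ℂ} (hs : -1 < s.re) : MellinConvergent gaussProfile s := by
  have h1 : 0 < ((s + 1) / (2 : ℝ)).re := by simp; linarith
  refine MellinConvergent.const_smul ?_ _
  rw [MellinConvergent.cpow_smul, MellinConvergent.comp_rpow (f := fun u : ℝ =>
    (fun v : ℝ => ((Real.exp (-v) : ℝ) : ℂ)) (1 / 4 * u)) two_ne_zero,
    MellinConvergent.comp_mul_left (f := fun v : ℝ => ((Real.exp (-v) : ℝ) : ℂ))
      (by norm_num : (0 : ℝ) < 1 / 4)]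
  have := Complex.GammaIntegral_convergent h1
  simpa only [MellinConvergent, smul_eq_mul, mul_comm] using this

/-- This is Mellin inversion for the Gaussian profile, legitimate on every line `γ > -1`. -/
theorem mellinBarnes_gaussKernel {γ : ℝ} (h : -1 < γ) {z : ℝ} (hz : 0 < z) :
    mellinBarnes gaussKernel γ z = ((z / Real.sqrt Real.pi * Real.exp (-(z ^ 2 / 4)) : ℝ) : ℂ) := by
  have hg : ∀ y : ℝ, mellin gaussProfile (γ + y * Complex.I) = gaussKernel (γ + y * Complex.I) :=
    fun y => mellin_gaussProfile (by simpa using h)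
  have hcont : ContinuousAt gaussProfile z := by
    unfold gaussProfile
    simp only [Complex.cpow_one]
    have h2 : ContinuousAt (fun z : ℝ => z ^ (2 : ℝ)) z :=
      Real.continuousAt_rpow_const _ _ (Or.inl hz.ne')
    fun_prop
  have hinv := mellinInv_mellin_eq γ gaussProfile hz
    (mellinConvergent_gaussProfile (by simpa using h)) (by
      simp only [Complex.VerticalIntegrable, hg]
      exact (stripDecay_gaussKernel h).integrable_line le_rfl le_rfl) hcont
  have h1 : mellinBarnes gaussKernel γ z = mellinInv γ (mellin gaussProfile) z := by
    simp only [mellinBarnes, mellinInv, hg, Complex.real_smul, smul_eq_mul]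
    push_cast
    congr 2
    funext y
    ring
  rw [h1, hinv, gaussProfile]
  simp only [Complex.cpow_one, smul_eq_mul, Real.rpow_two]
  push_cast
  ring_nf

/-- Legendre's duplication formula at `(1 + s)/2` turns `Γ(1 + s)/Γ(1 + s/2)` into a single Gamma
factor. -/
theorem foxTheta_11 {s : ℂ} (hs : -1 < s.re) :
    foxTheta 1 0 ![((1 : ℂ), (1 / 2 : ℝ))] ![((1 : ℂ), (1 : ℝ))] s = gaussKernel s := by
  have key : foxTheta 1 0 ![((1 : ℂ), (1 / 2 : ℝ))] ![((1 : ℂ), (1 : ℝ))] s =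
      Complex.Gamma (1 + s) / Complex.Gamma (1 + s / 2) := by
    simp [foxTheta]
    congr 3
    ring
  have h1 := Complex.Gamma_mul_Gamma_add_half ((1 + s) / 2)
  have h2 : Complex.Gamma (1 + s / 2) ≠ 0 :=
    Complex.Gamma_ne_zero_of_re_pos (by simp; linarith)
  have h3 : (Real.sqrt Real.pi : ℂ) ≠ 0 :=
    Complex.ofReal_ne_zero.2 (Real.sqrt_pos.2 Real.pi_pos).ne'
  have h4 : (2 : ℂ) ^ s ≠ 0 := by simp [Complex.cpow_eq_zero_iff]
  rw [show (1 + s) / 2 + 1 / 2 = 1 + s / 2 by ring, show 2 * ((1 + s) / 2) = 1 + s by ring,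
    show 1 - (1 + s) = -s by ring, Complex.cpow_neg] at h1
  rw [key, gaussKernel, div_eq_iff h2, mul_assoc, h1]
  field_simp

theorem hasFoxH_11 {z : ℝ} (hz : 0 < z) {γ : ℝ} (h1 : -1 < γ) :
    HasFoxH 1 0 ![((1 : ℂ), (1 / 2 : ℝ))] ![((1 : ℂ), (1 : ℝ))] z (mellinBarnes gaussKernel γ z) := by
  have hsep : ∀ γ : ℝ, FoxSeparates 1 0 ![((1 : ℂ), (1 / 2 : ℝ))] ![((1 : ℂ), (1 : ℝ))] γ ↔ -1 < γ := by
    intro γ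
    simp [FoxSeparates]
    grind
  refine hasFoxH_of_stripDecay (by norm_num) (by norm_num) (by norm_num) ?_ ?_ ?_ ?_
    ((hsep γ).2 h1) hz
  · intro i
    fin_cases i; simp
  · intro i
    fin_cases i; simp
  · intro γ hγ y
    exact foxTheta_11 (by simpa using (hsep γ).1 hγ)
  · intro γ γ' hγ hγ'
    exact stripDecay_gaussKernel ((hsep γ).1 hγ)

/-- At `α = 2` the factor `Γ(-s/2)` occurs in both numerator and denominator of `foxTheta` and
cancels; for `Re s < 0` it is not zero. -/
theorem stableKernel_two {s : ℂ} (hs : -1 < s.re) (hs' : s.re < 0) :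
    stableKernel 2 s = gaussKernel s := by
  rw [← foxTheta_11 hs, ← foxTheta_22 2 s]
  have h1 : Complex.Gamma (-(2⁻¹ * s)) ≠ 0 := Complex.Gamma_ne_zero_of_re_pos (by
    simp; linarith)
  simp [foxTheta, Finset.prod_filter, Fin.prod_univ_two, mul_comm (Complex.Gamma (1 + s)),
    mul_div_mul_left _ _ h1]

theorem foxSolution_two {η : ℝ} (hη : 0 < η) {x t : ℝ} (hx : x ≠ 0) (ht : 0 < t) {γ : ℝ}
    (h1 : -1 < γ) :
    foxSolution 2 1 η x t = 1 / ((2 * |x| : ℝ) : ℂ) *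
      mellinBarnes gaussKernel γ (|x| / (η * t) ^ (1 / 2 : ℝ)) := by
  have hz : 0 < |x| / (η * t) ^ (1 / 2 : ℝ) := by
    have := abs_pos.2 hx
    positivity
  rw [foxSolution_one_eq two_pos hη hx ht (γ := -1 / 2) (by norm_num) (by norm_num),
    ← Real.mul_rpow hη.le ht.le]
  congr 1
  have e : mellinBarnes (stableKernel 2) (-1 / 2) (|x| / (η * t) ^ (1 / 2 : ℝ)) =
      mellinBarnes gaussKernel (-1 / 2) (|x| / (η * t) ^ (1 / 2 : ℝ)) := by
    rw [mellinBarnes, mellinBarnes]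
    congr 2
    funext y
    rw [stableKernel_two] <;> norm_num
  rw [e, mellinBarnes_gaussKernel (by norm_num) hz, mellinBarnes_gaussKernel h1 hz]

theorem foxSolution_two_eq_gaussian {η : ℝ} (hη : 0 < η) {x t : ℝ} (hx : x ≠ 0) (ht : 0 < t) :
    foxSolution 2 1 η x t =
      (((4 * Real.pi * η * t) ^ (-1 / 2 : ℝ) * Real.exp (-(|x| ^ 2 / (4 * η * t))) : ℝ) : ℂ) := by
  have hx' := abs_pos.2 hx
  have hz : 0 < |x| / (η * t) ^ (1 / 2 : ℝ) := by positivity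
  rw [foxSolution_two hη hx ht (γ := 0) (by norm_num), mellinBarnes_gaussKernel (by norm_num) hz,
    ← Complex.ofReal_one, ← Complex.ofReal_div, ← Complex.ofReal_mul, Complex.ofReal_inj]
  have hηt : 0 < η * t := by positivity
  have e1 : (4 * Real.pi * η * t) ^ (-1 / 2 : ℝ) =
      (2 * Real.sqrt Real.pi * Real.sqrt (η * t))⁻¹ := by
    rw [show (-1 / 2 : ℝ) = -(1 / 2) by norm_num, Real.rpow_neg (by positivity),
      ← Real.sqrt_eq_rpow, show 4 * Real.pi * η * t = 2 ^ 2 * Real.pi * (η * t) by ring,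
      Real.sqrt_mul (by positivity), Real.sqrt_mul (by positivity), Real.sqrt_sq two_pos.le]
  rw [e1, ← Real.sqrt_eq_rpow, div_pow, Real.sq_sqrt hηt.le]
  have h1 : Real.sqrt Real.pi ≠ 0 := (Real.sqrt_pos.2 Real.pi_pos).ne'
  have h2 : Real.sqrt (η * t) ≠ 0 := (Real.sqrt_pos.2 hηt).ne'
  have e2 : |x| ^ 2 / (η * t) / 4 = |x| ^ 2 / (4 * η * t) := by
    rw [div_div]; congr 1; ring
  rw [e2]
  field_simp

end

/-! ### The Fourier transform of the solution is a Mittag-Leffler function. -/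

noncomputable section

/-! ### Size and continuity of inverse Mellin transforms -/

theorem norm_ofReal_cpow_neg_line {z : ℝ} (hz : 0 < z) (γ y : ℝ) :
    ‖(z : ℂ) ^ (-(γ + y * Complex.I))‖ = z ^ (-γ) := by
  rw [Complex.norm_cpow_eq_rpow_re_of_pos hz]
  simp

theorem norm_mellinBarnes_le (f : ℂ → ℂ) (γ : ℝ) {z : ℝ} (hz : 0 < z) :
    ‖mellinBarnes f γ z‖ ≤ (1 / (2 * Real.pi) * ∫ y : ℝ, ‖f (γ + y * Complex.I)‖) * z ^ (-γ) := by
  have hpi := Real.pi_pos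
  rw [mellinBarnes, norm_mul, mul_assoc]
  have h1 : ‖(1 / (2 * Real.pi) : ℂ)‖ = 1 / (2 * Real.pi) := by
    simp [abs_of_pos hpi]
  rw [h1]
  gcongr
  refine (norm_integral_le_integral_norm _).trans (le_of_eq ?_)
  rw [← integral_mul_const]
  congr 1
  funext y
  rw [norm_mul, norm_ofReal_cpow_neg_line hz]

theorem continuousAt_mellinBarnes {f : ℂ → ℂ} {a b γ : ℝ} (h : StripDecay f a b) (h1 : a ≤ γ)
    (h2 : γ ≤ b) {z : ℝ} (hz : 0 < z) : ContinuousAt (mellinBarnes f γ) z := by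
  refine ContinuousAt.mul continuousAt_const ?_
  have hc : ContinuousAt (fun w : ℝ => w ^ (-γ)) z := Real.continuousAt_rpow_const _ _ (Or.inl hz.ne')
  have hev : ∀ᶠ w in 𝓝 z, w ^ (-γ) < z ^ (-γ) + 1 :=
    hc.eventually (gt_mem_nhds (lt_add_one _))
  refine continuousAt_of_dominated
    (bound := fun y => ‖f (γ + y * Complex.I)‖ * (z ^ (-γ) + 1)) ?_ ?_ ?_ ?_
  · filter_upwards [lt_mem_nhds hz] with w hw
    exact ((h.mul_cpow hw).integrable_line h1 h2).aestronglyMeasurable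
  · filter_upwards [lt_mem_nhds hz, hev] with w hw hw'
    refine Eventually.of_forall fun y => ?_
    rw [norm_mul, norm_ofReal_cpow_neg_line hw]
    gcongr
  · exact (h.integrable_line h1 h2).norm.mul_const _
  · refine Eventually.of_forall fun y => ContinuousAt.mul continuousAt_const ?_
    have h3 : ContinuousAt (fun w : ℂ => w ^ (-(γ + y * Complex.I))) (z : ℂ) :=
      continuousAt_cpow_const (Or.inl (by simpa using hz))
    exact h3.comp Complex.continuous_ofReal.continuousAt

/-- `z⁻¹` times an inverse Mellin transform. -/
def mellinDensity (f : ℂ → ℂ) (γ z : ℝ) : ℂ := (z : ℂ)⁻¹ * mellinBarnes f γ z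

theorem continuousAt_mellinDensity {f : ℂ → ℂ} {a b γ : ℝ} (h : StripDecay f a b) (h1 : a ≤ γ)
    (h2 : γ ≤ b) {z : ℝ} (hz : 0 < z) : ContinuousAt (mellinDensity f γ) z := by
  refine ContinuousAt.mul ?_ (continuousAt_mellinBarnes h h1 h2 hz)
  exact Complex.continuous_ofReal.continuousAt.inv₀ (Complex.ofReal_ne_zero.2 hz.ne')

/-- On the line `Re s = c` the density is `O(z^(-c-1))`. The value does not depend on the line, so
`c = a < 0` gives integrability on `(0, 1]` and `c = b > 0` on `(1, ∞)`. -/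
theorem integrableOn_mellinDensity {f : ℂ → ℂ} {a b γ : ℝ} (h : StripDecay f a b) (ha : a < 0)
    (hb : 0 < b) (h1 : a ≤ γ) (h2 : γ ≤ b) : IntegrableOn (mellinDensity f γ) (Set.Ioi 0) := by
  have hab : a ≤ b := (ha.trans hb).le
  have hmeas : AEStronglyMeasurable (mellinDensity f γ) (volume.restrict (Set.Ioi 0)) :=
    ContinuousOn.aestronglyMeasurable
      (fun z hz => (continuousAt_mellinDensity h h1 h2 hz).continuousWithinAt) measurableSet_Ioi
  have hbound : ∀ c : ℝ, a ≤ c → c ≤ b → ∃ C : ℝ, ∀ z : ℝ, 0 < z →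
      ‖mellinDensity f γ z‖ ≤ C * z ^ (-c - 1) := by
    intro c hc1 hc2
    refine ⟨1 / (2 * Real.pi) * ∫ y : ℝ, ‖f (c + y * Complex.I)‖, fun z hz => ?_⟩
    rw [mellinDensity, h.mellinBarnes_eq hz h1 h2 hc1 hc2, norm_mul, norm_inv, Complex.norm_real,
      Real.norm_of_nonneg hz.le, Real.rpow_sub_one hz.ne', inv_mul_eq_div, ← mul_div_assoc]
    gcongr
    exact norm_mellinBarnes_le f c hz
  obtain ⟨Ca, hCa⟩ := hbound a le_rfl hab
  obtain ⟨Cb, hCb⟩ := hbound b hab le_rfl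
  rw [← Set.Ioc_union_Ioi_eq_Ioi zero_le_one]
  refine IntegrableOn.union ?_ ?_
  · have hi : IntegrableOn (fun z : ℝ => Ca * z ^ (-a - 1)) (Set.Ioc 0 1) := by
      rw [← intervalIntegrable_iff_integrableOn_Ioc_of_le zero_le_one]
      exact (intervalIntegral.intervalIntegrable_rpow' (by linarith)).const_mul _
    refine Integrable.mono' hi (hmeas.mono_set fun z hz => hz.1) ?_
    exact (ae_restrict_mem measurableSet_Ioc).mono fun z hz => hCa z hz.1
  · have hi : IntegrableOn (fun z : ℝ => Cb * z ^ (-b - 1)) (Set.Ioi 1) :=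
      (integrableOn_Ioi_rpow_of_lt (by linarith) one_pos).const_mul _
    refine Integrable.mono' hi (hmeas.mono_set (Set.Ioi_subset_Ioi zero_le_one)) ?_
    refine (ae_restrict_mem measurableSet_Ioi).mono fun z hz => ?_
    have hz1 : 1 < z := hz
    exact hCb z (by linarith)

/-! ### The Laplace and cosine transforms of inverse Mellin transforms -/

/-- Fubini, followed by the Laplace transform of `u^(-s-1)`. That transform converges because `γ <
0`, and `Re r > 0` makes the double integral absolutely convergent. -/
theorem integral_mellinDensity_mul_exp_neg {f : ℂ → ℂ} {γ : ℝ} (hγ : γ < 0)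
    (hf : Continuous fun y : ℝ => f (γ + y * Complex.I))
    (hfi : Integrable fun y : ℝ => f (γ + y * Complex.I)) {r : ℂ} (hr : 0 < r.re) :
    ∫ u in Set.Ioi (0 : ℝ), mellinDensity f γ u * Complex.exp (-(r * u)) =
      (1 / (2 * Real.pi) : ℂ) * ∫ y : ℝ, f (γ + y * Complex.I) *
        ((1 / r) ^ (-(γ + y * Complex.I)) * Complex.Gamma (-(γ + y * Complex.I))) := by
  have hre : ∀ y : ℝ, 0 < (-((γ : ℂ) + y * Complex.I)).re := fun y => by simpa using hγ
  have hL : ∀ u ∈ Set.Ioi (0 : ℝ), mellinDensity f γ u * Complex.exp (-(r * u)) =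
      (1 / (2 * Real.pi) : ℂ) * ∫ y : ℝ, f (γ + y * Complex.I) *
        ((u : ℂ) ^ (-(γ + y * Complex.I) - 1) * Complex.exp (-(r * u))) := by
    intro u hu
    have hu0 : (u : ℂ) ≠ 0 := Complex.ofReal_ne_zero.2 (ne_of_gt hu)
    rw [mellinDensity, mellinBarnes, mul_assoc, mul_assoc, mul_left_comm]
    congr 1
    rw [← integral_mul_const, ← integral_const_mul]
    congr 1
    funext y
    rw [Complex.cpow_sub _ _ hu0, Complex.cpow_one]
    field_simp
  rw [setIntegral_congr_fun measurableSet_Ioi hL, integral_const_mul, integral_integral_swap]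
  · congr 2
    funext y
    rw [integral_const_mul, integral_cpow_mul_exp_neg_mul_complex (hre y) hr]
  · have hint : Integrable (fun p : ℝ × ℝ =>
        (p.1 ^ (-γ - 1) * Real.exp (-(r.re) * p.1)) * ‖f (γ + p.2 * Complex.I)‖)
        ((volume.restrict (Set.Ioi 0)).prod volume) := by
      refine Integrable.mul_prod (f := fun u : ℝ => u ^ (-γ - 1) * Real.exp (-(r.re) * u)) ?_ hfi.norm
      have := integrableOn_rpow_mul_exp_neg_mul_rpow (p := 1) (s := -γ - 1) (b := r.re)
        (by linarith) one_pos hr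
      simpa [IntegrableOn] using this
    refine Integrable.mono' hint ?_ ?_
    · refine AEStronglyMeasurable.mul ?_ ?_
      · exact (hf.comp continuous_snd).aestronglyMeasurable
      · exact (Measurable.aestronglyMeasurable (by fun_prop))
    · have hae : ∀ᵐ p : ℝ × ℝ ∂((volume.restrict (Set.Ioi 0)).prod volume), 0 < p.1 :=
        Measure.quasiMeasurePreserving_fst.ae (ae_restrict_mem measurableSet_Ioi)
      filter_upwards [hae] with p hp
      simp only [Function.uncurry]
      rw [norm_mul, norm_mul, Complex.norm_cpow_eq_rpow_re_of_pos hp, Complex.norm_exp, mul_comm]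
      simp

theorem tendsto_integral_mul_exp_neg {g : ℝ → ℂ} (hg : IntegrableOn g (Set.Ioi 0)) (k : ℝ) :
    Tendsto (fun ε : ℝ => ∫ u in Set.Ioi (0 : ℝ), g u * Complex.exp (-((ε + k * Complex.I) * u)))
      (𝓝[>] 0) (𝓝 (∫ u in Set.Ioi (0 : ℝ), g u * Complex.exp (-((k * Complex.I) * u)))) := by
  refine tendsto_integral_filter_of_dominated_convergence (fun u => ‖g u‖) ?_ ?_ hg.norm ?_
  · exact Eventually.of_forall fun ε => hg.aestronglyMeasurable.mul
      (Measurable.aestronglyMeasurable (by fun_prop))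
  · filter_upwards [self_mem_nhdsWithin] with ε hε
    filter_upwards [ae_restrict_mem measurableSet_Ioi] with u hu
    rw [norm_mul, Complex.norm_exp]
    refine mul_le_of_le_one_right (norm_nonneg _) (Real.exp_le_one_iff.2 ?_)
    simp
    exact mul_nonneg (le_of_lt hε) (le_of_lt hu)
  · refine Eventually.of_forall fun u => ?_
    have : Continuous fun ε : ℝ => g u * Complex.exp (-((ε + k * Complex.I) * u)) := by fun_prop
    exact (this.tendsto' 0 _ (by simp)).mono_left nhdsWithin_le_nhds

/-- The one-sided Fourier transform of an inverse Mellin transform. -/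
theorem integral_mellinDensity_mul_exp_I {f : ℂ → ℂ} {a b γ : ℝ} (h : StripDecay f a b) (ha : a < 0)
    (hb : 0 < b) (h1 : a ≤ γ) (hγ : γ < 0) {k : ℝ} (hk : k ≠ 0) :
    Integrable (fun y : ℝ => f (γ + y * Complex.I) *
        ((1 / (k * Complex.I)) ^ (-(γ + y * Complex.I)) * Complex.Gamma (-(γ + y * Complex.I)))) ∧
    ∫ u in Set.Ioi (0 : ℝ), mellinDensity f γ u * Complex.exp (-((k * Complex.I) * u)) =
      (1 / (2 * Real.pi) : ℂ) * ∫ y : ℝ, f (γ + y * Complex.I) *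
        ((1 / (k * Complex.I)) ^ (-(γ + y * Complex.I)) * Complex.Gamma (-(γ + y * Complex.I))) := by
  have h2 : γ ≤ b := by linarith
  have hpi := Real.pi_pos
  have hk' := abs_pos.2 hk
  obtain ⟨C, c, hc, hC⟩ := h.exists_line_bound h1 h2
  -- an angle close enough to a right angle for the decay of `f` to absorb the difference
  obtain ⟨θ, hθ0, hθ, hθc⟩ : ∃ θ : ℝ, 0 ≤ θ ∧ θ < Real.pi / 2 ∧ Real.pi / 2 - c / 2 ≤ θ :=
    ⟨max 0 (Real.pi / 2 - c / 2), le_max_left _ _, max_lt (by linarith) (by linarith), le_max_right _ _⟩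
  set D : ℝ := Real.Gamma (-γ) * Real.cos θ ^ γ with hD
  have hΓ : ∀ y : ℝ, ‖Complex.Gamma (-(γ + y * Complex.I))‖ ≤ D * Real.exp (-θ * |y|) := by
    intro y
    have := norm_Gamma_le (s := -(γ + y * Complex.I)) (by simpa using hγ) hθ0 hθ
    simpa [hD] using this
  have hne : ∀ ε : ℝ, (ε : ℂ) + k * Complex.I ≠ 0 := fun ε h0 => hk (by simpa using congrArg Complex.im h0)
  -- The argument of `1/(ε + ik)` is at most `π/2` in modulus for all `ε ≥ 0`, hence the growth
  -- `exp(π|y|/2)`. The decay of `Γ(-s)` absorbs it up to `exp(c|y|/2)`, and the decay `exp(-c|y|)`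
  -- of `f` leaves an integrable majorant independent of `ε`.
  have hpow : ∀ ε : ℝ, 0 ≤ ε → ∀ y : ℝ, ‖(1 / ((ε : ℂ) + k * Complex.I)) ^ (-(γ + y * Complex.I))‖ ≤
      |k| ^ γ * Real.exp (Real.pi / 2 * |y|) := by
    intro ε hε y
    have hle : |k| ≤ ‖(ε : ℂ) + k * Complex.I‖ := by
      simpa using Complex.abs_im_le_norm ((ε : ℂ) + k * Complex.I)
    have hre : 0 ≤ (1 / ((ε : ℂ) + k * Complex.I)).re := by
      rw [one_div, Complex.inv_re]
      exact div_nonneg (by simpa using hε) (Complex.normSq_nonneg _)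
    have harg := Complex.abs_arg_le_pi_div_two_iff.2 hre
    rw [Complex.norm_cpow_of_ne_zero (one_div_ne_zero (hne ε)), div_eq_mul_inv, ← Real.exp_neg]
    have e1 : (-((γ : ℂ) + y * Complex.I)).re = -γ := by simp
    have e2 : (-((γ : ℂ) + y * Complex.I)).im = -y := by simp
    rw [e1, e2, norm_div, norm_one, one_div, Real.inv_rpow (norm_nonneg _),
      Real.rpow_neg (norm_nonneg _), inv_inv]
    refine mul_le_mul ?_ ?_ (Real.exp_pos _).le (by positivity)
    · exact Real.rpow_le_rpow_of_nonpos hk' hle hγ.le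
    · refine Real.exp_le_exp.2 ?_
      rw [mul_neg, neg_neg]
      refine (le_abs_self _).trans ?_
      rw [abs_mul]
      gcongr
  have hbound : ∀ ε : ℝ, 0 ≤ ε → ∀ y : ℝ, ‖f (γ + y * Complex.I) *
      ((1 / ((ε : ℂ) + k * Complex.I)) ^ (-(γ + y * Complex.I)) * Complex.Gamma (-(γ + y * Complex.I)))‖ ≤
      (|C| * |k| ^ γ * D) * Real.exp (-(c / 2) * |y|) := by
    intro ε hε y
    have hC' : ‖f (γ + y * Complex.I)‖ ≤ |C| * Real.exp (-c * |y|) :=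
      (hC y).trans (by gcongr; exact le_abs_self C)
    rw [norm_mul, norm_mul]
    calc _ ≤ (|C| * Real.exp (-c * |y|)) * ((|k| ^ γ * Real.exp (Real.pi / 2 * |y|)) *
          (D * Real.exp (-θ * |y|))) := by
          have := hpow ε hε y
          have := hΓ y
          gcongr
      _ = (|C| * |k| ^ γ * D) * (Real.exp (-c * |y|) * Real.exp (Real.pi / 2 * |y|) *
          Real.exp (-θ * |y|)) := by ring
      _ ≤ _ := by
          rw [← Real.exp_add, ← Real.exp_add]
          have hcos : 0 < Real.cos θ := Real.cos_pos_of_mem_Ioo ⟨by linarith, hθ⟩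
          have hD0 : 0 ≤ D := mul_nonneg (Real.Gamma_pos_of_pos (neg_pos.2 hγ)).le (by positivity)
          have : 0 ≤ |C| * |k| ^ γ * D := by positivity
          refine mul_le_mul_of_nonneg_left (Real.exp_le_exp.2 ?_) this
          have := abs_nonneg y
          nlinarith
  have hmeas : ∀ ε : ℝ, AEStronglyMeasurable (fun y : ℝ => f (γ + y * Complex.I) *
      ((1 / ((ε : ℂ) + k * Complex.I)) ^ (-(γ + y * Complex.I)) *
        Complex.Gamma (-(γ + y * Complex.I)))) := by
    intro ε
    refine (h.continuous_line h1 h2).aestronglyMeasurable.mul (AEStronglyMeasurable.mul ?_ ?_)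
    · exact (Measurable.aestronglyMeasurable (by fun_prop))
    · refine Continuous.aestronglyMeasurable (continuous_iff_continuousAt.2 fun y => ?_)
      refine ContinuousAt.comp (f := fun y : ℝ => -((γ : ℂ) + y * Complex.I))
        (differentiableAt_Gamma_of_re_pos (by simpa using hγ)).continuousAt (by fun_prop)
  have hexpi := (integrable_exp_neg_mul_abs_real (half_pos hc)).const_mul (|C| * |k| ^ γ * D)
  have hlim1 := tendsto_integral_mul_exp_neg (integrableOn_mellinDensity h ha hb h1 h2) k
  have hlim2 : Tendsto (fun ε : ℝ => (1 / (2 * Real.pi) : ℂ) * ∫ y : ℝ, f (γ + y * Complex.I) *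
      ((1 / ((ε : ℂ) + k * Complex.I)) ^ (-(γ + y * Complex.I)) *
        Complex.Gamma (-(γ + y * Complex.I)))) (𝓝[>] 0)
      (𝓝 ((1 / (2 * Real.pi) : ℂ) * ∫ y : ℝ, f (γ + y * Complex.I) *
        ((1 / (k * Complex.I)) ^ (-(γ + y * Complex.I)) *
          Complex.Gamma (-(γ + y * Complex.I))))) := by
    refine Tendsto.const_mul _ ?_
    refine tendsto_integral_filter_of_dominated_convergence _
      (Eventually.of_forall hmeas) ?_ hexpi ?_
    · filter_upwards [self_mem_nhdsWithin] with ε hε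
      exact Eventually.of_forall (hbound ε (le_of_lt hε))
    · refine Eventually.of_forall fun y => ?_
      have hct : ContinuousAt (fun ε : ℝ => f (γ + y * Complex.I) *
          ((1 / ((ε : ℂ) + k * Complex.I)) ^ (-(γ + y * Complex.I)) *
          Complex.Gamma (-(γ + y * Complex.I)))) 0 := by
        refine ContinuousAt.mul continuousAt_const (ContinuousAt.mul_const ?_ _)
        refine ContinuousAt.comp (f := fun ε : ℝ => 1 / ((ε : ℂ) + k * Complex.I))
          (g := fun w : ℂ => w ^ (-((γ : ℂ) + y * Complex.I))) (continuousAt_cpow_const ?_) ?_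
        · right
          simp [Complex.inv_im, hk]
        · exact ContinuousAt.div continuousAt_const (by fun_prop) (hne 0)
      have := hct.tendsto
      simp only [Complex.ofReal_zero, zero_add] at this
      exact this.mono_left nhdsWithin_le_nhds
  refine ⟨?_, tendsto_nhds_unique (hlim1.congr' ?_) hlim2⟩
  · have := hexpi.mono' (hmeas 0) (Eventually.of_forall (hbound 0 le_rfl))
    simpa using this
  · filter_upwards [self_mem_nhdsWithin] with ε hε
    exact integral_mellinDensity_mul_exp_neg hγ (h.continuous_line h1 h2) (h.integrable_line h1 h2)
      (by simpa using hε)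

end

noncomputable section

/-! ### The Mittag-Leffler kernel -/

/-- The Mellin–Barnes kernel of the Mittag-Leffler function `E_β(-λ)`. -/
def mlKernel (β : ℝ) (s : ℂ) : ℂ :=
  -(Real.pi / Complex.sin (Real.pi * s)) * (Complex.Gamma (1 + β * s))⁻¹

theorem sin_pi_mul_ne_zero_of_re_mem {s : ℂ} (hs : s ≠ 0) (h1 : -1 < s.re) (h2 : s.re < 1) :
    Complex.sin (Real.pi * s) ≠ 0 := by
  have hpi := Real.pi_pos
  have h3 : |Real.pi * s.re| < Real.pi := by
    rw [abs_mul, abs_of_pos hpi]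
    have : |s.re| < 1 := abs_lt.2 ⟨h1, h2⟩
    nlinarith
  have h4 := sinSlope_ne_zero hpi.ne' h3
  rw [sinSlope_of_ne _ hs] at h4
  exact (div_ne_zero_iff.1 h4).1

theorem stripBound_pi_div_sin (a b : ℝ) :
    StripBound (fun s => -(Real.pi / Complex.sin (Real.pi * s))) a b (-Real.pi) := by
  refine (((StripBound.const (-(Real.pi : ℂ))).mul
    (stripBound_sin_mul_inv Real.pi_pos a b)).mono_rate (by simp)).congr fun s _ _ _ => ?_
  ring

/-- With `θ = 1` the rate is `-π + (π - 1) β`, at most `-1` since `β ≤ 1`. -/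
theorem stripBound_mlKernel {β : ℝ} (hβ : 0 < β) (hβ1 : β ≤ 1) (a b : ℝ) :
    StripBound (mlKernel β) a b (-1) := by
  have hpi := Real.pi_gt_three
  have h := (stripBound_pi_div_sin a b).mul (stripBound_Gamma_one_add_inv hβ a b zero_le_one
    (by linarith : (1 : ℝ) < Real.pi / 2) 1)
  refine (h.mono_rate (by nlinarith)).congr fun s _ _ _ => ?_
  simp [mlKernel]

theorem stripDecay_mlKernel {β : ℝ} (hβ : 0 < β) (hβ1 : β ≤ 1) {a b : ℝ} (ha : -1 < a) (hb : b < 1)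
    (h0 : b < 0 ∨ 0 < a) : StripDecay (mlKernel β) a b := by
  refine (stripBound_mlKernel hβ hβ1 a b).stripDecay (by norm_num) fun s h1 h2 => ?_
  have hs : s ≠ 0 := by
    rintro rfl
    simp at h1 h2
    rcases h0 with h | h <;> linarith
  have hsin := sin_pi_mul_ne_zero_of_re_mem hs (ha.trans_le h1) (h2.trans_lt hb)
  refine DifferentiableAt.mul (DifferentiableAt.neg ?_) ?_
  · exact (differentiableAt_const _).div (by fun_prop) hsin
  · exact (Complex.differentiable_one_div_Gamma _).comp s (f := fun s => 1 + (β : ℂ) * s) (by fun_prop)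

theorem StripBound.sub {f g : ℂ → ℂ} {a b r : ℝ} (hf : StripBound f a b r) (hg : StripBound g a b r) :
    StripBound (fun s => f s - g s) a b r := by
  obtain ⟨C, T, hf⟩ := hf
  obtain ⟨D, T', hg⟩ := hg
  refine ⟨C + D, max T T', fun s h1 h2 h3 => ?_⟩
  have h4 := hf s h1 h2 ((le_max_left _ _).trans h3)
  have h5 := hg s h1 h2 ((le_max_right _ _).trans h3)
  rw [add_mul]
  exact (norm_sub_le _ _).trans (add_le_add h4 h5)

/-- An antiderivative is `2 arctan(exp(π y))`. On the lines `Re s = ± 1/2` the function `π/sin(π s)`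
becomes `± π/cosh(π y)`, which makes the residue at `0` computable without a residue theorem. -/
theorem integral_pi_div_cosh : Integrable (fun y : ℝ => Real.pi / Real.cosh (Real.pi * y)) ∧
    ∫ y : ℝ, Real.pi / Real.cosh (Real.pi * y) = Real.pi := by
  have hpi := Real.pi_pos
  have hd : ∀ y : ℝ, HasDerivAt (fun y : ℝ => 2 * Real.arctan (Real.exp (Real.pi * y)))
      (Real.pi / Real.cosh (Real.pi * y)) y := by
    intro y
    have h1 : HasDerivAt (fun y : ℝ => Real.exp (Real.pi * y)) (Real.exp (Real.pi * y) * (Real.pi * 1)) y :=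
      ((hasDerivAt_id y).const_mul Real.pi).exp
    convert! (h1.arctan).const_mul 2 using 1
    rw [Real.cosh_eq, Real.exp_neg]
    have := Real.exp_pos (Real.pi * y)
    field_simp
    ring
  have hbot : Tendsto (fun y : ℝ => 2 * Real.arctan (Real.exp (Real.pi * y))) atBot (𝓝 0) := by
    have h1 : Tendsto (fun y : ℝ => Real.exp (Real.pi * y)) atBot (𝓝 0) :=
      Real.tendsto_exp_atBot.comp (tendsto_id.const_mul_atBot hpi)
    have h2 := ((Real.continuous_arctan.tendsto 0).comp h1).const_mul 2
    simpa using h2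
  have htop : Tendsto (fun y : ℝ => 2 * Real.arctan (Real.exp (Real.pi * y))) atTop (𝓝 Real.pi) := by
    have h1 : Tendsto (fun y : ℝ => Real.exp (Real.pi * y)) atTop atTop :=
      Real.tendsto_exp_atTop.comp (tendsto_id.const_mul_atTop hpi)
    have h2 := ((Real.tendsto_arctan_atTop.mono_right nhdsWithin_le_nhds).comp h1).const_mul 2
    rwa [mul_div_cancel₀ _ two_ne_zero] at h2
  have hi : Integrable (fun y : ℝ => Real.pi / Real.cosh (Real.pi * y)) := by
    refine ((integrable_exp_neg_mul_abs_real hpi).const_mul (2 * Real.pi)).mono' ?_ ?_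
    · exact (Measurable.aestronglyMeasurable (by fun_prop))
    · refine Eventually.of_forall fun y => ?_
      have h1 := Real.cosh_pos (Real.pi * y)
      rw [Real.norm_of_nonneg (by positivity), neg_mul, Real.exp_neg, ← div_eq_mul_inv,
        div_le_div_iff₀ h1 (Real.exp_pos _), ← Real.cosh_abs, abs_mul, abs_of_pos hpi, Real.cosh_eq]
      have h2 := Real.exp_pos (-(Real.pi * |y|))
      nlinarith
  refine ⟨hi, ?_⟩
  rw [integral_of_hasDerivAt_of_tendsto hd hi hbot htop, sub_zero]

theorem sin_pi_mul_half_add (y : ℝ) :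
    Complex.sin (Real.pi * (((1 / 2 : ℝ) : ℂ) + y * Complex.I)) = (Real.cosh (Real.pi * y) : ℝ) := by
  rw [show (Real.pi : ℂ) * (((1 / 2 : ℝ) : ℂ) + y * Complex.I) =
    ((Real.pi * y : ℝ) : ℂ) * Complex.I + Real.pi / 2 by push_cast; ring,
    Complex.sin_add_pi_div_two, Complex.cos_mul_I, Complex.ofReal_cosh]

theorem sin_pi_mul_neg_half_add (y : ℝ) :
    Complex.sin (Real.pi * (((-1 / 2 : ℝ) : ℂ) + y * Complex.I)) = -(Real.cosh (Real.pi * y) : ℝ) := by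
  rw [show (Real.pi : ℂ) * (((-1 / 2 : ℝ) : ℂ) + y * Complex.I) =
    ((Real.pi * y : ℝ) : ℂ) * Complex.I - Real.pi / 2 by push_cast; ring,
    Complex.sin_sub_pi_div_two, Complex.cos_mul_I, Complex.ofReal_cosh]

/-- The residue of the Mittag-Leffler kernel at `0`. -/
theorem mellinBarnes_mlKernel_shift {β : ℝ} (hβ : 0 < β) (hβ1 : β ≤ 1) {z : ℝ} (hz : 0 < z) :
    mellinBarnes (mlKernel β) (-1 / 2) z = 1 + mellinBarnes (mlKernel β) (1 / 2) z := by
  have hpi := Real.pi_pos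
  have hpi0 : (Real.pi : ℂ) ≠ 0 := Complex.ofReal_ne_zero.2 hpi.ne'
  have hz' : (z : ℂ) ≠ 0 := Complex.ofReal_ne_zero.2 hz.ne'
  let g : ℂ → ℂ := fun s => (Complex.Gamma (1 + β * s))⁻¹ * (z : ℂ) ^ (-s)
  -- Since `g 0 = 1`, subtracting `-π/sin(π s)` from the integrand removes the pole at `0`; `d` is
  -- the holomorphic remainder. Its integrals over the two lines agree, and the subtracted parts
  -- contribute `π + π`, that is `1` after division by `2π`.
  let d : ℂ → ℂ := fun s => -(Real.pi * (dslope g 0 s / sinSlope Real.pi s))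
  have hg : Differentiable ℂ g := by
    refine Differentiable.mul ?_ ?_
    · exact Complex.differentiable_one_div_Gamma.comp (f := fun s => 1 + (β : ℂ) * s) (by fun_prop)
    · exact fun s => differentiableAt_id.neg.const_cpow (Or.inl hz')
  have hdg : Differentiable ℂ (dslope g 0) :=
    differentiableOn_univ.1 ((Complex.differentiableOn_dslope univ_mem).2 hg.differentiableOn)
  have hg0 : g 0 = 1 := by simp [g]
  have hd : ∀ s : ℂ, s ≠ 0 → d s = mlKernel β s * (z : ℂ) ^ (-s) -
      (-(Real.pi / Complex.sin (Real.pi * s))) := by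
    intro s hs
    simp only [d, dslope_of_ne _ hs, slope_def_field, sinSlope_of_ne _ hs, sub_zero, hg0,
      div_div_div_cancel_right₀ hs, mlKernel, g]
    ring
  have hK : StripBound (fun s => mlKernel β s * (z : ℂ) ^ (-s)) (-1 / 2) (1 / 2) (-1) := by
    have := (stripBound_mlKernel hβ hβ1 (-1 / 2) (1 / 2)).mul
      (stripBound_cpow hz' (a := -1 / 2) (b := 1 / 2))
    rwa [Complex.arg_ofReal_of_nonneg hz.le, abs_zero, add_zero] at this
  have hS : StripBound (fun s => -(Real.pi / Complex.sin (Real.pi * s))) (-1 / 2) (1 / 2) (-1) :=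
    (stripBound_pi_div_sin _ _).mono_rate (by linarith [Real.pi_gt_three])
  have hdec : StripDecay d (-1 / 2) (1 / 2) := by
    refine ((hK.sub hS).congr fun s _ _ hs => ?_).stripDecay (by norm_num) fun s h1 h2 => ?_
    · exact hd s (by rintro rfl; simp at hs)
    · refine ((DifferentiableAt.div (hdg s) (differentiable_sinSlope _ s)
        (sinSlope_ne_zero hpi.ne' ?_)).const_mul _).neg
      rw [abs_mul, abs_of_pos hpi]
      have : |s.re| ≤ 1 / 2 := abs_le.2 ⟨by linarith, h2⟩
      nlinarith
  have hne : ∀ x y : ℝ, x ≠ 0 → (x : ℂ) + y * Complex.I ≠ 0 := fun x y hx h0 =>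
    hx (by simpa using congrArg Complex.re h0)
  have hshift := hdec.integral_line_eq (by norm_num)
  have hKn := ((stripDecay_mlKernel hβ hβ1 (a := -1 / 2) (b := -1 / 2) (by norm_num) (by norm_num)
    (by norm_num)).mul_cpow hz).integrable_line le_rfl le_rfl
  have hKp := ((stripDecay_mlKernel hβ hβ1 (a := 1 / 2) (b := 1 / 2) (by norm_num) (by norm_num)
    (by norm_num)).mul_cpow hz).integrable_line le_rfl le_rfl
  have hl : ∀ y : ℝ, d (((-1 / 2 : ℝ) : ℂ) + y * Complex.I) =
      mlKernel β (((-1 / 2 : ℝ) : ℂ) + y * Complex.I) *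
        (z : ℂ) ^ (-(((-1 / 2 : ℝ) : ℂ) + y * Complex.I)) -
      ((Real.pi / Real.cosh (Real.pi * y) : ℝ) : ℂ) := by
    intro y
    rw [hd _ (hne _ y (by norm_num)), sin_pi_mul_neg_half_add, div_neg, neg_neg]
    push_cast; rfl
  have hr : ∀ y : ℝ, d (((1 / 2 : ℝ) : ℂ) + y * Complex.I) =
      mlKernel β (((1 / 2 : ℝ) : ℂ) + y * Complex.I) *
        (z : ℂ) ^ (-(((1 / 2 : ℝ) : ℂ) + y * Complex.I)) +
      ((Real.pi / Real.cosh (Real.pi * y) : ℝ) : ℂ) := by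
    intro y
    rw [hd _ (hne _ y (by norm_num)), sin_pi_mul_half_add, sub_neg_eq_add]
    push_cast; rfl
  obtain ⟨hci, hc⟩ := integral_pi_div_cosh
  have hci' : Integrable (fun y : ℝ => ((Real.pi / Real.cosh (Real.pi * y) : ℝ) : ℂ)) := hci.ofReal
  simp only [hl, hr] at hshift
  rw [integral_sub hKn hci', integral_add hKp hci', integral_complex_ofReal, hc] at hshift
  rw [mellinBarnes, mellinBarnes, sub_eq_iff_eq_add.1 hshift]
  generalize ∫ y : ℝ, mlKernel β (((1 / 2 : ℝ) : ℂ) + y * Complex.I) *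
        (z : ℂ) ^ (-(((1 / 2 : ℝ) : ℂ) + y * Complex.I)) = J
  field_simp
  ring

/-! ### The Fourier transform of the solution -/

theorem ofReal_cpow_eq_exp {x : ℝ} (hx : 0 < x) (s : ℂ) :
    (x : ℂ) ^ s = Complex.exp ((Real.log x : ℝ) * s) := by
  rw [Complex.cpow_def_of_ne_zero (Complex.ofReal_ne_zero.2 hx.ne'), Complex.ofReal_log hx.le]

theorem one_div_mul_I_cpow {k : ℝ} (hk : 0 < k) (s : ℂ) :
    (1 / (k * Complex.I)) ^ (-s) = (k : ℂ) ^ s * Complex.exp (Real.pi / 2 * s * Complex.I) := by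
  have h1 : 1 / (k * Complex.I) = ((k⁻¹ : ℝ) : ℂ) * (-Complex.I) := by
    push_cast
    rw [one_div, mul_inv, Complex.inv_I]
  have h2 : -Complex.I ≠ 0 := neg_ne_zero.2 Complex.I_ne_zero
  rw [h1, Complex.cpow_def_of_ne_zero (mul_ne_zero (by simpa using hk.ne') h2),
    Complex.log_ofReal_mul (inv_pos.2 hk) h2, Complex.log_neg_I, ofReal_cpow_eq_exp hk,
    ← Complex.exp_add, Real.log_inv]
  congr 1
  push_cast
  ring

theorem one_div_neg_mul_I_cpow {k : ℝ} (hk : 0 < k) (s : ℂ) :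
    (1 / (((-k : ℝ) : ℂ) * Complex.I)) ^ (-s) =
      (k : ℂ) ^ s * Complex.exp (-(Real.pi / 2 * s * Complex.I)) := by
  have h1 : 1 / (((-k : ℝ) : ℂ) * Complex.I) = ((k⁻¹ : ℝ) : ℂ) * Complex.I := by
    push_cast
    rw [one_div, mul_inv, Complex.inv_I, inv_neg, neg_mul_neg]
  rw [h1, Complex.cpow_def_of_ne_zero (mul_ne_zero (by simpa using hk.ne') Complex.I_ne_zero),
    Complex.log_ofReal_mul (inv_pos.2 hk) Complex.I_ne_zero, Complex.log_I, ofReal_cpow_eq_exp hk,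
    ← Complex.exp_add, Real.log_inv]
  congr 1
  push_cast
  ring

/-- The principal arguments of `1/(ik)` and `1/(-ik)` are `∓ π/2` according to the sign of `k`, so
the two powers are `|k|^s exp(± iπs/2)` in some order. -/
theorem one_div_cpow_add {k : ℝ} (hk : k ≠ 0) (s : ℂ) :
    (1 / (k * Complex.I)) ^ (-s) + (1 / (((-k : ℝ) : ℂ) * Complex.I)) ^ (-s) =
      ((|k| : ℝ) : ℂ) ^ s * (2 * Complex.cos (Real.pi / 2 * s)) := by
  have hcos : 2 * Complex.cos (Real.pi / 2 * s) = Complex.exp (Real.pi / 2 * s * Complex.I) +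
      Complex.exp (-(Real.pi / 2 * s * Complex.I)) := by
    rw [Complex.two_cos, neg_mul]
  rw [hcos, mul_add]
  rcases lt_or_gt_of_ne hk with h | h
  · have h' : 0 < -k := neg_pos.2 h
    have e1 := one_div_mul_I_cpow h' s
    have e2 := one_div_neg_mul_I_cpow h' s
    rw [neg_neg] at e2
    rw [e1, e2, abs_of_neg h, add_comm]
  · rw [one_div_mul_I_cpow h, one_div_neg_mul_I_cpow h, abs_of_pos h]

/-- The factor `Γ(-s) Γ(1 + s)` equals `-π/sin(πs)`, and `sin(πs) = 2 sin(πs/2) cos(πs/2)` cancels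
against the other two trigonometric factors. -/
theorem foxKernel_mul_Gamma {α β : ℝ} (hα : 0 < α) {s : ℂ} (h1 : -1 < s.re) (h2 : s.re < 0) :
    foxKernel α β s * Complex.Gamma (-s) * (2 * Complex.cos (Real.pi / 2 * s)) =
      mlKernel β (s / α) := by
  have hs : s ≠ 0 := by rintro rfl; simp at h2
  have hα' : (α : ℂ) ≠ 0 := Complex.ofReal_ne_zero.2 hα.ne'
  have hsin := sin_pi_mul_ne_zero_of_re_mem hs h1 (by linarith)
  have hG := Gamma_neg_mul_Gamma_one_add s
  have hdouble : Complex.sin (Real.pi * s) =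
      2 * Complex.sin (Real.pi / 2 * s) * Complex.cos (Real.pi / 2 * s) := by
    rw [← Complex.sin_two_mul]; congr 1; ring
  rw [foxKernel, sinSlope_of_ne _ hs, sinSlope_of_ne _ hs, div_div_div_cancel_right₀ hs, mlKernel]
  have e1 : Complex.sin (((Real.pi / 2 : ℝ) : ℂ) * s) = Complex.sin (Real.pi / 2 * s) := by
    congr 1; push_cast; ring
  have e2 : Complex.sin (((Real.pi / α : ℝ) : ℂ) * s) = Complex.sin (Real.pi * (s / α)) := by
    congr 1; push_cast; ring
  have e3 : Complex.Gamma (1 + ((β / α : ℝ) : ℂ) * s) = Complex.Gamma (1 + β * (s / α)) := by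
    congr 1; push_cast; ring
  rw [e1, e2, e3]
  calc _ = (Complex.Gamma (-s) * Complex.Gamma (1 + s)) *
        (2 * Complex.sin (Real.pi / 2 * s) * Complex.cos (Real.pi / 2 * s)) /
        Complex.sin (Real.pi * (s / α)) * (Complex.Gamma (1 + β * (s / α)))⁻¹ := by ring
    _ = _ := by
        rw [hG, ← hdouble, neg_mul, div_mul_cancel₀ _ hsin]
        ring

/-- The even extension of the density attached to the kernel of the solution. -/
def foxProfile (α β x : ℝ) : ℂ := mellinDensity (foxKernel α β) (-(min 1 α) / 2) |x|

theorem min_bounds {α : ℝ} (hα : 0 < α) :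
    -1 < -(min 1 α) / 2 ∧ -α < -(min 1 α) / 2 ∧ -(min 1 α) / 2 < 0 := by
  have := lt_min one_pos hα
  have h4 := min_le_left 1 α
  have h5 := min_le_right 1 α
  exact ⟨by linarith, by linarith, by linarith⟩

theorem integrable_foxProfile {α β : ℝ} (hα : 0 < α) (hβ : 0 < β) (hβ1 : β ≤ 1) :
    Integrable (foxProfile α β) := by
  obtain ⟨h1, h2, h3⟩ := min_bounds hα
  exact integrable_comp_abs (integrableOn_mellinDensity
    (stripDecay_foxKernel hα hβ hβ1 h1 h2 (half_lt_self hα)) h3 (half_pos hα) le_rfl (by linarith))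

/-- The even profile reduces the transform to the half-line transforms at `k` and `-k`. The
substitution `y ↦ y/α` turns the kernel at `s/α` into the Mittag-Leffler kernel, whence the factor
`α`; the contour is then moved from `γ/α` to `-1/2` without meeting the pole at `0`. -/
theorem integral_foxProfile_mul_exp {α β : ℝ} (hα : 0 < α) (hβ : 0 < β) (hβ1 : β ≤ 1) {k : ℝ}
    (hk : k ≠ 0) :
    ∫ x : ℝ, foxProfile α β x * Complex.exp (Complex.I * k * x) =
      α * mellinBarnes (mlKernel β) (-1 / 2) (|k| ^ α)⁻¹ := by
  obtain ⟨h1, h2, h3⟩ := min_bounds hα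
  set γ := -(min 1 α) / 2 with hγ
  have hk' := abs_pos.2 hk
  have hkα : 0 < |k| ^ α := Real.rpow_pos_of_pos hk' α
  have hdec := stripDecay_foxKernel hα hβ hβ1 h1 h2 (half_lt_self hα)
  obtain ⟨i1, e1⟩ := integral_mellinDensity_mul_exp_I hdec h3 (half_pos hα) le_rfl h3 hk
  obtain ⟨i2, e2⟩ := integral_mellinDensity_mul_exp_I hdec h3 (half_pos hα) le_rfl h3
    (neg_ne_zero.2 hk)
  have hint : Integrable fun x : ℝ => foxProfile α β x * Complex.exp (Complex.I * k * x) := by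
    refine (integrable_foxProfile hα hβ hβ1).mul_bdd (c := 1)
      (Measurable.aestronglyMeasurable (by fun_prop)) (Eventually.of_forall fun x => ?_)
    rw [Complex.norm_exp]
    simp
  have hI : IntegrableOn (mellinDensity (foxKernel α β) γ) (Set.Ioi 0) :=
    integrableOn_mellinDensity hdec h3 (half_pos hα) le_rfl (by linarith)
  have hIe : ∀ k : ℝ, IntegrableOn (fun u : ℝ => mellinDensity (foxKernel α β) γ u *
      Complex.exp (-((k * Complex.I) * u))) (Set.Ioi 0) := by
    intro k
    refine hI.mul_bdd (c := 1) (Measurable.aestronglyMeasurable (by fun_prop))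
      (Eventually.of_forall fun x => ?_)
    rw [Complex.norm_exp]
    simp
  rw [integral_eq_integral_Ioi_add_comp_neg hint]
  have hsplit : ∀ x ∈ Set.Ioi (0 : ℝ), foxProfile α β x * Complex.exp (Complex.I * k * x) +
      foxProfile α β (-x) * Complex.exp (Complex.I * k * ((-x : ℝ) : ℂ)) =
      mellinDensity (foxKernel α β) γ x * Complex.exp (-((k * Complex.I) * x)) +
      mellinDensity (foxKernel α β) γ x * Complex.exp (-((((-k : ℝ) : ℂ) * Complex.I) * x)) := by
    intro x hx
    rw [foxProfile, foxProfile, abs_neg, abs_of_pos hx, ← hγ, add_comm]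
    congr 3 <;> (push_cast; ring)
  rw [setIntegral_congr_fun measurableSet_Ioi hsplit, integral_add (hIe k) (hIe (-k)), e1, e2,
    ← mul_add, ← integral_add i1 i2]
  have hker : ∀ y : ℝ, foxKernel α β (γ + y * Complex.I) *
      ((1 / (k * Complex.I)) ^ (-(γ + y * Complex.I)) * Complex.Gamma (-(γ + y * Complex.I))) +
      foxKernel α β (γ + y * Complex.I) * ((1 / (((-k : ℝ) : ℂ) * Complex.I)) ^ (-(γ + y * Complex.I)) *
        Complex.Gamma (-(γ + y * Complex.I))) =
      (fun v : ℝ => mlKernel β (((γ / α : ℝ) : ℂ) + v * Complex.I) *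
        (((|k| ^ α)⁻¹ : ℝ) : ℂ) ^ (-(((γ / α : ℝ) : ℂ) + v * Complex.I))) (y / α) := by
    intro y
    have hα' : (α : ℂ) ≠ 0 := Complex.ofReal_ne_zero.2 hα.ne'
    have hs : ((γ / α : ℝ) : ℂ) + ((y / α : ℝ) : ℂ) * Complex.I = (γ + y * Complex.I) / α := by
      push_cast; ring
    simp only
    rw [hs, ← foxKernel_mul_Gamma (s := γ + y * Complex.I) hα (by simpa using h1) (by simpa using h3)]
    have hp : (((|k| ^ α)⁻¹ : ℝ) : ℂ) ^ (-((γ + y * Complex.I) / α)) =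
        ((|k| : ℝ) : ℂ) ^ (γ + y * Complex.I) := by
      rw [ofReal_cpow_eq_exp (inv_pos.2 hkα), ofReal_cpow_eq_exp hk', Real.log_inv, Real.log_rpow hk']
      congr 1
      push_cast
      field_simp
    have := one_div_cpow_add hk (γ + y * Complex.I)
    rw [hp, ← mul_add, ← add_mul, this]
    ring
  rw [integral_congr_ae (Eventually.of_forall hker), Measure.integral_comp_div
    (fun v : ℝ => mlKernel β (((γ / α : ℝ) : ℂ) + v * Complex.I) *
        (((|k| ^ α)⁻¹ : ℝ) : ℂ) ^ (-(((γ / α : ℝ) : ℂ) + v * Complex.I))), abs_of_pos hα, Complex.real_smul, mul_left_comm]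
  congr 1
  change mellinBarnes (mlKernel β) (γ / α) (|k| ^ α)⁻¹ = _
  have hγα : -1 < γ / α := by rw [lt_div_iff₀ hα]; linarith
  have hγα0 : γ / α < 0 := div_neg_of_neg_of_pos h3 hα
  have hz := inv_pos.2 hkα
  rcases le_total (γ / α) (-1 / 2) with h | h
  · exact (stripDecay_mlKernel hβ hβ1 hγα (by norm_num) (Or.inl (by norm_num))).mellinBarnes_eq hz
      le_rfl h h le_rfl
  · exact (stripDecay_mlKernel hβ hβ1 (by norm_num) (by linarith) (Or.inl hγα0)).mellinBarnes_eq hz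
      h le_rfl le_rfl h

/-- The width `(η t ^ β) ^ (1 / α)` of the solution at time `t`. -/
def solutionScale (α β η t : ℝ) : ℝ := (η * t ^ β) ^ (1 / α)

theorem solutionScale_pos (α β : ℝ) {η t : ℝ} (hη : 0 < η) (ht : 0 < t) :
    0 < solutionScale α β η t := by
  unfold solutionScale; positivity

/-- This is self-similarity. At `x = 0` both sides are `0` by the convention for division by zero.
-/
theorem foxSolution_eq_foxProfile {α β η : ℝ} (hα : 0 < α) (hβ : 0 < β) (hβ1 : β ≤ 1) (hη : 0 < η)
    (x : ℝ) {t : ℝ} (ht : 0 < t) :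
    foxSolution α β η x t =
      ((α * solutionScale α β η t : ℝ) : ℂ)⁻¹ * foxProfile α β (x / solutionScale α β η t) := by
  have hc := solutionScale_pos α β hη ht
  rcases eq_or_ne x 0 with rfl | hx
  · simp [foxSolution, foxProfile, mellinDensity]
  · obtain ⟨h1, h2, h3⟩ := min_bounds hα
    have hx' := abs_pos.2 hx
    rw [foxSolution_eq hα hβ hβ1 hη hx ht h1 h2 (by linarith), foxProfile, mellinDensity, abs_div,
      abs_of_pos hc, ← mul_assoc]
    congr 1
    rw [← Complex.ofReal_one, ← Complex.ofReal_div, ← Complex.ofReal_inv, ← Complex.ofReal_inv,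
      ← Complex.ofReal_mul]
    congr 1
    field_simp

theorem integrable_foxSolution {α β η : ℝ} (hα : 0 < α) (hβ : 0 < β) (hβ1 : β ≤ 1) (hη : 0 < η)
    {t : ℝ} (ht : 0 < t) : Integrable fun x => foxSolution α β η x t := by
  simp only [foxSolution_eq_foxProfile hα hβ hβ1 hη _ ht]
  exact ((integrable_foxProfile hα hβ hβ1).comp_div (solutionScale_pos α β hη ht).ne').const_mul _

/-- The rescaling preserves the `L¹` norm, so the mass is bounded uniformly in `t`. -/
theorem integral_norm_foxSolution {α β η : ℝ} (hα : 0 < α) (hβ : 0 < β) (hβ1 : β ≤ 1) (hη : 0 < η)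
    {t : ℝ} (ht : 0 < t) :
    ∫ x, ‖foxSolution α β η x t‖ = α⁻¹ * ∫ x, ‖foxProfile α β x‖ := by
  have hc := solutionScale_pos α β hη ht
  simp only [foxSolution_eq_foxProfile hα hβ hβ1 hη _ ht, norm_mul]
  rw [integral_const_mul, Measure.integral_comp_div (fun x => ‖foxProfile α β x‖), norm_inv,
    Complex.norm_real, Real.norm_of_nonneg (by positivity), abs_of_pos hc, smul_eq_mul]
  field_simp

theorem integral_foxSolution_mul_exp {α β η : ℝ} (hα : 0 < α) (hβ : 0 < β) (hβ1 : β ≤ 1) (hη : 0 < η)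
    {t : ℝ} (ht : 0 < t) {k : ℝ} (hk : k ≠ 0) :
    ∫ x : ℝ, foxSolution α β η x t * Complex.exp (Complex.I * k * x) =
      mellinBarnes (mlKernel β) (-1 / 2) (η * t ^ β * |k| ^ α)⁻¹ := by
  have hc := solutionScale_pos α β hη ht
  have hα' : (α : ℂ) ≠ 0 := Complex.ofReal_ne_zero.2 hα.ne'
  have hc' : (solutionScale α β η t : ℂ) ≠ 0 := Complex.ofReal_ne_zero.2 hc.ne'
  set c := solutionScale α β η t with hcdef
  have h1 : ∀ x : ℝ, foxSolution α β η x t * Complex.exp (Complex.I * k * x) =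
      ((α * c : ℝ) : ℂ)⁻¹ * (fun u : ℝ => foxProfile α β u *
        Complex.exp (Complex.I * ((k * c : ℝ) : ℂ) * u)) (x / c) := by
    intro x
    rw [foxSolution_eq_foxProfile hα hβ hβ1 hη _ ht, ← hcdef, mul_assoc]
    congr 3
    push_cast
    field_simp
  simp only [h1]
  rw [integral_const_mul, Measure.integral_comp_div (fun u : ℝ => foxProfile α β u *
        Complex.exp (Complex.I * ((k * c : ℝ) : ℂ) * u)),
    integral_foxProfile_mul_exp hα hβ hβ1 (mul_ne_zero hk hc.ne'), abs_of_pos hc, Complex.real_smul]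
  have h2 : |k * c| ^ α = η * t ^ β * |k| ^ α := by
    rw [abs_mul, abs_of_pos hc, Real.mul_rpow (abs_nonneg _) hc.le, hcdef, solutionScale,
      ← Real.rpow_mul (by positivity), one_div_mul_cancel hα.ne', Real.rpow_one, mul_comm]
  rw [h2]
  push_cast
  field_simp

end

/-! ### Existence: the formula solves the equation. -/

noncomputable section

/-! ### Caputo derivatives of Mellin-type integrals -/

/-- The point of height `y` on the vertical line `Re s = 1 / 2`. -/
def halfLine (y : ℝ) : ℂ := ((1 / 2 : ℝ) : ℂ) + y * Complex.I

theorem continuous_halfLine : Continuous halfLine := by unfold halfLine; fun_prop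

theorem halfLine_re (y : ℝ) : (halfLine y).re = 1 / 2 := by simp [halfLine]

theorem norm_halfLine_le (y : ℝ) : ‖halfLine y‖ ≤ 1 + |y| := by
  refine (norm_add_le _ _).trans ?_
  rw [Complex.norm_real, norm_mul, Complex.norm_real, Complex.norm_I, mul_one, Real.norm_eq_abs,
    Real.norm_eq_abs]
  gcongr
  rw [abs_of_pos] <;> norm_num

theorem mul_halfLine_re (β y : ℝ) : ((β : ℂ) * halfLine y).re = β / 2 := by
  rw [Complex.re_ofReal_mul, halfLine_re]; ring

theorem halfLine_ne_zero (y : ℝ) : halfLine y ≠ 0 := fun h => by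
  have := halfLine_re y
  rw [h] at this
  norm_num at this

/-- A polynomial factor is absorbed by the exponential decay. -/
theorem norm_mul_halfLine_le {a : ℝ → ℂ} {C c : ℝ} (hc : 0 < c)
    (ha : ∀ y, ‖a y‖ ≤ C * Real.exp (-c * |y|)) (y : ℝ) :
    ‖a y * halfLine y‖ ≤ (C * (1 + 2 / c)) * Real.exp (-(c / 2) * |y|) := by
  have hy := abs_nonneg y
  have hC : 0 ≤ C := by
    have := (norm_nonneg _).trans (ha 0)
    simpa using this
  have h1 : 1 + |y| ≤ (1 + 2 / c) * Real.exp (c / 2 * |y|) := by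
    have h2 : c / 2 * |y| ≤ Real.exp (c / 2 * |y|) := by
      linarith [Real.add_one_le_exp (c / 2 * |y|)]
    have h3 : 1 ≤ Real.exp (c / 2 * |y|) := Real.one_le_exp (by positivity)
    have h4 : |y| = 2 / c * (c / 2 * |y|) := by field_simp
    have h5 : 2 / c * (c / 2 * |y|) ≤ 2 / c * Real.exp (c / 2 * |y|) := by gcongr
    linarith
  rw [norm_mul]
  calc ‖a y‖ * ‖halfLine y‖ ≤ (C * Real.exp (-c * |y|)) * ((1 + 2 / c) * Real.exp (c / 2 * |y|)) := by
        gcongr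
        · exact ha y
        · exact (norm_halfLine_le y).trans h1
    _ = (C * (1 + 2 / c)) * (Real.exp (-c * |y|) * Real.exp (c / 2 * |y|)) := by ring
    _ = _ := by
        rw [← Real.exp_add]
        congr 2
        ring

theorem hasDerivAt_integral_cpow_halfLine {β : ℝ} (hβ : 0 < β) (hβ1 : β ≤ 1) {a : ℝ → ℂ}
    (ham : AEStronglyMeasurable a) {C c : ℝ} (hc : 0 < c)
    (ha : ∀ y, ‖a y‖ ≤ C * Real.exp (-c * |y|)) {t : ℝ} (ht : 0 < t) :
    HasDerivAt (fun t : ℝ => ∫ y, a y * (t : ℂ) ^ (β * halfLine y))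
      (∫ y, a y * ((β * halfLine y) * (t : ℂ) ^ (β * halfLine y - 1))) t := by
  have hs : Set.Ioi (t / 2) ∈ 𝓝 t := Ioi_mem_nhds (by linarith)
  have hpow : ∀ τ : ℝ, Measurable fun y : ℝ => (τ : ℂ) ^ (β * halfLine y) := fun τ =>
    measurable_const.pow (continuous_const.mul continuous_halfLine).measurable
  have hpow' : ∀ τ : ℝ, Measurable fun y : ℝ => (τ : ℂ) ^ (β * halfLine y - 1) := fun τ =>
    measurable_const.pow ((continuous_const.mul continuous_halfLine).sub continuous_const).measurable
  have hha := norm_mul_halfLine_le hc ha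
  refine (hasDerivAt_integral_of_dominated_loc_of_deriv_le hs
    (F := fun (τ : ℝ) (y : ℝ) => a y * (τ : ℂ) ^ (β * halfLine y))
    (F' := fun (τ : ℝ) (y : ℝ) => a y * ((β * halfLine y) * (τ : ℂ) ^ (β * halfLine y - 1)))
    (bound := fun y => ((C * (1 + 2 / c)) * Real.exp (-(c / 2) * |y|)) * (β * (t / 2) ^ (β / 2 - 1)))
    ?_ ?_ ?_ ?_ ?_ ?_).2
  · exact Eventually.of_forall fun τ => ham.mul (hpow τ).aestronglyMeasurable
  · refine ((integrable_exp_neg_mul_abs_real hc).const_mul C |>.mul_const (t ^ (β / 2))).mono'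
      (ham.mul (hpow t).aestronglyMeasurable) (Eventually.of_forall fun y => ?_)
    rw [norm_mul, Complex.norm_cpow_eq_rpow_re_of_pos ht, mul_halfLine_re]
    gcongr
    exact ha y
  · exact ham.mul (((continuous_const.mul continuous_halfLine).measurable).mul
      (hpow' t)).aestronglyMeasurable
  · refine Eventually.of_forall fun y τ hτ => ?_
    have hτ' : t / 2 < τ := hτ
    have hτ0 : 0 < τ := by linarith
    have e : a y * ((β * halfLine y) * (τ : ℂ) ^ (β * halfLine y - 1)) =
        (a y * halfLine y) * (β * (τ : ℂ) ^ (β * halfLine y - 1)) := by ring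
    rw [e, norm_mul, norm_mul (β : ℂ), Complex.norm_cpow_eq_rpow_re_of_pos hτ0, Complex.sub_re,
      mul_halfLine_re, Complex.one_re, Complex.norm_real, Real.norm_of_nonneg hβ.le]
    -- The exponent is negative, so the power is largest at the left end `t/2` of the neighbourhood.
    have h1 : τ ^ (β / 2 - 1) ≤ (t / 2) ^ (β / 2 - 1) :=
      Real.rpow_le_rpow_of_nonpos (by linarith) hτ'.le (by linarith)
    gcongr
    · exact (norm_nonneg _).trans (hha y)
    · exact hha y
  · exact ((integrable_exp_neg_mul_abs_real (half_pos hc)).const_mul _).mul_const _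
  · refine Eventually.of_forall fun y τ hτ => ?_
    have hτ' : t / 2 < τ := hτ
    have hτ0 : 0 < τ := by linarith
    have h1 : HasDerivAt (fun x : ℂ => x ^ (β * halfLine y))
        ((β * halfLine y) * (τ : ℂ) ^ (β * halfLine y - 1) * 1) (τ : ℂ) :=
      (hasDerivAt_id (τ : ℂ)).cpow_const (Or.inl (by simpa using hτ0))
    rw [mul_one] at h1
    exact h1.comp_ofReal.const_mul (a y)

theorem setIntegral_Ioo_cpow_mul_cpow {u v : ℂ} (hu : 0 < u.re) (hv : 0 < v.re) {t : ℝ} (ht : 0 < t) :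
    ∫ τ in Set.Ioo 0 t, (τ : ℂ) ^ (u - 1) * ((t : ℂ) - τ) ^ (v - 1) =
      (t : ℂ) ^ (u + v - 1) * (Complex.Gamma u * Complex.Gamma v / Complex.Gamma (u + v)) := by
  have hG : Complex.Gamma (u + v) ≠ 0 := Complex.Gamma_ne_zero_of_re_pos (by
    rw [Complex.add_re]; linarith)
  rw [← integral_Ioc_eq_integral_Ioo, ← intervalIntegral.integral_of_le ht.le,
    Complex.betaIntegral_scaled u v ht, Complex.Gamma_mul_Gamma_eq_betaIntegral hu hv,
    mul_div_cancel_left₀ _ hG]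

/-- Were the function not integrable, its integral would be `0` by default, whereas the Beta
integral has a nonzero value. -/
theorem integrableOn_Ioo_rpow_mul_rpow {p q : ℝ} (hp : 0 < p) (hq : 0 < q) {t : ℝ} (ht : 0 < t) :
    IntegrableOn (fun τ : ℝ => τ ^ (p - 1) * (t - τ) ^ (q - 1)) (Set.Ioo 0 t) := by
  by_contra hcon
  have h1 := setIntegral_Ioo_cpow_mul_cpow (u := p) (v := q) (by simpa using hp) (by simpa using hq) ht
  have h2 : ∫ τ in Set.Ioo 0 t, (τ : ℂ) ^ ((p : ℂ) - 1) * ((t : ℂ) - τ) ^ ((q : ℂ) - 1) =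
      ((∫ τ in Set.Ioo 0 t, τ ^ (p - 1) * (t - τ) ^ (q - 1) : ℝ) : ℂ) := by
    rw [← integral_complex_ofReal]
    refine setIntegral_congr_fun measurableSet_Ioo fun τ hτ => ?_
    rw [Complex.ofReal_mul, Complex.ofReal_cpow hτ.1.le, Complex.ofReal_cpow (by linarith [hτ.2])]
    push_cast
    rfl
  rw [h2, integral_undef hcon, Complex.ofReal_zero, eq_comm, mul_eq_zero, div_eq_zero_iff,
    mul_eq_zero, Complex.cpow_eq_zero_iff] at h1
  have g1 := Complex.Gamma_ne_zero_of_re_pos (s := (p : ℂ)) (by simpa using hp)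
  have g2 := Complex.Gamma_ne_zero_of_re_pos (s := (q : ℂ)) (by simpa using hq)
  have g3 := Complex.Gamma_ne_zero_of_re_pos (s := (p : ℂ) + q) (by simp; linarith)
  have g4 : (t : ℂ) ≠ 0 := Complex.ofReal_ne_zero.2 ht.ne'
  tauto

/-- The Caputo derivative kills the constant `g₀` and sends `t^w` to `Γ(1+w)/Γ(1-β+w) t^(w-β)`, by
the Beta integral if `β < 1` and by `Γ(1+w) = w Γ(w)` if `β = 1`. The exponential decay of `a`
allows this under the integral sign. -/
theorem hasCaputoDerivAt_integral_cpow_halfLine {β : ℝ} (hβ : 0 < β) (hβ1 : β ≤ 1) {a : ℝ → ℂ}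
    (ham : AEStronglyMeasurable a) {C c : ℝ} (hc : 0 < c)
    (ha : ∀ y, ‖a y‖ ≤ C * Real.exp (-c * |y|)) {G : ℝ → ℂ} {g₀ : ℂ}
    (hG : ∀ t : ℝ, 0 < t → G t = g₀ + ∫ y, a y * (t : ℂ) ^ (β * halfLine y)) {t : ℝ} (ht : 0 < t) :
    HasCaputoDerivAt β G
      (∫ y, a y * (Complex.Gamma (1 + β * halfLine y) / Complex.Gamma (1 - β + β * halfLine y) *
        (t : ℂ) ^ (β * halfLine y - β))) t := by
  have hderiv : ∀ τ : ℝ, 0 < τ →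
      HasDerivAt G (∫ y, a y * ((β * halfLine y) * (τ : ℂ) ^ (β * halfLine y - 1))) τ := by
    intro τ hτ
    refine ((hasDerivAt_integral_cpow_halfLine hβ hβ1 ham hc ha hτ).const_add g₀).congr_of_eventuallyEq ?_
    filter_upwards [lt_mem_nhds hτ] with x hx using hG x hx
  have hβ0 : (β : ℂ) ≠ 0 := Complex.ofReal_ne_zero.2 hβ.ne'
  have hs0 : ∀ y, (β : ℂ) * halfLine y ≠ 0 := fun y => mul_ne_zero hβ0 (halfLine_ne_zero y)
  have hsre : ∀ y, 0 < ((β : ℂ) * halfLine y).re := fun y => by rw [mul_halfLine_re]; linarith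
  have hG1 : ∀ y, Complex.Gamma (1 + β * halfLine y) =
      (β * halfLine y) * Complex.Gamma (β * halfLine y) := fun y => by
    rw [add_comm, Complex.Gamma_add_one _ (hs0 y)]
  unfold HasCaputoDerivAt
  split_ifs with h1
  · subst h1
    convert! hderiv t ht using 1
    congr 1
    funext y
    have h2 := Complex.Gamma_ne_zero_of_re_pos (hsre y)
    rw [hG1]
    simp only [Complex.ofReal_one, sub_self, zero_add] at h2 ⊢
    rw [mul_div_cancel_right₀ _ h2]
  · have hβlt : β < 1 := lt_of_le_of_ne hβ1 h1
    -- On `Re s = 1/2` the integrand is dominated by the Beta density `τ^(β/2-1) (t-τ)^(-β)` times a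
    -- decaying exponential in `y`, which justifies Fubini.
    have hprod : Integrable (Function.uncurry fun (τ y : ℝ) => (((t - τ) ^ (-β) : ℝ) : ℂ) *
        (a y * ((β * halfLine y) * (τ : ℂ) ^ (β * halfLine y - 1))))
        ((volume.restrict (Set.Ioo 0 t)).prod volume) := by
      have hb : Integrable (fun p : ℝ × ℝ => (p.1 ^ (β / 2 - 1) * (t - p.1) ^ (1 - β - 1)) *
          (β * ((C * (1 + 2 / c)) * Real.exp (-(c / 2) * |p.2|))))
          ((volume.restrict (Set.Ioo 0 t)).prod volume) :=
        Integrable.mul_prod (f := fun τ : ℝ => τ ^ (β / 2 - 1) * (t - τ) ^ (1 - β - 1))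
          (integrableOn_Ioo_rpow_mul_rpow (half_pos hβ) (by linarith) ht)
          (((integrable_exp_neg_mul_abs_real (half_pos hc)).const_mul _).const_mul β)
      refine hb.mono' ?_ ?_
      · refine AEStronglyMeasurable.mul ?_ (AEStronglyMeasurable.mul ham.comp_snd ?_)
        · exact (Measurable.aestronglyMeasurable (by fun_prop))
        · have h2 : Measurable fun p : ℝ × ℝ => (β : ℂ) * halfLine p.2 :=
            (continuous_const.mul (continuous_halfLine.comp continuous_snd)).measurable
          exact (h2.mul ((Complex.measurable_ofReal.comp measurable_fst).pow
            (h2.sub_const 1))).aestronglyMeasurable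
      · have hae : ∀ᵐ p : ℝ × ℝ ∂((volume.restrict (Set.Ioo 0 t)).prod volume), p.1 ∈ Set.Ioo 0 t :=
          Measure.quasiMeasurePreserving_fst.ae (ae_restrict_mem measurableSet_Ioo)
        filter_upwards [hae] with p hp
        have e : a p.2 * ((β * halfLine p.2) * (p.1 : ℂ) ^ (β * halfLine p.2 - 1)) =
            (a p.2 * halfLine p.2) * (β * (p.1 : ℂ) ^ (β * halfLine p.2 - 1)) := by ring
        simp only [Function.uncurry]
        rw [e, norm_mul, norm_mul _ (_ * (_ ^ _)), norm_mul (β : ℂ),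
          Complex.norm_cpow_eq_rpow_re_of_pos hp.1, Complex.sub_re,
          mul_halfLine_re, Complex.one_re, Complex.norm_real, Complex.norm_real,
          Real.norm_of_nonneg hβ.le, Real.norm_of_nonneg (Real.rpow_nonneg (by linarith [hp.2]) _)]
        have h2 := norm_mul_halfLine_le hc ha p.2
        have h3 : 0 ≤ p.1 ^ (β / 2 - 1) := Real.rpow_nonneg hp.1.le _
        have h4 : 0 ≤ (t - p.1) ^ (-β) := Real.rpow_nonneg (by linarith [hp.2]) _
        rw [show 1 - β - 1 = -β by ring]
        calc _ = (p.1 ^ (β / 2 - 1) * (t - p.1) ^ (-β)) * (β * ‖a p.2 * halfLine p.2‖) := by ring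
          _ ≤ _ := by gcongr
    have hcongr : ∀ τ ∈ Set.Ioo 0 t, (((t - τ) ^ (-β) : ℝ) : ℂ) * deriv G τ =
        ∫ y, (((t - τ) ^ (-β) : ℝ) : ℂ) *
          (a y * ((β * halfLine y) * (τ : ℂ) ^ (β * halfLine y - 1))) := by
      intro τ hτ
      rw [(hderiv τ hτ.1).deriv, integral_const_mul]
    refine ⟨fun τ hτ => (hderiv τ hτ.1).differentiableAt, ?_, ?_⟩
    · exact (IntegrableOn.congr_fun hprod.integral_prod_left (fun τ hτ => (hcongr τ hτ).symm)
        measurableSet_Ioo)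
    · rw [setIntegral_congr_fun measurableSet_Ioo hcongr, integral_integral_swap hprod,
        ← integral_const_mul]
      congr 1
      funext y
      have hg : Complex.Gamma (1 - β) ≠ 0 := Complex.Gamma_ne_zero_of_re_pos (by simpa using hβlt)
      have h2 : ∀ τ ∈ Set.Ioo 0 t, (((t - τ) ^ (-β) : ℝ) : ℂ) *
          (a y * ((β * halfLine y) * (τ : ℂ) ^ (β * halfLine y - 1))) =
          (a y * (β * halfLine y)) *
            ((τ : ℂ) ^ (β * halfLine y - 1) * ((t : ℂ) - τ) ^ ((1 - β : ℂ) - 1)) := by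
        intro τ hτ
        rw [Complex.ofReal_cpow (by linarith [hτ.2]), show (1 - β : ℂ) - 1 = ((-β : ℝ) : ℂ) by
          push_cast; ring, Complex.ofReal_sub]
        ring
      rw [setIntegral_congr_fun measurableSet_Ioo h2, integral_const_mul,
        setIntegral_Ioo_cpow_mul_cpow (hsre y) (by simpa using hβlt) ht, hG1,
        ← Complex.Gamma_ofReal, Complex.ofReal_sub, Complex.ofReal_one,
        show (β : ℂ) * halfLine y + (1 - β) - 1 = β * halfLine y - β by ring,
        show (β : ℂ) * halfLine y + (1 - β) = 1 - β + β * halfLine y by ring]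
      field_simp

end

noncomputable section

open scoped FourierTransform

/-! ### Fourier transforms -/

theorem fourier_eq_fourierTilde (f : ℝ → ℂ) (u : ℝ) : 𝓕 f u = fourierTilde f (-(2 * Real.pi * u)) := by
  rw [Real.fourier_real_eq_integral_exp_smul, fourierTilde]
  congr 1
  funext x
  rw [smul_eq_mul, mul_comm]
  congr 2
  push_cast
  ring

theorem fourierInv_eq_fourierTilde (f : ℝ → ℂ) (u : ℝ) : 𝓕⁻ f u = fourierTilde f (2 * Real.pi * u) := by
  rw [Real.fourierInv_eq_fourier_neg, fourier_eq_fourierTilde]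
  congr 1
  ring

theorem integral_mul_fourier {f g : ℝ → ℂ} (hf : Integrable f) (hg : Integrable g) :
    ∫ x, f x * 𝓕 g x = ∫ u, 𝓕 f u * g u := by
  simpa using! (VectorFourier.integral_fourierIntegral_smul_eq_flip (L := innerₗ ℝ)
      Real.continuous_fourierChar continuous_inner hf hg).symm

theorem fourierTilde_fourier (χ : SchwartzMap ℝ ℂ) (k : ℝ) :
    fourierTilde (𝓕 χ : SchwartzMap ℝ ℂ) k = χ (k / (2 * Real.pi)) := by
  have hpi := Real.pi_pos
  have h : 𝓕⁻ (((𝓕 χ : SchwartzMap ℝ ℂ)) : ℝ → ℂ) (k / (2 * Real.pi)) = χ (k / (2 * Real.pi)) := by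
    rw [← SchwartzMap.fourierInv_coe, FourierTransform.fourierInv_fourier_eq]
  rw [← h, fourierInv_eq_fourierTilde]
  congr 1
  field_simp

/-- For a test function written as `𝓕 χ` the operator multiplies `χ` by the symbol `-|2πu|^α`. The
product is in general not smooth at `0`, so it is treated as an integrable function only. -/
theorem spaceFracDeriv_fourier (α : ℝ) (χ : SchwartzMap ℝ ℂ) (x : ℝ) :
    spaceFracDeriv α (𝓕 χ) x = 𝓕 (fun u => -((|2 * Real.pi * u| ^ α : ℝ) : ℂ) * χ u) x := by
  have hpi := Real.pi_pos
  have hpi0 : (Real.pi : ℂ) ≠ 0 := Complex.ofReal_ne_zero.2 hpi.ne'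
  have h : ∀ k : ℝ, -((|k| ^ α : ℝ) : ℂ) * fourierTilde (𝓕 χ : SchwartzMap ℝ ℂ) k *
      Complex.exp (-(Complex.I * k * x)) =
      (fun u : ℝ => -((|2 * Real.pi * u| ^ α : ℝ) : ℂ) * χ u *
        Complex.exp (Complex.I * ((-(2 * Real.pi * x) : ℝ) : ℂ) * u)) (k / (2 * Real.pi)) := by
    intro k
    simp only
    rw [fourierTilde_fourier, mul_div_cancel₀ _ (by positivity)]
    congr 2
    push_cast
    field_simp
  rw [spaceFracDeriv, integral_congr_ae (Eventually.of_forall h),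
    Measure.integral_comp_div (fun u : ℝ => -((|2 * Real.pi * u| ^ α : ℝ) : ℂ) * χ u *
        Complex.exp (Complex.I * ((-(2 * Real.pi * x) : ℝ) : ℂ) * u)),
    abs_of_pos (by positivity), Complex.real_smul, fourier_eq_fourierTilde, fourierTilde, ← mul_assoc]
  push_cast
  rw [one_div, inv_mul_cancel₀ (by simp [hpi.ne']), one_mul]

theorem integrable_abs_rpow_mul_schwartz {α : ℝ} (hα : 0 < α) (χ : SchwartzMap ℝ ℂ) :
    Integrable fun u : ℝ => |2 * Real.pi * u| ^ α * ‖χ u‖ := by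
  obtain ⟨n, hn⟩ := exists_nat_ge α
  have h1 := (χ.integrable_pow_mul volume n).const_mul (|2 * Real.pi| ^ n)
  have h2 := (χ.integrable (μ := volume)).norm.add h1
  refine h2.mono' ?_ (Eventually.of_forall fun u => ?_)
  · refine AEStronglyMeasurable.mul ?_ χ.continuous.norm.aestronglyMeasurable
    exact (Measurable.aestronglyMeasurable (by fun_prop))
  · have h3 : |2 * Real.pi * u| ^ α ≤ 1 + |2 * Real.pi * u| ^ n := by
      have h0 := abs_nonneg (2 * Real.pi * u)
      rcases le_total |2 * Real.pi * u| 1 with h | h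
      · exact (Real.rpow_le_one h0 h hα.le).trans (by linarith [pow_nonneg h0 n])
      · have := Real.rpow_le_rpow_of_exponent_le h hn
        rw [Real.rpow_natCast] at this
        linarith
    rw [Real.norm_of_nonneg (by positivity)]
    simp only [Pi.add_apply]
    calc |2 * Real.pi * u| ^ α * ‖χ u‖ ≤ (1 + |2 * Real.pi * u| ^ n) * ‖χ u‖ := by gcongr
      _ = _ := by
        rw [abs_mul (2 * Real.pi) u, mul_pow, Real.norm_eq_abs]
        ring

theorem fourier_foxSolution {α β η : ℝ} (hα : 0 < α) (hβ : 0 < β) (hβ1 : β ≤ 1) (hη : 0 < η)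
    {t : ℝ} (ht : 0 < t) {u : ℝ} (hu : u ≠ 0) :
    𝓕 (fun x => foxSolution α β η x t) u =
      mellinBarnes (mlKernel β) (-1 / 2) (t ^ β * (η * |2 * Real.pi * u| ^ α))⁻¹ := by
  have hpi := Real.pi_pos
  rw [fourier_eq_fourierTilde, fourierTilde,
    integral_foxSolution_mul_exp hα hβ hβ1 hη ht (by simp [hu, hpi.ne']), abs_neg]
  congr 2
  ring

/-! ### Superposition of powers over a vertical line -/

section Superposition

variable {χ : ℝ → ℂ} {w : ℝ → ℝ}

theorem norm_cpow_halfLine {x : ℝ} (hx : 0 ≤ x) (y : ℝ) :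
    ‖(x : ℂ) ^ halfLine y‖ = x ^ (1 / 2 : ℝ) := by
  rw [Complex.norm_cpow_eq_rpow_re_of_nonneg hx (by rw [halfLine_re]; norm_num), halfLine_re]

/-- From `√w ≤ 1 + w`: the power of the symbol met on the line `Re s = 1/2` is controlled by its
first power. -/
theorem integrable_norm_mul_rpow_half (hχ : Integrable χ) (hw : Measurable w) (hw0 : ∀ u, 0 ≤ w u)
    (hχw : Integrable fun u => w u * ‖χ u‖) : Integrable fun u => ‖χ u‖ * w u ^ (1 / 2 : ℝ) := by
  refine (hχ.norm.add hχw).mono' ?_ (Eventually.of_forall fun u => ?_)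
  · exact hχ.norm.aestronglyMeasurable.mul (hw.pow_const _).aestronglyMeasurable
  · have h0 := hw0 u
    have h1 : w u ^ (1 / 2 : ℝ) ≤ 1 + w u := by
      rcases le_total (w u) 1 with h | h
      · exact (Real.rpow_le_one h0 h (by norm_num)).trans (by linarith)
      · have := Real.rpow_le_rpow_of_exponent_le h (by norm_num : (1 / 2 : ℝ) ≤ 1)
        rw [Real.rpow_one] at this
        linarith
    rw [Real.norm_of_nonneg (by positivity)]
    simp only [Pi.add_apply]
    calc ‖χ u‖ * w u ^ (1 / 2 : ℝ) ≤ ‖χ u‖ * (1 + w u) := by gcongr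
      _ = _ := by ring

theorem integrable_prod_cpow_halfLine (hχ : Integrable χ) (hw : Measurable w) (hw0 : ∀ u, 0 ≤ w u)
    (hχw : Integrable fun u => w u * ‖χ u‖) {A : ℝ → ℂ} (hA : Integrable A) :
    Integrable (Function.uncurry fun u y : ℝ => A y * (χ u * (w u : ℂ) ^ halfLine y))
      (volume.prod volume) := by
  have h := (integrable_norm_mul_rpow_half hχ hw hw0 hχw).mul_prod hA.norm
  refine h.mono' ?_ (Eventually.of_forall fun p => ?_)
  · refine hA.aestronglyMeasurable.comp_snd.mul (hχ.aestronglyMeasurable.comp_fst.mul ?_)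
    exact ((Complex.measurable_ofReal.comp (hw.comp measurable_fst)).pow
      (continuous_halfLine.measurable.comp measurable_snd)).aestronglyMeasurable
  · simp only [Function.uncurry]
    rw [norm_mul, norm_mul, norm_cpow_halfLine (hw0 _), mul_comm]

theorem norm_integral_cpow_halfLine_le (hw0 : ∀ u, 0 ≤ w u) (y : ℝ) :
    ‖∫ u, χ u * (w u : ℂ) ^ halfLine y‖ ≤ ∫ u, ‖χ u‖ * w u ^ (1 / 2 : ℝ) := by
  refine (norm_integral_le_integral_norm _).trans (le_of_eq ?_)
  congr 1
  funext u
  rw [norm_mul, norm_cpow_halfLine (hw0 _)]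

theorem aestronglyMeasurable_integral_cpow_halfLine (hχ : Integrable χ) (hw : Measurable w) :
    AEStronglyMeasurable fun y : ℝ => ∫ u, χ u * (w u : ℂ) ^ halfLine y := by
  refine AEStronglyMeasurable.integral_prod_right' (μ := volume) (ν := volume)
    (f := fun p : ℝ × ℝ => χ p.2 * (w p.2 : ℂ) ^ halfLine p.1) ?_
  refine hχ.aestronglyMeasurable.comp_snd.mul ?_
  exact ((Complex.measurable_ofReal.comp (hw.comp measurable_snd)).pow
      (continuous_halfLine.measurable.comp measurable_fst)).aestronglyMeasurable

theorem integral_mul_integral_cpow_halfLine (hχ : Integrable χ) (hw : Measurable w)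
    (hw0 : ∀ u, 0 ≤ w u) (hχw : Integrable fun u => w u * ‖χ u‖) {A : ℝ → ℂ} (hA : Integrable A) :
    ∫ u, χ u * ∫ y, A y * (w u : ℂ) ^ halfLine y =
      ∫ y, A y * ∫ u, χ u * (w u : ℂ) ^ halfLine y := by
  have h := integral_integral_swap (integrable_prod_cpow_halfLine hχ hw hw0 hχw hA)
  simp only [integral_const_mul] at h
  rw [← h]
  congr 1
  funext u
  rw [← integral_const_mul]
  congr 1
  funext y
  ring

end Superposition

theorem integrable_mul_cpow {A : ℝ → ℂ} (hA : Integrable A) {t : ℝ} (ht : 0 < t) {p : ℝ → ℂ} {r : ℝ}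
    (hp : Continuous p) (hr : ∀ y, (p y).re = r) : Integrable fun y => A y * (t : ℂ) ^ p y := by
  refine hA.mul_bdd (c := t ^ r) ?_ (Eventually.of_forall fun y => ?_)
  · exact (measurable_const.pow hp.measurable).aestronglyMeasurable
  · rw [Complex.norm_cpow_eq_rpow_re_of_pos ht, hr]

/-! ### The formula gives a solution -/

theorem inv_mul_cpow_neg {τ w : ℝ} (hτ : 0 < τ) (hw : 0 < w) (β : ℝ) (s : ℂ) :
    (((τ ^ β * w)⁻¹ : ℝ) : ℂ) ^ (-s) = (τ : ℂ) ^ (β * s) * (w : ℂ) ^ s := by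
  have h1 : 0 < τ ^ β := Real.rpow_pos_of_pos hτ β
  rw [ofReal_cpow_eq_exp (inv_pos.2 (mul_pos h1 hw)), ofReal_cpow_eq_exp hτ, ofReal_cpow_eq_exp hw,
    ← Complex.exp_add, Real.log_inv, Real.log_mul h1.ne' hw.ne', Real.log_rpow hτ]
  congr 1
  push_cast
  ring

/-- The equation at the level of kernels: the factor from the Caputo derivative replaces `Γ(1 + βs)`
by `Γ(1 + β(s-1))`, and `sin(π(s-1)) = -sin(πs)` supplies the sign of the symbol. -/
theorem mlKernel_halfLine_sub_one {β : ℝ} (hβ : 0 < β) (y : ℝ) :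
    mlKernel β (halfLine y) * (Complex.Gamma (1 + β * halfLine y) /
      Complex.Gamma (1 - β + β * halfLine y)) =
      -mlKernel β (((-1 / 2 : ℝ) : ℂ) + y * Complex.I) := by
  have h1 : ((-1 / 2 : ℝ) : ℂ) + y * Complex.I = halfLine y - 1 := by
    unfold halfLine; push_cast; ring
  have h2 : Complex.Gamma (1 + β * halfLine y) ≠ 0 := Complex.Gamma_ne_zero_of_re_pos (by
    rw [Complex.add_re, mul_halfLine_re, Complex.one_re]; linarith)
  have h3 : Complex.sin (Real.pi * (halfLine y - 1)) = -Complex.sin (Real.pi * halfLine y) := by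
    rw [mul_sub, mul_one, Complex.sin_sub_pi]
  rw [h1, mlKernel, mlKernel, h3, show 1 + (β : ℂ) * (halfLine y - 1) = 1 - β + β * halfLine y by ring]
  generalize Complex.Gamma (1 + β * halfLine y) = g at h2 ⊢
  field_simp

section Existence

variable {α β η : ℝ}

/-- The symbol `η |2πu| ^ α` of the operator in the frequency variable `u`. -/
def freqSymbol (α η u : ℝ) : ℝ := η * |2 * Real.pi * u| ^ α

theorem measurable_freqSymbol (α η : ℝ) : Measurable (freqSymbol α η) := by
  unfold freqSymbol; fun_prop

theorem freqSymbol_nonneg (α : ℝ) (hη : 0 < η) (u : ℝ) : 0 ≤ freqSymbol α η u := by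
  unfold freqSymbol; positivity

theorem freqSymbol_pos (α : ℝ) (hη : 0 < η) {u : ℝ} (hu : u ≠ 0) : 0 < freqSymbol α η u := by
  have : 0 < |2 * Real.pi * u| := abs_pos.2 (by simp [hu, Real.pi_ne_zero])
  unfold freqSymbol; positivity

theorem integrable_freqSymbol_mul (hα : 0 < α) (η : ℝ) (χ : SchwartzMap ℝ ℂ) :
    Integrable fun u => freqSymbol α η u * ‖χ u‖ := by
  have := (integrable_abs_rpow_mul_schwartz hα χ).const_mul η
  simpa only [freqSymbol, mul_assoc] using this

/-- The Mellin coefficient of the pairing of the solution with a test function. -/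
def pairingCoeff (α β η : ℝ) (χ : ℝ → ℂ) (y : ℝ) : ℂ :=
  (1 / (2 * Real.pi) : ℂ) * mlKernel β (halfLine y) *
    ∫ u, χ u * (freqSymbol α η u : ℂ) ^ halfLine y

theorem ae_ne_zero_real : ∀ᵐ u : ℝ, u ≠ 0 := by
  simp [ae_iff, measure_singleton]

theorem integrable_mlKernel_line (hβ : 0 < β) (hβ1 : β ≤ 1) {σ : ℝ} (h1 : -1 < σ) (h2 : σ < 1)
    (h0 : σ ≠ 0) : Integrable fun y : ℝ => mlKernel β (σ + y * Complex.I) :=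
  (stripDecay_mlKernel hβ hβ1 h1 h2 (lt_or_gt_of_ne h0)).integrable_line le_rfl le_rfl

theorem exists_pairingCoeff_bound (hβ : 0 < β) (hβ1 : β ≤ 1) (hη : 0 < η) (χ : ℝ → ℂ) :
    ∃ C c : ℝ, 0 < c ∧ ∀ y, ‖pairingCoeff α β η χ y‖ ≤ C * Real.exp (-c * |y|) := by
  obtain ⟨C, c, hc, hC⟩ := (stripDecay_mlKernel hβ hβ1 (a := 1 / 2) (b := 1 / 2) (by norm_num)
    (by norm_num) (Or.inr (by norm_num))).exists_line_bound le_rfl le_rfl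
  refine ⟨‖(1 / (2 * Real.pi) : ℂ)‖ * C * ∫ u, ‖χ u‖ * freqSymbol α η u ^ (1 / 2 : ℝ), c, hc,
    fun y => ?_⟩
  have h1 := hC y
  have h2 := norm_integral_cpow_halfLine_le (χ := χ) (freqSymbol_nonneg α hη) y
  rw [pairingCoeff, norm_mul, norm_mul]
  calc _ ≤ ‖(1 / (2 * Real.pi) : ℂ)‖ * (C * Real.exp (-c * |y|)) *
        ∫ u, ‖χ u‖ * freqSymbol α η u ^ (1 / 2 : ℝ) := by
          have h3 : 0 ≤ C * Real.exp (-c * |y|) := (norm_nonneg _).trans h1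
          gcongr
          exact h1
    _ = _ := by ring

theorem aestronglyMeasurable_pairingCoeff (hβ : 0 < β) (hβ1 : β ≤ 1) (χ : SchwartzMap ℝ ℂ) :
    AEStronglyMeasurable (pairingCoeff α β η χ) := by
  refine AEStronglyMeasurable.mul (AEStronglyMeasurable.const_mul ?_ _) ?_
  · exact (integrable_mlKernel_line hβ hβ1 (σ := 1 / 2) (by norm_num) (by norm_num)
      (by norm_num)).aestronglyMeasurable
  · exact aestronglyMeasurable_integral_cpow_halfLine χ.integrable (measurable_freqSymbol α η)

/-- After transposing the Fourier transform onto the solution, the Mittag-Leffler contour is moved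
to `Re s = 1/2`. The residue contributes `∫ χ`, the value of `𝓕 χ` at `0`, and the rest is a
superposition of powers of `t` with positive real exponent. -/
theorem integral_foxSolution_mul_fourier (hα : 0 < α) (hβ : 0 < β) (hβ1 : β ≤ 1) (hη : 0 < η)
    (χ : SchwartzMap ℝ ℂ) {t : ℝ} (ht : 0 < t) :
    ∫ x, foxSolution α β η x t * (𝓕 χ : SchwartzMap ℝ ℂ) x =
      (∫ u, χ u) + ∫ y, pairingCoeff α β η χ y * (t : ℂ) ^ (β * halfLine y) := by
  have hK := integrable_mlKernel_line hβ hβ1 (σ := 1 / 2) (by norm_num) (by norm_num) (by norm_num)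
  have hA : Integrable fun y => mlKernel β (halfLine y) * (t : ℂ) ^ (β * halfLine y) :=
    integrable_mul_cpow (p := fun y => (β : ℂ) * halfLine y) hK ht
      (continuous_const.mul continuous_halfLine) (mul_halfLine_re β)
  have hw := measurable_freqSymbol α η
  have hw0 := freqSymbol_nonneg α hη
  have hχw := integrable_freqSymbol_mul hα η χ
  rw [SchwartzMap.fourier_coe, integral_mul_fourier (integrable_foxSolution hα hβ hβ1 hη ht) χ.integrable]
  have hae : ∀ᵐ u : ℝ, 𝓕 (fun x => foxSolution α β η x t) u * χ u = χ u +
      (1 / (2 * Real.pi) : ℂ) * (χ u * ∫ y, (mlKernel β (halfLine y) * (t : ℂ) ^ (β * halfLine y)) *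
        (freqSymbol α η u : ℂ) ^ halfLine y) := by
    filter_upwards [ae_ne_zero_real] with u hu
    have hwu := freqSymbol_pos α hη hu
    have hz : 0 < (t ^ β * freqSymbol α η u)⁻¹ := by positivity
    rw [fourier_foxSolution hα hβ hβ1 hη ht hu]
    change mellinBarnes (mlKernel β) (-1 / 2) (t ^ β * freqSymbol α η u)⁻¹ * χ u = _
    rw [mellinBarnes_mlKernel_shift hβ hβ1 hz, mellinBarnes, add_mul, one_mul, mul_assoc, mul_comm (χ u)]
    congr 4
    funext y
    change mlKernel β (halfLine y) * _ ^ (-halfLine y) = _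
    rw [inv_mul_cpow_neg ht hwu, mul_assoc]
  have hint : Integrable fun u => χ u * ∫ y, (mlKernel β (halfLine y) *
      (t : ℂ) ^ (β * halfLine y)) * (freqSymbol α η u : ℂ) ^ halfLine y := by
    refine (integrable_prod_cpow_halfLine χ.integrable hw hw0 hχw hA).integral_prod_left.congr
      (Eventually.of_forall fun u => ?_)
    simp only [Function.uncurry]
    rw [← integral_const_mul]
    congr 1
    funext y
    ring
  rw [integral_congr_ae hae, integral_add χ.integrable (hint.const_mul _), integral_const_mul,
    integral_mul_integral_cpow_halfLine χ.integrable hw hw0 hχw hA, ← integral_const_mul]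
  congr 2
  funext y
  rw [pairingCoeff]
  ring

/-- Here the contour stays at `Re s = -1/2`: the extra factor `w` from the symbol turns `w^(s-1)`
into `w^s` with `Re s = 1/2`, so the same coefficients appear as in the undifferentiated pairing. -/
theorem integral_foxSolution_mul_spaceFracDeriv (hα : 0 < α) (hβ : 0 < β) (hβ1 : β ≤ 1) (hη : 0 < η)
    (χ : SchwartzMap ℝ ℂ) {t : ℝ} (ht : 0 < t) :
    (η : ℂ) * ∫ x, foxSolution α β η x t * spaceFracDeriv α (𝓕 χ) x =
      ∫ y, pairingCoeff α β η χ y * (Complex.Gamma (1 + β * halfLine y) /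
        Complex.Gamma (1 - β + β * halfLine y) * (t : ℂ) ^ (β * halfLine y - β)) := by
  have hK := integrable_mlKernel_line hβ hβ1 (σ := -1 / 2) (by norm_num) (by norm_num) (by norm_num)
  have hA : Integrable fun y : ℝ => mlKernel β (((-1 / 2 : ℝ) : ℂ) + y * Complex.I) *
      (t : ℂ) ^ (β * halfLine y - β) :=
    integrable_mul_cpow (p := fun y => (β : ℂ) * halfLine y - β) (r := β / 2 - β) hK ht
      ((continuous_const.mul continuous_halfLine).sub continuous_const)
      (fun y => by rw [Complex.sub_re, mul_halfLine_re, Complex.ofReal_re])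
  have hw := measurable_freqSymbol α η
  have hw0 := freqSymbol_nonneg α hη
  have hχw := integrable_freqSymbol_mul hα η χ
  have hχα : Integrable fun u : ℝ => -((|2 * Real.pi * u| ^ α : ℝ) : ℂ) * χ u := by
    refine (integrable_abs_rpow_mul_schwartz hα χ).mono' ?_ (Eventually.of_forall fun u => ?_)
    · refine AEStronglyMeasurable.mul ?_ χ.continuous.aestronglyMeasurable
      exact (Measurable.aestronglyMeasurable (by fun_prop))
    · rw [norm_mul, norm_neg, Complex.norm_real, Real.norm_of_nonneg (by positivity)]
  simp only [spaceFracDeriv_fourier]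
  rw [integral_mul_fourier (integrable_foxSolution hα hβ hβ1 hη ht) hχα, ← integral_const_mul]
  have hae : ∀ᵐ u : ℝ, (η : ℂ) * (𝓕 (fun x => foxSolution α β η x t) u *
      (-((|2 * Real.pi * u| ^ α : ℝ) : ℂ) * χ u)) =
      -(1 / (2 * Real.pi) : ℂ) * (χ u * ∫ y : ℝ, (mlKernel β (((-1 / 2 : ℝ) : ℂ) + y * Complex.I) *
        (t : ℂ) ^ (β * halfLine y - β)) * (freqSymbol α η u : ℂ) ^ halfLine y) := by
    filter_upwards [ae_ne_zero_real] with u hu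
    have hwu := freqSymbol_pos α hη hu
    have hwu' : (freqSymbol α η u : ℂ) ≠ 0 := Complex.ofReal_ne_zero.2 hwu.ne'
    rw [fourier_foxSolution hα hβ hβ1 hη ht hu]
    change (η : ℂ) * (mellinBarnes (mlKernel β) (-1 / 2) (t ^ β * freqSymbol α η u)⁻¹ * _) = _
    have e : (η : ℂ) * (mellinBarnes (mlKernel β) (-1 / 2) (t ^ β * freqSymbol α η u)⁻¹ *
        (-((|2 * Real.pi * u| ^ α : ℝ) : ℂ) * χ u)) = -(χ u * ((freqSymbol α η u : ℂ) *
        mellinBarnes (mlKernel β) (-1 / 2) (t ^ β * freqSymbol α η u)⁻¹)) := by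
      rw [freqSymbol, Complex.ofReal_mul]
      ring
    have e2 : (freqSymbol α η u : ℂ) *
        mellinBarnes (mlKernel β) (-1 / 2) (t ^ β * freqSymbol α η u)⁻¹ =
        (1 / (2 * Real.pi) : ℂ) * ∫ y : ℝ, (mlKernel β (((-1 / 2 : ℝ) : ℂ) + y * Complex.I) *
        (t : ℂ) ^ (β * halfLine y - β)) * (freqSymbol α η u : ℂ) ^ halfLine y := by
      rw [mellinBarnes, mul_left_comm, ← integral_const_mul]
      congr 2
      funext y
      rw [inv_mul_cpow_neg ht hwu]
      have h1 : ((-1 / 2 : ℝ) : ℂ) + y * Complex.I = halfLine y - 1 := by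
        unfold halfLine; push_cast; ring
      rw [h1, Complex.cpow_sub _ _ hwu', Complex.cpow_one, mul_sub, mul_one]
      field_simp
    rw [e, e2]
    ring
  rw [integral_congr_ae hae, integral_const_mul,
    integral_mul_integral_cpow_halfLine χ.integrable hw hw0 hχw hA, ← integral_const_mul]
  congr 1
  funext y
  have h3 := mlKernel_halfLine_sub_one hβ y
  rw [← neg_eq_iff_eq_neg] at h3
  rw [pairingCoeff, ← h3]
  ring

theorem fourier_fourierInv_schwartz (φ : SchwartzMap ℝ ℂ) :
    (𝓕 (𝓕⁻ φ : SchwartzMap ℝ ℂ) : SchwartzMap ℝ ℂ) = φ :=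
  FourierTransform.fourier_fourierInv_eq φ

theorem isFundamentalSolution_foxSolution (hα : 0 < α) (hβ : 0 < β) (hβ1 : β ≤ 1) (hη : 0 < η) :
    IsFundamentalSolution α β η (foxSolution α β η) where
  integrable t ht := integrable_foxSolution hα hβ hβ1 hη ht
  bounded T _ := ⟨_, fun t ht => (integral_norm_foxSolution hα hβ hβ1 hη ht.1).le⟩
  equation φ t ht := by
    -- Every Schwartz function is a Fourier transform of one, so the two pairing formulas cover all
    -- test functions.
    obtain ⟨χ, rfl⟩ : ∃ χ : SchwartzMap ℝ ℂ, (𝓕 χ : SchwartzMap ℝ ℂ) = φ :=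
      ⟨𝓕⁻ φ, fourier_fourierInv_schwartz φ⟩
    obtain ⟨C, c, hc, hC⟩ := exists_pairingCoeff_bound (α := α) hβ hβ1 hη χ
    rw [integral_foxSolution_mul_spaceFracDeriv hα hβ hβ1 hη χ ht]
    exact hasCaputoDerivAt_integral_cpow_halfLine hβ hβ1 (aestronglyMeasurable_pairingCoeff hβ hβ1 χ)
      hc hC (fun s hs => integral_foxSolution_mul_fourier hα hβ hβ1 hη χ hs) ht
  initial φ := by
    obtain ⟨χ, rfl⟩ : ∃ χ : SchwartzMap ℝ ℂ, (𝓕 χ : SchwartzMap ℝ ℂ) = φ :=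
      ⟨𝓕⁻ φ, fourier_fourierInv_schwartz φ⟩
    obtain ⟨C, c, hc, hC⟩ := exists_pairingCoeff_bound (α := α) hβ hβ1 hη χ
    have h0 : (𝓕 χ : SchwartzMap ℝ ℂ) 0 = ∫ u, χ u := by
      rw [SchwartzMap.fourier_coe, fourier_eq_fourierTilde, fourierTilde]
      simp
    rw [h0]
    have hlim : Tendsto (fun t : ℝ => ∫ y, pairingCoeff α β η χ y * (t : ℂ) ^ (β * halfLine y))
        (𝓝[>] 0) (𝓝 0) := by
      have h1 : Tendsto (fun t : ℝ => (∫ y, ‖pairingCoeff α β η χ y‖) * t ^ (β / 2)) (𝓝[>] 0) (𝓝 0) := by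
        have h2 : Tendsto (fun t : ℝ => t ^ (β / 2)) (𝓝[>] 0) (𝓝 0) := by
          have := (Real.continuousAt_rpow_const 0 (β / 2) (Or.inr (half_pos hβ).le)).tendsto
          rw [Real.zero_rpow (half_pos hβ).ne'] at this
          exact this.mono_left nhdsWithin_le_nhds
        simpa using h2.const_mul (∫ y, ‖pairingCoeff α β η χ y‖)
      refine squeeze_zero_norm' ?_ h1
      filter_upwards [self_mem_nhdsWithin] with t ht
      refine (norm_integral_le_integral_norm _).trans (le_of_eq ?_)
      rw [← integral_mul_const]
      congr 1
      funext y
      rw [norm_mul, Complex.norm_cpow_eq_rpow_re_of_pos ht, mul_halfLine_re]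
    have h2 := hlim.const_add (∫ u, χ u)
    rw [add_zero] at h2
    refine h2.congr' ?_
    filter_upwards [self_mem_nhdsWithin] with t ht
    exact (integral_foxSolution_mul_fourier hα hβ hβ1 hη χ ht).symm

end Existence

end

/-! ### Uniqueness: Abel inversion, a weighted estimate, and passage to Fourier transforms. -/

noncomputable section

open scoped FourierTransform

/-! ### Inversion of the Caputo derivative -/

theorem HasCaputoDerivAt.sub {β : ℝ} {f g : ℝ → ℂ} {v w : ℂ} {t : ℝ} (hf : HasCaputoDerivAt β f v t)
    (hg : HasCaputoDerivAt β g w t) : HasCaputoDerivAt β (fun s => f s - g s) (v - w) t := by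
  unfold HasCaputoDerivAt at *
  split_ifs at * with h
  · exact HasDerivAt.sub hf hg
  · obtain ⟨hf1, hf2, hf3⟩ := hf
    obtain ⟨hg1, hg2, hg3⟩ := hg
    have e : ∀ τ ∈ Set.Ioo 0 t, (((t - τ) ^ (-β) : ℝ) : ℂ) * deriv (fun s => f s - g s) τ =
        (((t - τ) ^ (-β) : ℝ) : ℂ) * deriv f τ - (((t - τ) ^ (-β) : ℝ) : ℂ) * deriv g τ := by
      intro τ hτ
      rw [deriv_fun_sub (hf1 τ hτ) (hg1 τ hτ), mul_sub]
    refine ⟨fun τ hτ => (hf1 τ hτ).sub (hg1 τ hτ), ?_, ?_⟩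
    · exact (hf2.sub hg2).congr_fun (fun τ hτ => (e τ hτ).symm) measurableSet_Ioo
    · rw [setIntegral_congr_fun measurableSet_Ioo e, integral_sub hf2 hg2, hf3, hg3, mul_sub]

theorem integral_Ioo_rpow_mul_rpow_one {β : ℝ} (hβ : 0 < β) (hβ1 : β < 1) {t : ℝ} (ht : 0 < t) :
    ∫ τ in Set.Ioo 0 t, τ ^ (-β) * (t - τ) ^ (β - 1) = Real.Gamma (1 - β) * Real.Gamma β := by
  have h1 := setIntegral_Ioo_cpow_mul_cpow (u := ((1 - β : ℝ) : ℂ)) (v := β)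
    (by rw [Complex.ofReal_re]; linarith) (by simpa using hβ) ht
  have h2 : ∫ τ in Set.Ioo 0 t, (τ : ℂ) ^ (((1 - β : ℝ) : ℂ) - 1) * ((t : ℂ) - τ) ^ ((β : ℂ) - 1) =
      ((∫ τ in Set.Ioo 0 t, τ ^ (-β) * (t - τ) ^ (β - 1) : ℝ) : ℂ) := by
    rw [← integral_complex_ofReal]
    refine setIntegral_congr_fun measurableSet_Ioo fun τ hτ => ?_
    rw [Complex.ofReal_mul, Complex.ofReal_cpow hτ.1.le, Complex.ofReal_cpow (by linarith [hτ.2])]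
    push_cast
    congr 2
    ring
  rw [h2] at h1
  have h3 : ((1 - β : ℝ) : ℂ) + β = 1 := by push_cast; ring
  rw [h3, sub_self, Complex.cpow_zero, one_mul, Complex.Gamma_one, div_one, Complex.Gamma_ofReal,
    Complex.Gamma_ofReal] at h1
  exact_mod_cast h1

theorem eq_setIntegral_deriv {g : ℝ → ℂ} (h0 : Tendsto g (𝓝[>] 0) (𝓝 0))
    (hg : ∀ t, 0 < t → DifferentiableAt ℝ g t) {t : ℝ} (ht : 0 < t)
    (hint : IntegrableOn (deriv g) (Set.Ioo 0 t)) : ∫ s in Set.Ioo 0 t, deriv g s = g t := by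
  rw [← integral_Ioc_eq_integral_Ioo, ← intervalIntegral.integral_of_le ht.le,
    intervalIntegral.integral_eq_sub_of_hasDerivAt_of_tendsto ht
      (fun x hx => (hg x hx.1).hasDerivAt)
      ((intervalIntegrable_iff_integrableOn_Ioo_of_le ht.le).2 hint) h0
      ((hg t ht).continuousAt.tendsto.mono_left nhdsWithin_le_nhds), sub_zero]

section Abel

variable {β t : ℝ} {f : ℝ → ℂ}

/-- The kernel of the composition of the fractional integral of order `β` with the one of order
`1 - β`, applied to `f`. -/
def abelKernel (β t : ℝ) (f : ℝ → ℂ) (p : ℝ × ℝ) : ℂ :=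
  {p : ℝ × ℝ | 0 < p.2 ∧ p.2 < p.1 ∧ p.1 < t}.indicator
    (fun p => (((p.1 - p.2) ^ (-β) * (t - p.1) ^ (β - 1) : ℝ) : ℂ) * f p.2) p

theorem abelKernel_eq_left (s τ : ℝ) : abelKernel β t f (s, τ) =
    (Set.Ioo 0 t).indicator (fun s => (((t - s) ^ (β - 1) : ℝ) : ℂ) *
      (Set.Ioo 0 s).indicator (fun τ => (((s - τ) ^ (-β) : ℝ) : ℂ) * f τ) τ) s := by
  simp only [abelKernel, Set.indicator_apply, Set.mem_ofPred_eq, Set.mem_Ioo]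
  by_cases h : 0 < τ ∧ τ < s ∧ s < t
  · rw [if_pos h, if_pos ⟨h.1.trans h.2.1, h.2.2⟩, if_pos ⟨h.1, h.2.1⟩]
    push_cast; ring
  · rw [if_neg h]
    split_ifs with h1 h2
    · exact absurd ⟨h2.1, h2.2, h1.2⟩ h
    · simp
    · rfl

/-- For fixed `τ` the kernel in `s` is a translate of a Beta density on `(0, t - τ)`, so its
integral over `s` is the same constant for every `τ < t`. -/
theorem abelKernel_eq_right (s τ : ℝ) : abelKernel β t f (s, τ) =
    (Set.Ioo 0 t).indicator f τ * (((Set.Ioo 0 (t - τ)).indicator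
      (fun r => r ^ (-β) * (t - τ - r) ^ (β - 1)) (s - τ) : ℝ) : ℂ) := by
  simp only [abelKernel, Set.indicator_apply, Set.mem_ofPred_eq, Set.mem_Ioo]
  by_cases h : 0 < τ ∧ τ < s ∧ s < t
  · rw [if_pos h, if_pos ⟨h.1, h.2.1.trans h.2.2⟩, if_pos ⟨by linarith, by linarith⟩,
      show t - τ - (s - τ) = t - s by ring, mul_comm]
  · rw [if_neg h]
    split_ifs with h1 h2
    · exact absurd ⟨h1.1, by linarith, by linarith⟩ h
    · simp
    · simp
    · simp

theorem integrable_abelKernel_section (hβ : 0 < β) (hβ1 : β < 1) {τ : ℝ} (h : τ < t) :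
    Integrable (fun s => (Set.Ioo 0 (t - τ)).indicator
      (fun r => r ^ (-β) * (t - τ - r) ^ (β - 1)) (s - τ)) := by
  have h1 := integrableOn_Ioo_rpow_mul_rpow (p := 1 - β) (q := β) (by linarith) hβ (sub_pos.2 h)
  rw [show 1 - β - 1 = -β by ring] at h1
  exact ((integrable_indicator_iff measurableSet_Ioo).2 h1).comp_sub_right τ

theorem integral_abelKernel_section (hβ : 0 < β) (hβ1 : β < 1) {τ : ℝ} (h : τ < t) :
    ∫ s, (Set.Ioo 0 (t - τ)).indicator
      (fun r => r ^ (-β) * (t - τ - r) ^ (β - 1)) (s - τ) = Real.Gamma (1 - β) * Real.Gamma β := by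
  rw [integral_sub_right_eq_self (fun x => (Set.Ioo 0 (t - τ)).indicator
      (fun r => r ^ (-β) * (t - τ - r) ^ (β - 1)) x) τ, integral_indicator measurableSet_Ioo,
    integral_Ioo_rpow_mul_rpow_one hβ hβ1 (sub_pos.2 h)]

theorem norm_abelKernel (s τ : ℝ) : ‖abelKernel β t f (s, τ)‖ =
    (Set.Ioo 0 t).indicator (fun τ => ‖f τ‖) τ * (Set.Ioo 0 (t - τ)).indicator
      (fun r => r ^ (-β) * (t - τ - r) ^ (β - 1)) (s - τ) := by
  rw [abelKernel_eq_right, norm_mul, norm_indicator_eq_indicator_norm, Complex.norm_real,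
    Real.norm_of_nonneg]
  refine Set.indicator_nonneg (fun r hr => ?_) _
  have := hr.1
  have := hr.2
  have : 0 ≤ t - τ - r := by linarith
  positivity

/-- Tonelli with the integration over `s` inside: the inner integral of the norm is `‖f τ‖` times
the Beta constant. -/
theorem integrable_abelKernel (hβ : 0 < β) (hβ1 : β < 1) (hf : Measurable f)
    (hint : IntegrableOn f (Set.Ioo 0 t)) : Integrable (abelKernel β t f) (volume.prod volume) := by
  have hm : AEStronglyMeasurable (abelKernel β t f) (volume.prod volume) := by
    refine AEStronglyMeasurable.indicator (Measurable.aestronglyMeasurable (by fun_prop)) ?_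
    exact (measurableSet_lt measurable_const measurable_snd).inter
      ((measurableSet_lt measurable_snd measurable_fst).inter
        (measurableSet_lt measurable_fst measurable_const))
  rw [integrable_prod_iff' hm]
  constructor
  · refine Eventually.of_forall fun τ => ?_
    simp only [abelKernel_eq_right]
    by_cases h : τ < t
    · exact (integrable_abelKernel_section hβ hβ1 h).ofReal.const_mul _
    · simp [Set.indicator_of_notMem (fun h' : τ ∈ Set.Ioo 0 t => h h'.2)]
  · have h1 : Integrable fun τ => (Set.Ioo 0 t).indicator (fun τ => ‖f τ‖) τ *
        (Real.Gamma (1 - β) * Real.Gamma β) :=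
      ((integrable_indicator_iff measurableSet_Ioo).2 hint.norm).mul_const _
    refine h1.congr (Eventually.of_forall fun τ => ?_)
    simp only [norm_abelKernel]
    rw [integral_const_mul]
    by_cases h : τ < t
    · rw [integral_abelKernel_section hβ hβ1 h]
    · simp [Set.indicator_of_notMem (fun h' : τ ∈ Set.Ioo 0 t => h h'.2)]

/-- Abel's inversion: the fractional integrals of orders `β` and `1 - β` compose to the ordinary
integral, and the constant is the Beta integral `Γ(1-β) Γ(β)`. -/
theorem integral_abelKernel (hβ : 0 < β) (hβ1 : β < 1) (hf : Measurable f)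
    (hint : IntegrableOn f (Set.Ioo 0 t)) :
    ∫ s in Set.Ioo 0 t, (((t - s) ^ (β - 1) : ℝ) : ℂ) *
      ∫ τ in Set.Ioo 0 s, (((s - τ) ^ (-β) : ℝ) : ℂ) * f τ =
    (Real.Gamma (1 - β) * Real.Gamma β : ℝ) * ∫ τ in Set.Ioo 0 t, f τ := by
  have h := integral_integral_swap (f := fun s τ => abelKernel β t f (s, τ))
    (integrable_abelKernel hβ hβ1 hf hint)
  have h1 : ∀ s, ∫ τ, abelKernel β t f (s, τ) = (Set.Ioo 0 t).indicator
      (fun s => (((t - s) ^ (β - 1) : ℝ) : ℂ) *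
      ∫ τ in Set.Ioo 0 s, (((s - τ) ^ (-β) : ℝ) : ℂ) * f τ) s := by
    intro s
    simp only [abelKernel_eq_left]
    by_cases hs : s ∈ Set.Ioo 0 t
    · simp only [Set.indicator_of_mem hs]
      rw [integral_const_mul, integral_indicator measurableSet_Ioo]
    · simp only [Set.indicator_of_notMem hs, integral_zero]
  have h2 : ∀ τ, ∫ s, abelKernel β t f (s, τ) = (Set.Ioo 0 t).indicator f τ *
      (Real.Gamma (1 - β) * Real.Gamma β : ℝ) := by
    intro τ
    simp only [abelKernel_eq_right]
    rw [integral_const_mul, integral_complex_ofReal]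
    by_cases hτ : τ < t
    · rw [integral_abelKernel_section hβ hβ1 hτ]
    · simp [Set.indicator_of_notMem (fun h' : τ ∈ Set.Ioo 0 t => hτ h'.2)]
  simp only [h1, h2] at h
  rw [integral_indicator measurableSet_Ioo, integral_mul_const, integral_indicator measurableSet_Ioo]
    at h
  rw [h, mul_comm]

end Abel

/-- A function that vanishes at `0+` is the fractional integral of its Caputo derivative. -/
theorem HasCaputoDerivAt.eq_fractionalIntegral {β : ℝ} (hβ : 0 < β) (hβ1 : β ≤ 1) {g h : ℝ → ℂ}
    (h0 : Tendsto g (𝓝[>] 0) (𝓝 0)) (hg : ∀ t, 0 < t → HasCaputoDerivAt β g (h t) t) {t B : ℝ}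
    (ht : 0 < t) (hB : ∀ s ∈ Set.Ioo 0 t, ‖h s‖ ≤ B) :
    g t = ((Real.Gamma β : ℝ) : ℂ)⁻¹ * ∫ s in Set.Ioo 0 t, (((t - s) ^ (β - 1) : ℝ) : ℂ) * h s := by
  rcases eq_or_lt_of_le hβ1 with rfl | hlt
  · have hd : ∀ s, 0 < s → HasDerivAt g (h s) s := fun s hs => by
      simpa [HasCaputoDerivAt] using hg s hs
    have e : ∀ s ∈ Set.Ioo 0 t, (((t - s) ^ ((1 : ℝ) - 1) : ℝ) : ℂ) * h s = deriv g s := by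
      intro s hs
      rw [sub_self, Real.rpow_zero, Complex.ofReal_one, one_mul, (hd s hs.1).deriv]
    rw [setIntegral_congr_fun measurableSet_Ioo e, Real.Gamma_one, eq_setIntegral_deriv h0
      (fun s hs => (hd s hs).differentiableAt) ht]
    · simp
    -- For `β = 1` integrability of the derivative is not part of the definition; it comes from the
    -- bound on `h`.
    · refine Measure.integrableOn_of_bounded (M := B) (by simp)
        (measurable_deriv g).aestronglyMeasurable ?_
      refine (ae_restrict_mem measurableSet_Ioo).mono fun s hs => ?_
      rw [(hd s hs.1).deriv]
      exact hB s hs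
  · have hC : ∀ t : ℝ, 0 < t → _ := fun t ht => by
      have := hg t ht
      rw [HasCaputoDerivAt, if_neg hlt.ne] at this
      exact this
    -- The Caputo derivative at a later time, here `s + 1`, includes differentiability at `s`.
    have hd : ∀ s, 0 < s → DifferentiableAt ℝ g s := fun s hs =>
      (hC (s + 1) (by linarith)).1 s ⟨hs, by linarith⟩
    -- The weight `(t-s)^(-β)` is at least `t^(-β)` on `(0, t)`, so the absolute convergence of the
    -- Caputo integral gives that of `∫ g'`.
    have hint : IntegrableOn (deriv g) (Set.Ioo 0 t) := by
      refine Integrable.mono' ((hC t ht).2.1.norm.const_mul (t ^ β))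
        (measurable_deriv g).aestronglyMeasurable ?_
      refine (ae_restrict_mem measurableSet_Ioo).mono fun s hs => ?_
      have h1 : 0 < t - s := by linarith [hs.2]
      rw [norm_mul, Complex.norm_real, Real.norm_of_nonneg (by positivity), ← mul_assoc]
      have h2 : 1 ≤ t ^ β * (t - s) ^ (-β) := by
        rw [Real.rpow_neg h1.le, ← div_eq_mul_inv, one_le_div (by positivity)]
        exact Real.rpow_le_rpow h1.le (by linarith [hs.1]) hβ.le
      exact le_mul_of_one_le_left (norm_nonneg _) h2
    have hG1 := (Real.Gamma_pos_of_pos hβ).ne'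
    have hG2 := (Real.Gamma_pos_of_pos (sub_pos.2 hlt)).ne'
    have e : ∀ s ∈ Set.Ioo 0 t, (((t - s) ^ (β - 1) : ℝ) : ℂ) * h s =
        ((Real.Gamma (1 - β) : ℝ) : ℂ)⁻¹ * ((((t - s) ^ (β - 1) : ℝ) : ℂ) *
          ∫ τ in Set.Ioo 0 s, (((s - τ) ^ (-β) : ℝ) : ℂ) * deriv g τ) := by
      intro s hs
      rw [(hC s hs.1).2.2]
      ring
    rw [setIntegral_congr_fun measurableSet_Ioo e, integral_const_mul,
      integral_abelKernel hβ hlt (measurable_deriv g) hint, eq_setIntegral_deriv h0 hd ht hint]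
    have := Complex.ofReal_ne_zero.2 hG1
    have := Complex.ofReal_ne_zero.2 hG2
    push_cast
    field_simp

/-- Writing `exp(σs) = exp(σt) exp(-σ(t-s))` in the fractional integral and extending the range of
`r = t - s` to `(0, ∞)` gives the factor `σ^(-β)`. A large `σ` thus makes the inversion of the
derivative contracting. -/
theorem HasCaputoDerivAt.norm_le_exp {β : ℝ} (hβ : 0 < β) (hβ1 : β ≤ 1) {g h : ℝ → ℂ}
    (h0 : Tendsto g (𝓝[>] 0) (𝓝 0)) (hg : ∀ t, 0 < t → HasCaputoDerivAt β g (h t) t) {t B σ : ℝ}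
    (ht : 0 < t) (hσ : 0 < σ) (hB : ∀ s ∈ Set.Ioo 0 t, ‖h s‖ ≤ B * Real.exp (σ * s)) :
    ‖g t‖ ≤ B * σ ^ (-β) * Real.exp (σ * t) := by
  have hB0 : 0 ≤ B := by
    have h1 := (norm_nonneg _).trans (hB (t / 2) ⟨by linarith, by linarith⟩)
    exact nonneg_of_mul_nonneg_left h1 (Real.exp_pos _)
  have hG := Real.Gamma_pos_of_pos hβ
  rw [HasCaputoDerivAt.eq_fractionalIntegral hβ hβ1 h0 hg ht (B := B * Real.exp (σ * t))
    (fun s hs => (hB s hs).trans (by have := hs.2; gcongr)), norm_mul, norm_inv, Complex.norm_real,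
    Real.norm_of_nonneg hG.le]
  have hk : Integrable ((Set.Ioi (0 : ℝ)).indicator fun r => r ^ (β - 1) * Real.exp (-(σ * r))) := by
    rw [integrable_indicator_iff measurableSet_Ioi]
    have := integrableOn_rpow_mul_exp_neg_mul_rpow (p := 1) (s := β - 1) (b := σ)
      (by linarith) one_pos hσ
    simpa using this
  have hk' := (hk.comp_sub_left t).const_mul (B * Real.exp (σ * t))
  have h1 : ‖∫ s in Set.Ioo 0 t, (((t - s) ^ (β - 1) : ℝ) : ℂ) * h s‖ ≤
      ∫ s in Set.Ioo 0 t, B * Real.exp (σ * t) *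
        (Set.Ioi (0 : ℝ)).indicator (fun r => r ^ (β - 1) * Real.exp (-(σ * r))) (t - s) := by
    refine norm_integral_le_of_norm_le hk'.integrableOn ?_
    refine (ae_restrict_mem measurableSet_Ioo).mono fun s hs => ?_
    have h2 : 0 < t - s := by linarith [hs.2]
    rw [Set.indicator_of_mem (Set.mem_Ioi.2 h2), norm_mul, Complex.norm_real,
      Real.norm_of_nonneg (by positivity)]
    calc _ ≤ (t - s) ^ (β - 1) * (B * Real.exp (σ * s)) := by gcongr; exact hB s hs
      _ = (t - s) ^ (β - 1) * (B * Real.exp (σ * t + -(σ * (t - s)))) := by ring_nf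
      _ = _ := by rw [Real.exp_add]; ring
  have h2 : ∫ s in Set.Ioo 0 t, B * Real.exp (σ * t) *
        (Set.Ioi (0 : ℝ)).indicator (fun r => r ^ (β - 1) * Real.exp (-(σ * r))) (t - s) ≤
      B * Real.exp (σ * t) * ((1 / σ) ^ β * Real.Gamma β) := by
    refine (setIntegral_le_integral hk' (Eventually.of_forall fun s => ?_)).trans (le_of_eq ?_)
    · refine mul_nonneg (by positivity) (Set.indicator_nonneg (fun r hr => ?_) _)
      have : 0 < r := hr
      positivity
    · rw [integral_const_mul, integral_sub_left_eq_self (fun x => (Set.Ioi (0 : ℝ)).indicator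
        (fun r => r ^ (β - 1) * Real.exp (-(σ * r))) x) volume t, integral_indicator measurableSet_Ioi,
        Real.integral_rpow_mul_exp_neg_mul_Ioi hβ hσ]
  calc _ ≤ (Real.Gamma β)⁻¹ * (B * Real.exp (σ * t) * ((1 / σ) ^ β * Real.Gamma β)) := by
        gcongr; exact h1.trans h2
    _ = _ := by
        rw [one_div, Real.inv_rpow hσ.le, ← Real.rpow_neg hσ.le]
        field_simp

/-- A chain of functions, each a multiple of the Caputo derivative of the one before it, vanishes if
it starts from zero and grows at most geometrically along the chain. -/
theorem eq_zero_of_hasCaputoDerivAt_succ {β η ρ : ℝ} (hβ : 0 < β) (hβ1 : β ≤ 1) (hη : 0 < η)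
    (hρ : 0 ≤ ρ) {g : ℕ → ℝ → ℂ} (h0 : ∀ m, Tendsto (g m) (𝓝[>] 0) (𝓝 0))
    (hg : ∀ m t, 0 < t → HasCaputoDerivAt β (g m) (η * g (m + 1) t) t)
    (hb : ∀ T, 0 < T → ∃ D, ∀ m, ∀ t ∈ Set.Ioc 0 T, ‖g m t‖ ≤ D * ρ ^ m) {t : ℝ} (ht : 0 < t) :
    g 0 t = 0 := by
  obtain ⟨D, hD⟩ := hb t ht
  -- One step along the chain costs `η ρ` and gains `σ^(-β)`; `σ` is taken so large that the product
  -- is below `1`.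
  have hσ : ∃ σ : ℝ, 0 < σ ∧ η * ρ * σ ^ (-β) < 1 := by
    have h1 : Tendsto (fun σ : ℝ => η * ρ * σ ^ (-β)) atTop (𝓝 0) := by
      simpa using (tendsto_rpow_neg_atTop hβ).const_mul (η * ρ)
    obtain ⟨σ, h2, h3⟩ := ((eventually_gt_atTop 0).and (h1.eventually (gt_mem_nhds one_pos))).exists
    exact ⟨σ, h2, h3⟩
  obtain ⟨σ, hσ0, hσ1⟩ := hσ
  set q := η * ρ * σ ^ (-β) with hq
  have hq0 : 0 ≤ q := by positivity
  have hD0 : 0 ≤ D := by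
    have := (norm_nonneg _).trans (hD 0 t ⟨ht, le_rfl⟩)
    simpa using this
  -- The bound for `g m` after `n + 1` steps uses that for `g (m + 1)` after `n` steps, so `m` must
  -- be free in the induction.
  have key : ∀ n m : ℕ, ∀ s ∈ Set.Ioc 0 t, ‖g m s‖ ≤ q ^ n * (D * ρ ^ m) * Real.exp (σ * s) := by
    intro n
    induction n with
    | zero =>
      intro m s hs
      rw [pow_zero, one_mul]
      refine (hD m s hs).trans (le_mul_of_one_le_right (by positivity) ?_)
      exact Real.one_le_exp (mul_nonneg hσ0.le hs.1.le)
    | succ n ih =>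
      intro m s hs
      refine (HasCaputoDerivAt.norm_le_exp hβ hβ1 (h0 m) (hg m) (B := η * (q ^ n * (D * ρ ^ (m + 1))))
        hs.1 hσ0 fun τ hτ => ?_).trans (le_of_eq ?_)
      · rw [norm_mul, Complex.norm_real, Real.norm_of_nonneg hη.le, mul_assoc]
        exact mul_le_mul_of_nonneg_left (ih (m + 1) τ ⟨hτ.1, hτ.2.le.trans hs.2⟩) hη.le
      · rw [hq]; ring
  have h1 : Tendsto (fun n : ℕ => q ^ n * (D * ρ ^ 0) * Real.exp (σ * t)) atTop (𝓝 0) := by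
    have := ((tendsto_pow_atTop_nhds_zero_of_lt_one hq0 hσ1).mul_const (D * ρ ^ 0)).mul_const
      (Real.exp (σ * t))
    simpa using this
  have h2 := ge_of_tendsto' h1 fun n => key n 0 t ⟨ht, le_rfl⟩
  exact norm_le_zero_iff.1 h2

end

noncomputable section

open scoped FourierTransform

/-! ### Uniqueness of the solution -/

section Uniqueness

variable {α β η : ℝ}

theorem norm_integral_mul_fourier_le {f g : ℝ → ℂ} (hf : Integrable f) :
    ‖∫ x, f x * 𝓕 g x‖ ≤ (∫ x, ‖f x‖) * ∫ u, ‖g u‖ := by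
  rw [← integral_mul_const]
  refine norm_integral_le_of_norm_le (hf.norm.mul_const _) (Eventually.of_forall fun x => ?_)
  rw [norm_mul]
  gcongr
  exact VectorFourier.norm_fourierIntegral_le_integral_norm _ _ _ g x

/-- The iterated symbol of the space-fractional derivative times a function that vanishes near
`0`. -/
def symbolPowMul (α : ℝ) (n : ℕ) (χ : ℝ → ℂ) (u : ℝ) : ℂ :=
  (-((|2 * Real.pi * u| ^ α : ℝ) : ℂ)) ^ n * χ u

/-- The symbol is smooth except at `0`, and `χ` vanishes near `0`. The operator can therefore be
iterated within Schwartz functions. -/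
theorem contDiff_symbolPowMul {χ : ℝ → ℂ} (hχ : ContDiff ℝ (⊤ : ℕ∞) χ) (h0 : (0 : ℝ) ∉ tsupport χ)
    (α : ℝ) (n : ℕ) : ContDiff ℝ (⊤ : ℕ∞) (symbolPowMul α n χ) := by
  rw [contDiff_iff_contDiffAt]
  intro u
  rcases eq_or_ne u 0 with rfl | hu
  · have h1 : symbolPowMul α n χ =ᶠ[𝓝 0] fun _ => 0 := by
      filter_upwards [notMem_tsupport_iff_eventuallyEq.1 h0] with v hv
      simp [symbolPowMul, hv]
    exact contDiffAt_const.congr_of_eventuallyEq h1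
  · have h2 : 2 * Real.pi * u ≠ 0 := by simp [hu, Real.pi_ne_zero]
    have h3 : ContDiffAt ℝ (⊤ : ℕ∞) (fun v : ℝ => |2 * Real.pi * v| ^ α) u :=
      ContDiffAt.rpow_const_of_ne ((contDiffAt_abs h2).comp u (by fun_prop)) (abs_pos.2 h2).ne'
    have h4 : ContDiffAt ℝ (⊤ : ℕ∞) (fun v : ℝ => ((|2 * Real.pi * v| ^ α : ℝ) : ℂ)) u :=
      Complex.ofRealCLM.contDiff.contDiffAt.comp u h3
    exact (h4.neg.pow n).mul hχ.contDiffAt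

theorem hasCompactSupport_symbolPowMul {χ : ℝ → ℂ} (hχ : HasCompactSupport χ) (α : ℝ) (n : ℕ) :
    HasCompactSupport (symbolPowMul α n χ) :=
  HasCompactSupport.mul_left hχ

/-- The rate `ρ` is a bound of `|2πu|^α` on the compact support of `χ`; this is the geometric growth
along the chain. -/
theorem exists_norm_symbolPowMul_le {χ : ℝ → ℂ} (hχ : HasCompactSupport χ) (hα : 0 < α) :
    ∃ ρ : ℝ, 0 ≤ ρ ∧ ∀ n u, ‖symbolPowMul α n χ u‖ ≤ ρ ^ n * ‖χ u‖ := by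
  obtain ⟨R, hR⟩ := hχ.isCompact.exists_bound_of_continuousOn (f := fun u : ℝ => |2 * Real.pi * u| ^ α)
    ((Continuous.rpow_const (by fun_prop) (fun _ => Or.inr hα.le)).continuousOn)
  refine ⟨|R|, abs_nonneg R, fun n u => ?_⟩
  rw [symbolPowMul, norm_mul, norm_pow, norm_neg, Complex.norm_real]
  by_cases hu : u ∈ tsupport χ
  · gcongr
    exact (hR u hu).trans (le_abs_self R)
  · simp [image_eq_zero_of_notMem_tsupport hu]

theorem integral_norm_symbolPowMul_le {χ : ℝ → ℂ} (hχ : Integrable χ) {ρ : ℝ}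
    (hρ : ∀ n u, ‖symbolPowMul α n χ u‖ ≤ ρ ^ n * ‖χ u‖) (n : ℕ) :
    ∫ u, ‖symbolPowMul α n χ u‖ ≤ ρ ^ n * ∫ u, ‖χ u‖ := by
  rw [← integral_const_mul]
  exact integral_mono_of_nonneg (Eventually.of_forall fun u => norm_nonneg _)
    (hχ.norm.const_mul _) (Eventually.of_forall (hρ n))

/-- Two solutions agree when tested against the Fourier transform of a smooth function whose support
is compact and avoids the frequency `0`. -/
theorem IsFundamentalSolution.integral_mul_fourier_eq {M N : ℝ → ℝ → ℂ}
    (hM : IsFundamentalSolution α β η M) (hN : IsFundamentalSolution α β η N) (hα : 0 < α)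
    (hβ : 0 < β) (hβ1 : β ≤ 1) (hη : 0 < η) {χ : ℝ → ℂ} (hχ : ContDiff ℝ (⊤ : ℕ∞) χ)
    (hc : HasCompactSupport χ) (h0 : (0 : ℝ) ∉ tsupport χ) {t : ℝ} (ht : 0 < t) :
    ∫ x, M x t * 𝓕 χ x = ∫ x, N x t * 𝓕 χ x := by
  let X : ℕ → SchwartzMap ℝ ℂ := fun n =>
    (hasCompactSupport_symbolPowMul hc α n).toSchwartzMap (contDiff_symbolPowMul hχ h0 α n)
  have hX : ∀ n, (X n : ℝ → ℂ) = symbolPowMul α n χ := fun n => rfl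
  have hX' : ∀ n x, (𝓕 (X n) : SchwartzMap ℝ ℂ) x = 𝓕 (symbolPowMul α n χ) x := fun n x => by
    rw [SchwartzMap.fourier_coe, hX]
  have hD : ∀ n x, spaceFracDeriv α (𝓕 (X n) : SchwartzMap ℝ ℂ) x =
      (𝓕 (X (n + 1)) : SchwartzMap ℝ ℂ) x := by
    intro n x
    rw [spaceFracDeriv_fourier, hX', hX]
    refine congrFun (congrArg _ (funext fun u => ?_)) x
    rw [symbolPowMul, symbolPowMul, pow_succ']
    ring
  obtain ⟨ρ, hρ0, hρ⟩ := exists_norm_symbolPowMul_le hc hα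
  have hχi : Integrable χ := hχ.continuous.integrable_of_hasCompactSupport hc
  have key := eq_zero_of_hasCaputoDerivAt_succ hβ hβ1 hη hρ0
    (g := fun n s => (∫ x, M x s * (𝓕 (X n) : SchwartzMap ℝ ℂ) x) -
      ∫ x, N x s * (𝓕 (X n) : SchwartzMap ℝ ℂ) x) (fun n => ?_) (fun n s hs => ?_) (fun T hT => ?_) ht
  · have e : symbolPowMul α 0 χ = χ := funext fun u => by simp [symbolPowMul]
    simpa only [hX', sub_eq_zero, e] using key
  · simpa using (hM.initial (𝓕 (X n))).sub (hN.initial (𝓕 (X n)))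
  · have := (hM.equation (𝓕 (X n)) s hs).sub (hN.equation (𝓕 (X n)) s hs)
    simp only [hD] at this
    rwa [← mul_sub] at this
  -- The pairing is at most the mass of the solution times the `L¹` norm of the iterated symbol, so
  -- bounded mass on `(0, T]` gives one constant for the whole chain.
  · obtain ⟨C₁, hC₁⟩ := hM.bounded T hT
    obtain ⟨C₂, hC₂⟩ := hN.bounded T hT
    refine ⟨(C₁ + C₂) * ∫ u, ‖χ u‖, fun n s hs => ?_⟩
    simp only [hX']
    have h1 := integral_norm_symbolPowMul_le hχi hρ n
    have h2 : 0 ≤ ∫ u, ‖symbolPowMul α n χ u‖ := integral_nonneg fun _ => norm_nonneg _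
    have h3 : 0 ≤ ∫ x, ‖M x s‖ := integral_nonneg fun _ => norm_nonneg _
    have h4 : 0 ≤ ∫ x, ‖N x s‖ := integral_nonneg fun _ => norm_nonneg _
    have h5 := hC₁ s hs
    have h6 := hC₂ s hs
    calc _ ≤ ‖∫ x, M x s * 𝓕 (symbolPowMul α n χ) x‖ + ‖∫ x, N x s * 𝓕 (symbolPowMul α n χ) x‖ :=
          norm_sub_le _ _
      _ ≤ (∫ x, ‖M x s‖) * (∫ u, ‖symbolPowMul α n χ u‖) +
          (∫ x, ‖N x s‖) * ∫ u, ‖symbolPowMul α n χ u‖ :=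
        add_le_add (norm_integral_mul_fourier_le (hM.integrable s hs.1))
          (norm_integral_mul_fourier_le (hN.integrable s hs.1))
      _ = ((∫ x, ‖M x s‖) + ∫ x, ‖N x s‖) * ∫ u, ‖symbolPowMul α n χ u‖ := by ring
      _ ≤ (C₁ + C₂) * (ρ ^ n * ∫ u, ‖χ u‖) := by
        have h7 : 0 ≤ C₁ + C₂ := by linarith
        gcongr
      _ = _ := by ring

theorem continuous_fourier_of_integrable {f : ℝ → ℂ} (hf : Integrable f) : Continuous (𝓕 f) :=
  VectorFourier.fourierIntegral_continuous Real.continuous_fourierChar (L := innerₗ ℝ)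
    continuous_inner hf

/-- Proved by duality: every test function is `𝓕` of a Schwartz function, and transposing `𝓕` onto
`f` makes each pairing vanish. No inversion of `𝓕 f` is needed. -/
theorem ae_eq_zero_of_fourier_ae_eq_zero {f : ℝ → ℂ} (hf : Integrable f)
    (h : ∀ᵐ u : ℝ, 𝓕 f u = 0) : ∀ᵐ x : ℝ, f x = 0 := by
  refine ae_eq_zero_of_integral_contDiff_smul_eq_zero hf.locallyIntegrable fun g hg hgc => ?_
  have hgc' : HasCompactSupport fun x => (g x : ℂ) := hgc.comp_left Complex.ofReal_zero
  let φ : SchwartzMap ℝ ℂ := hgc'.toSchwartzMap (Complex.ofRealCLM.contDiff.comp hg)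
  have h1 : ∫ x, f x * (𝓕 (𝓕⁻ φ : SchwartzMap ℝ ℂ) : SchwartzMap ℝ ℂ) x = 0 := by
    rw [SchwartzMap.fourier_coe, integral_mul_fourier hf (SchwartzMap.integrable _)]
    refine integral_eq_zero_of_ae ?_
    filter_upwards [h] with u hu
    simp [hu]
  rw [fourier_fourierInv_schwartz] at h1
  rw [← h1]
  congr 1
  funext x
  rw [Complex.real_smul, mul_comm]
  rfl

/-- Testing with `χ` supported off `0` shows that the transform of the difference vanishes at almost
every nonzero frequency, and `{0}` is a null set. -/
theorem IsFundamentalSolution.ae_eq {M N : ℝ → ℝ → ℂ} (hM : IsFundamentalSolution α β η M)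
    (hN : IsFundamentalSolution α β η N) (hα : 0 < α) (hβ : 0 < β) (hβ1 : β ≤ 1) (hη : 0 < η)
    {t : ℝ} (ht : 0 < t) : ∀ᵐ x : ℝ, M x t = N x t := by
  have hi : Integrable fun x => M x t - N x t := (hM.integrable t ht).sub (hN.integrable t ht)
  have h1 : ∀ᵐ u : ℝ, u ∈ ({0}ᶜ : Set ℝ) → 𝓕 (fun x => M x t - N x t) u = 0 := by
    refine isOpen_compl_singleton.ae_eq_zero_of_integral_contDiff_smul_eq_zero
      ((continuous_fourier_of_integrable hi).locallyIntegrable.locallyIntegrableOn _)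
      fun g hg hgc hgs => ?_
    have hgc' : HasCompactSupport fun x => (g x : ℂ) := hgc.comp_left Complex.ofReal_zero
    have hg' : ContDiff ℝ (⊤ : ℕ∞) fun x => (g x : ℂ) := Complex.ofRealCLM.contDiff.comp hg
    have hg0 : (0 : ℝ) ∉ tsupport fun x => (g x : ℂ) := fun h =>
      hgs (tsupport_comp_subset Complex.ofReal_zero g h) rfl
    have h2 := hM.integral_mul_fourier_eq hN hα hβ hβ1 hη hg' hgc' hg0 ht
    have hgi : Integrable fun x => (g x : ℂ) := hg'.continuous.integrable_of_hasCompactSupport hgc'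
    have h3 : ∫ u, g u • 𝓕 (fun x => M x t - N x t) u =
        ∫ u, 𝓕 (fun x => M x t - N x t) u * (g u : ℂ) := by
      congr 1
      funext u
      rw [Complex.real_smul, mul_comm]
    rw [h3, ← integral_mul_fourier hi hgi]
    simp only [sub_mul]
    rw [integral_sub, h2, sub_self]
    · exact (hM.integrable t ht).mul_bdd (c := ∫ x, ‖(g x : ℂ)‖)
        (continuous_fourier_of_integrable hgi).aestronglyMeasurable
        (Eventually.of_forall fun x => VectorFourier.norm_fourierIntegral_le_integral_norm _ _ _ _ x)
    · exact (hN.integrable t ht).mul_bdd (c := ∫ x, ‖(g x : ℂ)‖)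
        (continuous_fourier_of_integrable hgi).aestronglyMeasurable
        (Eventually.of_forall fun x => VectorFourier.norm_fourierIntegral_le_integral_norm _ _ _ _ x)
  have h2 : ∀ᵐ u : ℝ, 𝓕 (fun x => M x t - N x t) u = 0 := by
    filter_upwards [h1, ae_ne_zero_real] with u hu hu0
    exact hu hu0
  filter_upwards [ae_eq_zero_of_fourier_ae_eq_zero hi h2] with x hx
  exact sub_eq_zero.1 hx

end Uniqueness

end

/-! ### The case `β = 1`: Fourier inversion, the limit in `α`, and stable laws. -/

noncomputable section

open scoped FourierTransform

/-! ### First order in time: the Fourier transform of the solution -/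

theorem mlKernel_one {s : ℂ} (h1 : -1 < s.re) :
    mlKernel 1 s = Complex.Gamma (-s) := by
  have h3 := Gamma_neg_mul_Gamma_one_add s
  have h4 : Complex.Gamma (1 + s) ≠ 0 := Complex.Gamma_ne_zero_of_re_pos (by
    rw [Complex.add_re, Complex.one_re]; linarith)
  rw [mlKernel, Complex.ofReal_one, one_mul, ← div_eq_mul_inv, div_eq_iff h4, h3]

/-- For `β = 1` the kernel is `Γ(-s)`, and Mellin inversion of the Gamma integral, with `s` replaced
by `-s`, gives the exponential. -/
theorem mellinBarnes_mlKernel_one {r : ℝ} (hr : 0 < r) :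
    mellinBarnes (mlKernel 1) (-1 / 2) r⁻¹ = ((Real.exp (-r) : ℝ) : ℂ) := by
  have hg : ∀ y : ℝ, mellin (fun v : ℝ => ((Real.exp (-v) : ℝ) : ℂ)) (((1 / 2 : ℝ) : ℂ) + y * Complex.I) =
      mlKernel 1 (((-1 / 2 : ℝ) : ℂ) + (-y : ℝ) * Complex.I) := by
    intro y
    have h2 : (((1 / 2 : ℝ) : ℂ) + y * Complex.I).re = 1 / 2 := by simp
    have h3 : (((-1 / 2 : ℝ) : ℂ) + (-y : ℝ) * Complex.I).re = -1 / 2 := by simp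
    rw [← Complex.GammaIntegral_eq_mellin, ← Complex.Gamma_eq_integral (by rw [h2]; norm_num),
      mlKernel_one (by rw [h3]; norm_num)]
    congr 1
    push_cast
    ring
  have hK := (integrable_mlKernel_line (β := 1) one_pos le_rfl (σ := -1 / 2) (by norm_num) (by norm_num)
    (by norm_num)).comp_neg
  have hinv := mellinInv_mellin_eq (1 / 2) (fun v : ℝ => ((Real.exp (-v) : ℝ) : ℂ)) hr
    (by
      have := Complex.GammaIntegral_convergent (s := ((1 / 2 : ℝ) : ℂ)) (by simp)
      simpa only [MellinConvergent, smul_eq_mul, mul_comm] using this)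
    (by simpa only [Complex.VerticalIntegrable, hg] using hK) (by fun_prop)
  rw [← hinv, mellinBarnes, mellinInv, ← integral_neg_eq_self]
  simp only [hg, Complex.real_smul, smul_eq_mul]
  push_cast
  congr 2
  funext y
  rw [ofReal_cpow_eq_exp hr, show ((r : ℂ))⁻¹ = ((r⁻¹ : ℝ) : ℂ) by push_cast; rfl,
    ofReal_cpow_eq_exp (inv_pos.2 hr), Real.log_inv, mul_comm]
  congr 2
  push_cast
  ring

section StableFourier

variable {α η t : ℝ}

/-- The contour formula excludes `u = 0`; both sides are continuous, so the identity extends to it.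
-/
theorem fourier_foxSolution_one (hα : 0 < α) (hη : 0 < η) (ht : 0 < t) (u : ℝ) :
    𝓕 (fun x => foxSolution α 1 η x t) u =
      ((Real.exp (-(η * t * |2 * Real.pi * u| ^ α)) : ℝ) : ℂ) := by
  have h1 : ∀ u ∈ ({0}ᶜ : Set ℝ), 𝓕 (fun x => foxSolution α 1 η x t) u =
      ((Real.exp (-(η * t * |2 * Real.pi * u| ^ α)) : ℝ) : ℂ) := by
    intro u hu
    have hw := freqSymbol_pos α hη hu
    unfold freqSymbol at hw
    rw [fourier_foxSolution hα one_pos le_rfl hη ht hu, Real.rpow_one,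
      mellinBarnes_mlKernel_one (mul_pos ht hw)]
    congr 3
    ring
  have hc : Continuous fun u : ℝ => ((Real.exp (-(η * t * |2 * Real.pi * u| ^ α)) : ℝ) : ℂ) := by
    have : Continuous fun u : ℝ => |2 * Real.pi * u| ^ α :=
      Continuous.rpow_const (by fun_prop) (fun _ => Or.inr hα.le)
    fun_prop
  exact congrFun (Continuous.ext_on (dense_compl_singleton 0) (continuous_fourier_of_integrable
    (integrable_foxSolution hα one_pos le_rfl hη ht)) hc h1) u

theorem integrable_exp_neg_mul_abs_rpow (hα : 0 < α) {c : ℝ} (hc : 0 < c) :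
    Integrable fun u : ℝ => ((Real.exp (-(c * |2 * Real.pi * u| ^ α)) : ℝ) : ℂ) := by
  have h1 : IntegrableOn (fun v : ℝ => ((Real.exp (-(c * v ^ α)) : ℝ) : ℂ)) (Set.Ioi 0) := by
    have := integrableOn_rpow_mul_exp_neg_mul_rpow (p := α) (s := 0) (b := c) (by norm_num) hα hc
    simp only [Real.rpow_zero, one_mul, neg_mul] at this
    exact this.ofReal
  exact (integrable_comp_abs h1).comp_mul_left' (R := 2 * Real.pi) (by simp [Real.pi_ne_zero])

theorem continuousAt_foxSolution {β : ℝ} (hα : 0 < α) (hβ : 0 < β) (hβ1 : β ≤ 1) (hη : 0 < η)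
    (ht : 0 < t) {x : ℝ} (hx : x ≠ 0) : ContinuousAt (fun x => foxSolution α β η x t) x := by
  have hc := solutionScale_pos α β hη ht
  simp only [foxSolution_eq_foxProfile hα hβ hβ1 hη _ ht]
  refine continuousAt_const.mul ?_
  obtain ⟨h1, h2, h3⟩ := min_bounds hα
  have h4 := continuousAt_mellinDensity (stripDecay_foxKernel hα hβ hβ1 h1 h2 (half_lt_self hα)) le_rfl
    (by linarith) (z := |x / solutionScale α β η t|) (by positivity)
  exact ContinuousAt.comp (f := fun x => |x / solutionScale α β η t|) h4 (by fun_prop)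

/-- Pointwise Fourier inversion applies at `x ≠ 0`, where the solution is continuous, since its
transform is integrable. -/
theorem foxSolution_one_eq_fourierInv (hα : 0 < α) (hη : 0 < η) (ht : 0 < t) {x : ℝ} (hx : x ≠ 0) :
    foxSolution α 1 η x t =
      𝓕⁻ (fun u : ℝ => ((Real.exp (-(η * t * |2 * Real.pi * u| ^ α)) : ℝ) : ℂ)) x := by
  have h1 : 𝓕 (fun x => foxSolution α 1 η x t) =
      fun u : ℝ => ((Real.exp (-(η * t * |2 * Real.pi * u| ^ α)) : ℝ) : ℂ) :=
    funext fun u => fourier_foxSolution_one hα hη ht u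
  have h2 := (integrable_foxSolution hα one_pos le_rfl hη ht).fourierInv_fourier_eq
    (by rw [h1]; exact integrable_exp_neg_mul_abs_rpow hα (mul_pos hη ht))
    (continuousAt_foxSolution hα one_pos le_rfl hη ht hx)
  rw [← h2, h1]

/-- The solution as an inverse Fourier integral. -/
theorem foxSolution_one_eq_integral (hα : 0 < α) (hη : 0 < η) (ht : 0 < t) {x : ℝ} (hx : x ≠ 0) :
    foxSolution α 1 η x t = ∫ u : ℝ, ((Real.exp (-(η * t * |2 * Real.pi * u| ^ α)) : ℝ) : ℂ) *
      Complex.exp (Complex.I * (2 * Real.pi * x : ℝ) * u) := by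
  rw [foxSolution_one_eq_fourierInv hα hη ht hx, fourierInv_eq_fourierTilde, fourierTilde]

/-- In the inverse Fourier integral the index enters only through the symbol. For all `a > 1` the
inequality `v - 1 ≤ v^a`, `v ≥ 0`, gives the common majorant `exp(ηt) exp(-ηt |2πu|)`. -/
theorem tendsto_foxSolution_one (hα : 1 < α) (hη : 0 < η) (ht : 0 < t) {x : ℝ} (hx : x ≠ 0) :
    Tendsto (fun a : ℝ => foxSolution a 1 η x t) (𝓝 α) (𝓝 (foxSolution α 1 η x t)) := by
  have hc := mul_pos hη ht
  have hev : ∀ᶠ a : ℝ in 𝓝 α, 1 < a := Ioi_mem_nhds hα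
  have h1 : Tendsto (fun a : ℝ => ∫ u : ℝ, ((Real.exp (-(η * t * |2 * Real.pi * u| ^ a)) : ℝ) : ℂ) *
      Complex.exp (Complex.I * (2 * Real.pi * x : ℝ) * u)) (𝓝 α)
      (𝓝 (foxSolution α 1 η x t)) := by
    rw [foxSolution_one_eq_integral (one_pos.trans hα) hη ht hx]
    have hb := ((integrable_exp_neg_mul_abs_rpow (α := 1) one_pos hc).norm).const_mul
      (Real.exp (η * t))
    refine tendsto_integral_filter_of_dominated_convergence _ ?_ ?_ hb ?_
    · exact Eventually.of_forall fun a => Measurable.aestronglyMeasurable (by fun_prop)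
    · filter_upwards [hev] with a ha
      refine Eventually.of_forall fun u => ?_
      have h2 : Complex.I * ((2 * Real.pi * x : ℝ) : ℂ) * u =
          ((2 * Real.pi * x * u : ℝ) : ℂ) * Complex.I := by push_cast; ring
      rw [norm_mul, h2, Complex.norm_exp_ofReal_mul_I, mul_one, Complex.norm_real, Complex.norm_real,
        Real.norm_of_nonneg (Real.exp_pos _).le, Real.norm_of_nonneg (Real.exp_pos _).le,
        ← Real.exp_add, Real.rpow_one]
      apply Real.exp_le_exp.2
      have h3 : |2 * Real.pi * u| - 1 ≤ |2 * Real.pi * u| ^ a := by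
        rcases le_total |2 * Real.pi * u| 1 with h | h
        · have : 0 ≤ |2 * Real.pi * u| ^ a := by positivity
          linarith
        · have := Real.self_le_rpow_of_one_le h ha.le
          linarith
      nlinarith
    · filter_upwards [ae_ne_zero_real] with u hu
      have h4 : |2 * Real.pi * u| ≠ 0 := by simp [hu, Real.pi_ne_zero]
      have h5 : ContinuousAt (fun a : ℝ => |2 * Real.pi * u| ^ a) α :=
        Real.continuousAt_const_rpow h4
      have h6 : ContinuousAt (fun a : ℝ => ((Real.exp (-(η * t * |2 * Real.pi * u| ^ a)) : ℝ) : ℂ) *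
          Complex.exp (Complex.I * (2 * Real.pi * x : ℝ) * u)) α := by fun_prop
      exact h6.tendsto
  refine h1.congr' ?_
  filter_upwards [hev] with a ha
  exact (foxSolution_one_eq_integral (one_pos.trans ha) hη ht hx).symm

end StableFourier

end

noncomputable section

open scoped FourierTransform

/-! ### The symmetrised Pareto law -/

section Pareto

variable {α : ℝ}

/-- The integral of `1 - cos` against the tail of the Lévy measure of index `α`. -/
def levyTail (α h : ℝ) : ℝ := ∫ u in Set.Ioi h, α * u ^ (-1 - α) * (1 - Real.cos u)

theorem levy_nonneg (hα : 0 < α) {u : ℝ} (hu : 0 < u) : 0 ≤ α * u ^ (-1 - α) * (1 - Real.cos u) := by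
  have := Real.cos_le_one u
  have : 0 ≤ 1 - Real.cos u := by linarith
  positivity

/-- Near `0` the bound `1 - cos u ≤ u²/2` gives `u^(1-α)`, integrable as `α < 2`; at infinity
`u^(-1-α)` suffices as `α > 0`. -/
theorem integrableOn_levy (hα : 0 < α) (hα2 : α < 2) :
    IntegrableOn (fun u : ℝ => α * u ^ (-1 - α) * (1 - Real.cos u)) (Set.Ioi 0) := by
  rw [← Set.Ioc_union_Ioi_eq_Ioi zero_le_one]
  refine IntegrableOn.union ?_ ?_
  · have h1 : IntegrableOn (fun u : ℝ => α / 2 * u ^ (1 - α)) (Set.Ioc 0 1) := by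
      rw [integrableOn_Ioc_iff_integrableOn_Ioo]
      exact ((intervalIntegral.integrableOn_Ioo_rpow_iff one_pos).2 (by linarith)).const_mul _
    refine Integrable.mono' h1 (Measurable.aestronglyMeasurable (by fun_prop)) ?_
    refine (ae_restrict_mem measurableSet_Ioc).mono fun u hu => ?_
    rw [Real.norm_of_nonneg (levy_nonneg hα hu.1)]
    have h2 : 1 - Real.cos u ≤ u ^ (2 : ℝ) / 2 := by
      rw [Real.rpow_two]
      linarith [Real.one_sub_sq_div_two_le_cos (x := u)]
    have h3 : u ^ (1 - α) = u ^ (-1 - α) * u ^ (2 : ℝ) := by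
      rw [← Real.rpow_add hu.1]
      congr 1
      ring
    have h4 : 0 < u ^ (-1 - α) := Real.rpow_pos_of_pos hu.1 _
    rw [h3]
    calc _ ≤ α * u ^ (-1 - α) * (u ^ (2 : ℝ) / 2) := by gcongr
      _ = _ := by ring
  · have h1 : IntegrableOn (fun u : ℝ => 2 * α * u ^ (-1 - α)) (Set.Ioi 1) :=
      (integrableOn_Ioi_rpow_of_lt (by linarith) one_pos).const_mul _
    refine Integrable.mono' h1 (Measurable.aestronglyMeasurable (by fun_prop)) ?_
    refine (ae_restrict_mem measurableSet_Ioi).mono fun u hu => ?_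
    have hu0 : 0 < u := one_pos.trans hu
    rw [Real.norm_of_nonneg (levy_nonneg hα hu0)]
    have h2 : 1 - Real.cos u ≤ 2 := by linarith [Real.neg_one_le_cos u]
    calc _ ≤ α * u ^ (-1 - α) * 2 := by gcongr
      _ = _ := by ring

theorem tendsto_levyTail (hα : 0 < α) (hα2 : α < 2) :
    Tendsto (levyTail α) (𝓝[>] 0) (𝓝 (levyTail α 0)) := by
  have hi := integrableOn_levy hα hα2
  have h1 : ∀ h : ℝ, 0 < h → levyTail α h = ∫ u in Set.Ioi 0, (Set.Ioi h).indicator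
      (fun u : ℝ => α * u ^ (-1 - α) * (1 - Real.cos u)) u := by
    intro h hh
    rw [setIntegral_indicator measurableSet_Ioi, Set.Ioi_inter_Ioi, sup_eq_right.2 hh.le, levyTail]
  have h2 : Tendsto (fun h : ℝ => ∫ u in Set.Ioi 0, (Set.Ioi h).indicator
      (fun u : ℝ => α * u ^ (-1 - α) * (1 - Real.cos u)) u) (𝓝[>] 0) (𝓝 (levyTail α 0)) := by
    refine tendsto_integral_filter_of_dominated_convergence _ ?_ ?_ hi.norm ?_
    · exact Eventually.of_forall fun h => hi.aestronglyMeasurable.indicator measurableSet_Ioi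
    · exact Eventually.of_forall fun h => Eventually.of_forall fun u => norm_indicator_le_norm_self _ _
    · refine (ae_restrict_mem measurableSet_Ioi).mono fun u hu => ?_
      refine tendsto_const_nhds.congr' ?_
      filter_upwards [nhdsWithin_le_nhds (Iio_mem_nhds hu)] with h hh
      rw [Set.indicator_of_mem (Set.mem_Ioi.2 hh)]
  refine h2.congr' ?_
  filter_upwards [self_mem_nhdsWithin] with h hh
  exact (h1 h hh).symm

theorem levyTail_zero_pos (hα : 0 < α) (hα2 : α < 2) : 0 < levyTail α 0 := by
  rw [levyTail, setIntegral_pos_iff_support_of_nonneg_ae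
    ((ae_restrict_mem measurableSet_Ioi).mono fun u hu => levy_nonneg hα hu) (integrableOn_levy hα hα2)]
  have h1 : Set.Ioo (0 : ℝ) 1 ⊆ Function.support
      (fun u : ℝ => α * u ^ (-1 - α) * (1 - Real.cos u)) ∩ Set.Ioi 0 := by
    intro u hu
    refine ⟨?_, hu.1⟩
    have h2 := Real.cos_lt_cos_of_nonneg_of_le_pi le_rfl (by linarith [Real.pi_gt_three, hu.2]) hu.1
    rw [Real.cos_zero] at h2
    have h3 : 0 < 1 - Real.cos u := by linarith
    have h4 : 0 < u ^ (-1 - α) := Real.rpow_pos_of_pos hu.1 _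
    exact (mul_pos (mul_pos hα h4) h3).ne'
  exact lt_of_lt_of_le (by simp) (measure_mono h1)

/-- The density of the symmetrised Pareto law, as a function of the absolute value. -/
def paretoDensity (α v : ℝ) : ℝ := (Set.Ioi 1).indicator (fun v : ℝ => α / 2 * v ^ (-1 - α)) v

theorem measurable_paretoDensity (α : ℝ) : Measurable (paretoDensity α) :=
  Measurable.indicator (by fun_prop) measurableSet_Ioi

theorem paretoDensity_nonneg (hα : 0 < α) (v : ℝ) : 0 ≤ paretoDensity α v :=
  Set.indicator_nonneg (fun v hv => by
    have : (0 : ℝ) < v := one_pos.trans hv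
    positivity) v

theorem setIntegral_paretoDensity_mul (α : ℝ) (f : ℝ → ℝ) :
    ∫ v in Set.Ioi 0, paretoDensity α v * f v = ∫ v in Set.Ioi 1, α / 2 * v ^ (-1 - α) * f v := by
  have h : ∀ v, paretoDensity α v * f v =
      (Set.Ioi 1).indicator (fun v : ℝ => α / 2 * v ^ (-1 - α) * f v) v := by
    intro v
    rw [paretoDensity, Set.indicator_apply, Set.indicator_apply]
    split_ifs <;> simp
  simp only [h]
  rw [setIntegral_indicator measurableSet_Ioi, Set.Ioi_inter_Ioi, sup_eq_right.2 zero_le_one]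

theorem integrableOn_paretoDensity (hα : 0 < α) : IntegrableOn (paretoDensity α) (Set.Ioi 0) := by
  refine IntegrableOn.mono_set (t := Set.univ) ?_ (Set.subset_univ _)
  rw [integrableOn_univ]
  exact (integrable_indicator_iff measurableSet_Ioi).2
    ((integrableOn_Ioi_rpow_of_lt (by linarith) one_pos).const_mul _)

theorem setIntegral_paretoDensity (hα : 0 < α) : ∫ v in Set.Ioi 0, paretoDensity α v = 1 / 2 := by
  have h := setIntegral_paretoDensity_mul α fun _ => 1
  simp only [mul_one] at h
  rw [h, integral_const_mul, integral_Ioi_rpow_of_lt (by linarith) one_pos, Real.one_rpow]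
  have : -1 - α + 1 = -α := by ring
  rw [this]
  field_simp

/-- The symmetrised Pareto law. -/
def symmetricPareto (α : ℝ) : Measure ℝ :=
  volume.withDensity fun x => ENNReal.ofReal (paretoDensity α |x|)

theorem isProbabilityMeasure_symmetricPareto (hα : 0 < α) :
    IsProbabilityMeasure (symmetricPareto α) where
  measure_univ := by
    rw [symmetricPareto, withDensity_apply _ MeasurableSet.univ, setLIntegral_univ,
      ← ofReal_integral_eq_lintegral_ofReal (integrable_comp_abs (integrableOn_paretoDensity hα))
        (Eventually.of_forall fun x => paretoDensity_nonneg hα _), integral_comp_abs,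
      setIntegral_paretoDensity hα]
    norm_num

theorem setIntegral_paretoDensity_mul_cos {k : ℝ} (hk : 0 < k) :
    ∫ v in Set.Ioi 0, paretoDensity α v * (2 * (1 - Real.cos (k * v))) = k ^ α * levyTail α k := by
  rw [setIntegral_paretoDensity_mul]
  have h1 := integral_comp_mul_left_Ioi (fun u : ℝ => α * u ^ (-1 - α) * (1 - Real.cos u)) 1 hk
  rw [mul_one, smul_eq_mul] at h1
  have h2 : k ^ α = k ^ (1 + α) * k⁻¹ := by
    rw [← Real.rpow_neg_one, ← Real.rpow_add hk]
    congr 1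
    ring
  rw [levyTail, h2, mul_assoc, ← h1, ← integral_const_mul]
  refine setIntegral_congr_fun measurableSet_Ioi fun v hv => ?_
  have hv0 : 0 ≤ v := zero_le_one.trans (le_of_lt hv)
  rw [Real.mul_rpow hk.le hv0]
  have h3 : k ^ (1 + α) * k ^ (-1 - α) = 1 := by
    rw [← Real.rpow_add hk, show 1 + α + (-1 - α) = 0 by ring, Real.rpow_zero]
  linear_combination (-(α * v ^ (-1 - α) * (1 - Real.cos (k * v)))) * h3

/-- By symmetry only the cosine survives, and the scaling `u = |k| v` extracts `|k|^α`. Since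
`levyTail α` has a positive limit at `0+`, the law lies in the domain of attraction of the stable
law. -/
theorem charFun_symmetricPareto (hα : 0 < α) {k : ℝ} (hk : k ≠ 0) :
    charFun (symmetricPareto α) k = ((1 - |k| ^ α * levyTail α |k| : ℝ) : ℂ) := by
  have hp := integrableOn_paretoDensity hα
  have hm : Measurable fun x : ℝ => ENNReal.ofReal (paretoDensity α |x|) :=
    ((measurable_paretoDensity α).comp measurable_norm).ennreal_ofReal
  have hexp : ∀ x : ℝ, ‖Complex.exp (k * x * Complex.I)‖ = 1 := fun x => by
    rw [← Complex.ofReal_mul, Complex.norm_exp_ofReal_mul_I]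
  have hi : Integrable fun x : ℝ => (paretoDensity α |x| : ℂ) * Complex.exp (k * x * Complex.I) :=
    (integrable_comp_abs hp).ofReal.mul_bdd (c := 1)
      (Measurable.aestronglyMeasurable (by fun_prop)) (Eventually.of_forall fun x => (hexp x).le)
  have h1 : charFun (symmetricPareto α) k =
      ∫ x : ℝ, (paretoDensity α |x| : ℂ) * Complex.exp (k * x * Complex.I) := by
    rw [charFun_apply_real, symmetricPareto,
      integral_withDensity_eq_integral_toReal_smul₀ hm.aemeasurable (Eventually.of_forall fun x => by simp)]
    congr 1
    funext x
    rw [ENNReal.toReal_ofReal (paretoDensity_nonneg hα _), Complex.real_smul]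
  have hcos : IntegrableOn (fun v => paretoDensity α v * (2 * (1 - Real.cos (|k| * v)))) (Set.Ioi 0) := by
    refine hp.mul_bdd (c := 4) (Measurable.aestronglyMeasurable (by fun_prop))
      (Eventually.of_forall fun v => ?_)
    rw [Real.norm_eq_abs, abs_le]
    constructor <;> linarith [Real.cos_le_one (|k| * v), Real.neg_one_le_cos (|k| * v)]
  have h2 : ∀ v ∈ Set.Ioi (0 : ℝ), (paretoDensity α |v| : ℂ) * Complex.exp (k * v * Complex.I) +
      (paretoDensity α |(-v)| : ℂ) * Complex.exp (k * (-v : ℝ) * Complex.I) =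
      ((2 * paretoDensity α v - paretoDensity α v * (2 * (1 - Real.cos (|k| * v))) : ℝ) : ℂ) := by
    intro v hv
    have h3 : Real.cos (|k| * v) = Real.cos (k * v) := by
      rw [← Real.cos_abs (k * v), abs_mul, abs_of_pos (Set.mem_Ioi.1 hv)]
    have h4 := Complex.two_cos (x := ((k * v : ℝ) : ℂ))
    rw [abs_neg, abs_of_pos (Set.mem_Ioi.1 hv), h3]
    push_cast at h4 ⊢
    rw [show (k : ℂ) * -v * Complex.I = -(k * v) * Complex.I by ring]
    linear_combination (-(paretoDensity α v : ℂ)) * h4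
  rw [h1, integral_eq_integral_Ioi_add_comp_neg hi, setIntegral_congr_fun measurableSet_Ioi h2,
    integral_complex_ofReal, integral_sub (hp.const_mul 2) hcos, integral_const_mul,
    setIntegral_paretoDensity hα, setIntegral_paretoDensity_mul_cos (abs_pos.2 hk)]
  norm_num

/-- The stable characteristic function is a pointwise limit of characteristic functions. -/
theorem exists_tendsto_charFun (hα : 0 < α) (hα2 : α < 2) {c : ℝ} (hc : 0 < c) :
    ∃ ν : ℕ → Measure ℝ, (∀ n, IsProbabilityMeasure (ν n)) ∧ ∀ k : ℝ, k ≠ 0 →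
      Tendsto (fun n => charFun (ν n) k) atTop (𝓝 ((Real.exp (-(c * |k| ^ α)) : ℝ) : ℂ)) := by
  have hpow : ∀ (ν : Measure ℝ) [IsProbabilityMeasure ν] (n : ℕ), ∃ μ : Measure ℝ,
      IsProbabilityMeasure μ ∧ ∀ k, charFun μ k = charFun ν k ^ n := by
    intro ν _ n
    induction n with
    | zero => exact ⟨Measure.dirac 0, inferInstance, fun k => by simp⟩
    | succ n ih =>
      obtain ⟨μ, hμ, h⟩ := ih
      exact ⟨μ.conv ν, inferInstance, fun k => by rw [charFun_conv, h, pow_succ]⟩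
  have hK := levyTail_zero_pos hα hα2
  have := isProbabilityMeasure_symmetricPareto hα
  -- The scale is chosen so that `h n ^ α * levyTail α 0 = c / n` for `n ≥ 1`; the characteristic
  -- function at `h n * k` is then `1 - c |k|^α / n + o(1/n)`, and its `n`-th power converges to the
  -- exponential.
  set h : ℕ → ℝ := fun n => (c / levyTail α 0 * (n : ℝ)⁻¹) ^ (1 / α) with hh
  have hscale : ∀ n, ∃ μ : Measure ℝ, IsProbabilityMeasure μ ∧
      ∀ k, charFun μ k = charFun (symmetricPareto α) (h n * k) ^ n := by
    intro n
    have hm : Measurable fun x : ℝ => h n * x := by fun_prop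
    have := Measure.isProbabilityMeasure_map (μ := symmetricPareto α) hm.aemeasurable
    obtain ⟨μ, hμ, hμ'⟩ := hpow ((symmetricPareto α).map fun x => h n * x) n
    exact ⟨μ, hμ, fun k => by rw [hμ', charFun_map_mul]⟩
  choose ν hν hν' using hscale
  refine ⟨ν, hν, fun k hk => ?_⟩
  have hk' := abs_pos.2 hk
  have hlim0 : Tendsto (fun n => h n * |k|) atTop (𝓝[>] 0) := by
    refine tendsto_nhdsWithin_iff.2 ⟨?_, ?_⟩
    · have h1 : Tendsto (fun n : ℕ => c / levyTail α 0 * (n : ℝ)⁻¹) atTop (𝓝 0) := by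
        simpa using tendsto_natCast_atTop_atTop.inv_tendsto_atTop.const_mul (c / levyTail α 0)
      have h2 := (Real.continuousAt_rpow_const 0 (1 / α) (Or.inr (by positivity))).tendsto.comp h1
      rw [Real.zero_rpow (by positivity)] at h2
      have h3 := h2.mul_const |k|
      rwa [zero_mul] at h3
    · filter_upwards [eventually_gt_atTop 0] with n hn
      have : (0 : ℝ) < n := Nat.cast_pos.2 hn
      simp only [hh, Set.mem_Ioi]
      positivity
  have hlim : Tendsto (fun n : ℕ => (n : ℂ) * (charFun (symmetricPareto α) (h n * k) - 1)) atTop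
      (𝓝 ((-(c * |k| ^ α) : ℝ) : ℂ)) := by
    have h1 : Tendsto (fun n => ((-(c / levyTail α 0 * |k| ^ α * levyTail α (h n * |k|)) : ℝ) : ℂ)) atTop
        (𝓝 ((-(c / levyTail α 0 * |k| ^ α * levyTail α 0) : ℝ) : ℂ)) :=
      (Complex.continuous_ofReal.tendsto _).comp
        (((tendsto_levyTail hα hα2).comp hlim0).const_mul _).neg
    have h2 : c / levyTail α 0 * |k| ^ α * levyTail α 0 = c * |k| ^ α := by
      field_simp
    rw [h2] at h1
    refine h1.congr' ?_
    filter_upwards [eventually_gt_atTop 0] with n hn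
    have hn' : (0 : ℝ) < n := Nat.cast_pos.2 hn
    have hb : 0 < c / levyTail α 0 * (n : ℝ)⁻¹ := by positivity
    have hhn : 0 < h n := Real.rpow_pos_of_pos hb _
    have h3 : h n ^ α = c / levyTail α 0 * (n : ℝ)⁻¹ := by
      rw [hh]
      simp only
      rw [← Real.rpow_mul hb.le, one_div, inv_mul_cancel₀ hα.ne', Real.rpow_one]
    rw [charFun_symmetricPareto hα (mul_ne_zero hhn.ne' hk), abs_mul, abs_of_pos hhn,
      Real.mul_rpow hhn.le hk'.le, h3]
    have hn0 : (n : ℂ) ≠ 0 := Nat.cast_ne_zero.2 hn.ne'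
    push_cast
    field_simp
    ring
  have := Complex.tendsto_one_add_pow_exp_of_tendsto hlim
  rw [Complex.ofReal_exp]
  refine this.congr fun n => ?_
  rw [hν', add_sub_cancel]

end Pareto

end

noncomputable section

open scoped FourierTransform

/-! ### Positivity of the density -/

section Positivity

theorem isClosed_nonneg_complex : IsClosed {z : ℂ | z.im = 0 ∧ 0 ≤ z.re} :=
  (isClosed_eq Complex.continuous_im continuous_const).inter
    (isClosed_le continuous_const Complex.continuous_re)

theorem norm_exp_I_mul (x u : ℝ) : ‖Complex.exp (Complex.I * x * u)‖ = 1 := by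
  rw [show Complex.I * (x : ℂ) * u = ((x * u : ℝ) : ℂ) * Complex.I by push_cast; ring,
    Complex.norm_exp_ofReal_mul_I]

theorem integrable_gaussian {δ : ℝ} (hδ : 0 < δ) : Integrable fun u : ℝ => Real.exp (-(δ * u ^ 2)) := by
  simpa only [neg_mul] using integrable_exp_neg_mul_sq hδ

theorem integral_gaussian_mul_exp {δ : ℝ} (hδ : 0 < δ) (s : ℝ) :
    ∫ u : ℝ, ((Real.exp (-(δ * u ^ 2)) : ℝ) : ℂ) * Complex.exp (Complex.I * s * u) =
      (((Real.pi / δ) ^ (1 / 2 : ℝ) * Real.exp (-s ^ 2 / (4 * δ)) : ℝ) : ℂ) := by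
  have h := fourierIntegral_gaussian (b := δ) (by simpa using hδ) s
  rw [Complex.ofReal_mul, Complex.ofReal_cpow (by positivity)]
  push_cast
  rw [← h]
  congr 1
  funext u
  rw [mul_comm, neg_mul]

/-- Gaussian smoothing of a characteristic function has a nonnegative Fourier integral. -/
theorem integral_charFun_mul_gaussian_nonneg (ν : Measure ℝ) [IsProbabilityMeasure ν] {δ : ℝ}
    (hδ : 0 < δ) (x : ℝ) :
    ∫ u : ℝ, charFun ν (2 * Real.pi * u) * (((Real.exp (-(δ * u ^ 2)) : ℝ) : ℂ) *
      Complex.exp (Complex.I * (2 * Real.pi * x : ℝ) * u)) ∈ {z : ℂ | z.im = 0 ∧ 0 ≤ z.re} := by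
  have h1 : ∀ u : ℝ, charFun ν (2 * Real.pi * u) * (((Real.exp (-(δ * u ^ 2)) : ℝ) : ℂ) *
      Complex.exp (Complex.I * (2 * Real.pi * x : ℝ) * u)) =
      ∫ y, ((Real.exp (-(δ * u ^ 2)) : ℝ) : ℂ) *
        Complex.exp (Complex.I * (2 * Real.pi * (x + y) : ℝ) * u) ∂ν := by
    intro u
    rw [charFun_apply_real, ← integral_mul_const]
    congr 1
    funext y
    rw [mul_left_comm, ← Complex.exp_add]
    congr 2
    push_cast
    ring
  have hi : Integrable (Function.uncurry fun (u y : ℝ) => ((Real.exp (-(δ * u ^ 2)) : ℝ) : ℂ) *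
      Complex.exp (Complex.I * (2 * Real.pi * (x + y) : ℝ) * u)) (volume.prod ν) := by
    have h2 : Integrable (fun p : ℝ × ℝ => Real.exp (-(δ * p.1 ^ 2)) * (1 : ℝ)) (volume.prod ν) :=
      (integrable_gaussian hδ).mul_prod (integrable_const (1 : ℝ))
    refine h2.mono' (Measurable.aestronglyMeasurable (by unfold Function.uncurry; fun_prop))
      (Eventually.of_forall fun p => ?_)
    simp only [Function.uncurry]
    rw [norm_mul, norm_exp_I_mul, Complex.norm_real, Real.norm_of_nonneg (Real.exp_pos _).le]
  simp only [h1]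
  rw [integral_integral_swap hi]
  simp only [integral_gaussian_mul_exp hδ]
  rw [integral_complex_ofReal]
  refine ⟨Complex.ofReal_im _, ?_⟩
  rw [Complex.ofReal_re]
  exact integral_nonneg fun y => by positivity

variable {α η t : ℝ}

/-- For `α < 2` the inverse Fourier integral is damped by `exp(-δ u²)`. With this damping it is a
limit of integrals of characteristic functions, which are averages of Gaussians. The factor is then
removed by `δ → 0+`, and both limits stay in the closed set of nonnegative reals. -/
theorem foxSolution_one_nonneg (hα : 0 < α) (hα2 : α ≤ 2) (hη : 0 < η) (ht : 0 < t) {x : ℝ}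
    (hx : x ≠ 0) : (foxSolution α 1 η x t).im = 0 ∧ 0 ≤ (foxSolution α 1 η x t).re := by
  rcases eq_or_lt_of_le hα2 with rfl | hlt
  · rw [foxSolution_two_eq_gaussian hη hx ht]
    refine ⟨Complex.ofReal_im _, ?_⟩
    rw [Complex.ofReal_re]
    positivity
  have hc := mul_pos hη ht
  obtain ⟨ν, hν, hlim⟩ := exists_tendsto_charFun hα hlt hc
  have hE : ∀ u : ℝ, ‖((Real.exp (-(η * t * |2 * Real.pi * u| ^ α)) : ℝ) : ℂ)‖ ≤ 1 := fun u => by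
    rw [Complex.norm_real, Real.norm_of_nonneg (Real.exp_pos _).le]
    exact Real.exp_le_one_iff.2 (neg_nonpos.2 (by positivity))
  have h1 : ∀ δ : ℝ, 0 < δ → ∫ u : ℝ, ((Real.exp (-(η * t * |2 * Real.pi * u| ^ α)) : ℝ) : ℂ) *
      (((Real.exp (-(δ * u ^ 2)) : ℝ) : ℂ) *
      Complex.exp (Complex.I * (2 * Real.pi * x : ℝ) * u)) ∈ {z : ℂ | z.im = 0 ∧ 0 ≤ z.re} := by
    intro δ hδ
    refine isClosed_nonneg_complex.mem_of_tendsto (b := atTop) (f := fun n : ℕ =>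
      ∫ u : ℝ, charFun (ν n) (2 * Real.pi * u) * (((Real.exp (-(δ * u ^ 2)) : ℝ) : ℂ) *
      Complex.exp (Complex.I * (2 * Real.pi * x : ℝ) * u))) ?_
      (Eventually.of_forall fun n => integral_charFun_mul_gaussian_nonneg (ν n) hδ x)
    refine tendsto_integral_of_dominated_convergence _ (fun n => ?_) (integrable_gaussian hδ)
      (fun n => Eventually.of_forall fun u => ?_) ?_
    · exact Measurable.aestronglyMeasurable (by fun_prop)
    · rw [norm_mul, norm_mul, norm_exp_I_mul, mul_one, Complex.norm_real,
        Real.norm_of_nonneg (Real.exp_pos _).le]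
      exact mul_le_of_le_one_left (Real.exp_pos _).le (norm_charFun_le_one _)
    · filter_upwards [ae_ne_zero_real] with u hu
      exact (hlim (2 * Real.pi * u) (by simp [hu, Real.pi_ne_zero])).mul_const _
  change foxSolution α 1 η x t ∈ {z : ℂ | z.im = 0 ∧ 0 ≤ z.re}
  rw [foxSolution_one_eq_integral hα hη ht hx]
  refine isClosed_nonneg_complex.mem_of_tendsto (b := 𝓝[>] (0 : ℝ)) (f := fun δ : ℝ =>
      ∫ u : ℝ, ((Real.exp (-(η * t * |2 * Real.pi * u| ^ α)) : ℝ) : ℂ) *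
      (((Real.exp (-(δ * u ^ 2)) : ℝ) : ℂ) *
      Complex.exp (Complex.I * (2 * Real.pi * x : ℝ) * u))) ?_ ?_
  · refine tendsto_integral_filter_of_dominated_convergence _ ?_ ?_
      (integrable_exp_neg_mul_abs_rpow hα hc).norm ?_
    · exact Eventually.of_forall fun δ => Measurable.aestronglyMeasurable (by fun_prop)
    · filter_upwards [self_mem_nhdsWithin] with δ hδ
      refine Eventually.of_forall fun u => ?_
      have hδ' : 0 < δ := hδ
      rw [norm_mul, norm_mul, norm_exp_I_mul, mul_one, Complex.norm_real (Real.exp (-(δ * u ^ 2))),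
        Real.norm_of_nonneg (Real.exp_pos _).le]
      exact mul_le_of_le_one_right (norm_nonneg _)
        (Real.exp_le_one_iff.2 (neg_nonpos.2 (by positivity)))
    · refine Eventually.of_forall fun u => ?_
      have h2 : Continuous fun δ : ℝ => ((Real.exp (-(η * t * |2 * Real.pi * u| ^ α)) : ℝ) : ℂ) *
          (((Real.exp (-(δ * u ^ 2)) : ℝ) : ℂ) *
          Complex.exp (Complex.I * (2 * Real.pi * x : ℝ) * u)) := by fun_prop
      have h3 := (h2.tendsto 0).mono_left (nhdsWithin_le_nhds (s := Set.Ioi 0))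
      simpa only [zero_mul, neg_zero, Real.exp_zero, Complex.ofReal_one, one_mul] using h3
  · filter_upwards [self_mem_nhdsWithin] with δ hδ
    exact h1 δ hδ

theorem isSymmetricStableLaw_foxSolution (hα : 0 < α) (hα2 : α ≤ 2) (hη : 0 < η) (ht : 0 < t) :
    IsSymmetricStableLaw α (η * t)
      (volume.withDensity fun x : ℝ => ENNReal.ofReal (foxSolution α 1 η x t).re) := by
  have hpi := Real.pi_pos
  have hi := integrable_foxSolution hα one_pos le_rfl hη ht
  have hm : AEMeasurable (fun x : ℝ => ENNReal.ofReal (foxSolution α 1 η x t).re) volume :=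
    (Complex.measurable_re.comp_aemeasurable hi.aemeasurable).ennreal_ofReal
  have hchar : ∀ k : ℝ, charFun (volume.withDensity fun x : ℝ =>
      ENNReal.ofReal (foxSolution α 1 η x t).re) k =
      ((Real.exp (-(η * t * |k| ^ α)) : ℝ) : ℂ) := by
    intro k
    have h1 := fourier_foxSolution_one hα hη ht (-(k / (2 * Real.pi)))
    rw [fourier_eq_fourierTilde, fourierTilde] at h1
    have h2 : -(2 * Real.pi * -(k / (2 * Real.pi))) = k := by field_simp
    have h3 : |2 * Real.pi * -(k / (2 * Real.pi))| = |k| := by rw [← abs_neg, h2]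
    rw [h2, h3] at h1
    rw [← h1, charFun_apply_real, integral_withDensity_eq_integral_toReal_smul₀ hm
      (Eventually.of_forall fun x => by simp)]
    refine integral_congr_ae ?_
    filter_upwards [ae_ne_zero_real] with x hx
    obtain ⟨h4, h5⟩ := foxSolution_one_nonneg hα hα2 hη ht hx
    have h6 : (((foxSolution α 1 η x t).re : ℝ) : ℂ) = foxSolution α 1 η x t :=
      Complex.ext (by simp) (by simp [h4])
    rw [ENNReal.toReal_ofReal h5, Complex.real_smul, h6]
    congr 2
    ring
  refine ⟨⟨?_⟩, hchar⟩
  -- The total mass is the characteristic function at `0`, so the normalisation needs no separate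
  -- integral.
  have h0 := hchar 0
  rw [charFun_zero, abs_zero, Real.zero_rpow hα.ne', mul_zero, neg_zero, Real.exp_zero] at h0
  have h1 : (volume.withDensity fun x : ℝ => ENNReal.ofReal (foxSolution α 1 η x t).re).real
      Set.univ = 1 := by exact_mod_cast h0
  exact (ENNReal.toReal_eq_one_iff _).1 h1

end Positivity

end

/-! ### Assembly of the statements. -/

theorem corollary1p2 (α β η : ℝ) (hα : 0 < α) (hβ : 0 < β) (hβ1 : β ≤ 1) (hη : 0 < η) :
    -- the H-function in the formula is defined
    (∀ x t : ℝ, x ≠ 0 → 0 < t →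
      FoxHDefined 2 1 (upper33 α β) (lower33 α) ((|x| / (η * t ^ β) ^ (1 / α) : ℝ) : ℂ)) ∧
    -- the formula gives a solution, and every solution is given by it
    IsFundamentalSolution α β η (foxSolution α β η) ∧
    (∀ M : ℝ → ℝ → ℂ, IsFundamentalSolution α β η M → ∀ t : ℝ, 0 < t →
      ∀ᵐ x : ℝ, M x t = foxSolution α β η x t) ∧
    -- the case `β = 1`
    (∀ x t : ℝ, x ≠ 0 → 0 < t →
      FoxHDefined 1 1 ![(1, 1 / α), (1, 1 / 2)] ![(1, 1), (1, 1 / 2)]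
        ((|x| / (η ^ (1 / α) * t ^ (1 / α)) : ℝ) : ℂ) ∧
      foxSolution α 1 η x t = 1 / ((α * |x| : ℝ) : ℂ) *
        foxH 1 1 ![(1, 1 / α), (1, 1 / 2)] ![(1, 1), (1, 1 / 2)]
          ((|x| / (η ^ (1 / α) * t ^ (1 / α)) : ℝ) : ℂ)) ∧
    -- for `β = 1` and `α ≤ 2` the solution is the density of a Lévy stable law
    (α ≤ 2 → ∀ t : ℝ, 0 < t →
      (∀ x : ℝ, x ≠ 0 → (foxSolution α 1 η x t).im = 0 ∧ 0 ≤ (foxSolution α 1 η x t).re) ∧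
      IsSymmetricStableLaw α (η * t)
        (volume.withDensity fun x : ℝ => ENNReal.ofReal (foxSolution α 1 η x t).re)) ∧
    -- the case `β = 1`, `α = 2`
    (∀ x t : ℝ, x ≠ 0 → 0 < t →
      FoxHDefined 1 1 ![(1, 1 / 2), (1, 1 / 2)] ![(1, 1), (1, 1 / 2)]
        ((|x| / (η * t) ^ (1 / 2 : ℝ) : ℝ) : ℂ) ∧
      foxSolution 2 1 η x t = 1 / ((2 * |x| : ℝ) : ℂ) *
        foxH 1 1 ![(1, 1 / 2), (1, 1 / 2)] ![(1, 1), (1, 1 / 2)]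
          ((|x| / (η * t) ^ (1 / 2 : ℝ) : ℝ) : ℂ) ∧
      FoxHDefined 1 0 ![(1, 1 / 2)] ![(1, 1)] ((|x| / (η * t) ^ (1 / 2 : ℝ) : ℝ) : ℂ) ∧
      foxSolution 2 1 η x t = 1 / ((2 * |x| : ℝ) : ℂ) *
        foxH 1 0 ![(1, 1 / 2)] ![(1, 1)] ((|x| / (η * t) ^ (1 / 2 : ℝ) : ℝ) : ℂ) ∧
      foxSolution 2 1 η x t =
        (((4 * Real.pi * η * t) ^ (-1 / 2 : ℝ) * Real.exp (-(|x| ^ 2 / (4 * η * t))) : ℝ) : ℂ)) ∧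
    -- the limit `α → 2`, for `β = 1`
    (∀ x t : ℝ, x ≠ 0 → 0 < t →
      Tendsto (fun a : ℝ => foxSolution a 1 η x t) (𝓝 2)
        (𝓝 (((4 * Real.pi * η * t) ^ (-1 / 2 : ℝ) *
          Real.exp (-(|x| ^ 2 / (4 * η * t))) : ℝ) : ℂ))) := by
  refine ⟨fun x t hx ht => ?_, ?_, fun M hM t ht => ?_, fun x t hx ht => ?_, fun hα2 t ht => ⟨fun x hx => ?_, ?_⟩,
    fun x t hx ht => ?_, fun x t hx ht => ?_⟩
  · obtain ⟨h1, h2, h3⟩ := min_bounds hα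
    exact ⟨_, hasFoxH_33 hα hβ hβ1 (solution_arg_pos α β hη ht hx) h1 h2 (by linarith)⟩
  · exact isFundamentalSolution_foxSolution hα hβ hβ1 hη
  · exact hM.ae_eq (isFundamentalSolution_foxSolution hα hβ hβ1 hη) hα hβ hβ1 hη ht
  · have hx' := abs_pos.2 hx
    have h := hasFoxH_22 hα (z := |x| / (η ^ (1 / α) * t ^ (1 / α))) (γ := -1 / 2) (by positivity)
      (by norm_num) (by norm_num)
    refine ⟨⟨_, h⟩, ?_⟩
    rw [h.foxH_eq]
    exact foxSolution_one_eq hα hη hx ht (by norm_num) (by norm_num)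
  · exact foxSolution_one_nonneg hα hα2 hη ht hx
  · exact isSymmetricStableLaw_foxSolution hα hα2 hη ht
  · have hx' := abs_pos.2 hx
    have hz : 0 < |x| / (η * t) ^ (1 / 2 : ℝ) := by positivity
    have h22 := hasFoxH_22 two_pos hz (γ := -1 / 2) (by norm_num) (by norm_num)
    have h11 := hasFoxH_11 hz (γ := -1 / 2) (by norm_num)
    have h1 := foxSolution_one_eq two_pos hη hx ht (γ := -1 / 2) (by norm_num) (by norm_num)
    rw [← Real.mul_rpow hη.le ht.le] at h1
    refine ⟨⟨_, h22⟩, ?_, ⟨_, h11⟩, ?_, foxSolution_two_eq_gaussian hη hx ht⟩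
    · rw [h22.foxH_eq, h1]
    · rw [h11.foxH_eq]
      exact foxSolution_two hη hx ht (by norm_num)
  · rw [← foxSolution_two_eq_gaussian hη hx ht]
    exact tendsto_foxSolution_one one_lt_two hη ht hx
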